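/- **Setting.** Let $M$ be a smooth closed $n$-manifold and $X$ a smooth vector field on $M$; a *rest point* is a zero of $X$. For $m\in M$ let $\gamma_m$ be the trajectory of $X$ with $\gamma_m(0)=m$. For a rest point $x$ let $W^-_x$ (resp. $W^+_x$) be the set of $m$ with $\gamma_m(t)\to x$ as $t\to-\infty$ (resp. $t\to+\infty$). If $x$ is hyperbolic (no eigenvalue of the linearization $D_x(X):T_xM\to T_xM$ is purely imaginary or zero) these are injectively immersed manifolds, and $\operatorname{ind}(x)$ is the number of eigenvalues of $D_x(X)$ with positive real part, counted with algebraic multiplicity. Suppose that * $P_1$: all rest points are hyperbolic; * $P_2$: for all rest points $x,y$ the immersed manifolds $W^-_x$ and $W^+_y$ are transversal. **Spaces.** An *instanton* from $x$ to $y$ is a trajectory with limit $x$ at $-\infty$ and $y$ at $+\infty$, up to translation of time; $\mathcal T(x,y)$ is the set of these, and $\mathcal M(x,y)=W^-_x\cap W^+_y$. A *chain* from $x$ to $y$ consists of rest points $x=y_0,\dots,y_k=y$ ($k\ge 0$) with $\operatorname{ind}(y_0)>\dots>\operatorname{ind}(y_k)$ and instantons $\gamma^i\in\mathcal T(y_{i-1},y_i)$,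 $1\le i\le k$. Put * $\hat{\mathcal T}(x,y)=\mathcal T(x,y)\sqcup\{\text{chains from }x\text{ to }y\text{ with }k\ge 2\}$; * $\hat W^-_x=\{(\underline\gamma,m): \underline\gamma \text{ a chain from } x \text{ to some } y,\ m\in W^-_y\}$, with $\hat i^-_x(\underline\gamma,m)=m$; * $\hat W^+_x=\{(m,\underline\gamma): \underline\gamma \text{ a chain from some } y \text{ to } x,\ m\in W^+_y\}$, with $\hat i^+_x(m,\underline\gamma)=m$; * $\hat{\mathcal M}(x,z)=\{(\underline\gamma,m,\underline\gamma'): \underline\gamma\text{ a chain from }x\text{ to some }y,\ m\in\mathcal M(y,y'),\ \underline\gamma'\text{ a chain from some }y'\text{ to }z\}$, with $\hat i_{x,z}(\underline\gamma,m,\underline\gamma')=m$. It is identified with the set of $(u,v)\in\hat W^-_x\times\hat W^+_z$ with $\hat i^-_x(u)=\hat i^+_z(v)$. **Topology.** An element of $\hat{\mathcal T}(x,y)$ *lies in* $V\subseteq M$ if its instantons and all its rest points $y_0,\dots,y_k$ lie in $V$; an element $(\underline\gamma,m)$ of $\hat W^-_x$ lies in $V$ if $\underline\gamma$ (with its rest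 points) and $\gamma_m((-\infty,0])$ do. Let $(P_1,\dots,P_p)$ be $(\gamma^1,\dots,\gamma^k)$ for an element of $\hat{\mathcal T}(x,y)$ and $(\gamma^1,\dots,\gamma^k,\gamma_m)$ for an element of $\hat W^-_x$. A *transversal slice* to the element is a finite sequence $\underline U=(U_1,\dots,U_r)$ of pairwise disjoint embedded $(n-1)$-dimensional submanifolds of $M$, diffeomorphic to open discs and transversal to $X$, for which there are indices $a(1),\dots,a(r)\in\{1,\dots,p\}$ such that $U_j$ meets $P_{a(j)}$, $a(j+1)-a(j)\in\{0,1\}$, and each instanton $\gamma^i$, $1\le i\le k$, is $P_{a(j)}$ for some $j$ (the trajectory $\gamma_m$ of the end point may, but need not, be met). The *transversal slice topology* on $\hat{\mathcal T}(x,y)$ is generated by the sets of all elements that lie in $V$ and have $\underline U$ as a transversal slice, where $V\subseteq M$ is open and at least one element lies in $V$ and has $\underline U$ as a transversal slice. On $\hat W^-_x$ it is generated by the sets of all elements that lie in $V$, have $\underline U$ as a transversal slice, and have their end point $m$ in $O$, where $V,O\subseteq M$ are open and at least one element satisfies these conditions. The topology of $\hat W^+_x$ is obtained by replacing $X$ with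 $-X$, and $\hat{\mathcal M}(x,z)$ has the topology induced from $\hat W^-_x\times\hat W^+_z$. **Theorem 1.3.** For all rest points $x,y,z$ of $X$: 1. The spaces $\hat W^-_x$, $\hat W^+_x$, $\hat{\mathcal T}(x,y)$ and $\hat{\mathcal M}(x,z)$ are Hausdorff and paracompact, and the maps $\hat i^-_x:\hat W^-_x\to M$ and $\hat i_{x,z}:\hat{\mathcal M}(x,z)\to M$ are continuous. 2. If there is a smooth function $f:M\to\mathbb R$ with $X_m(f)<0$ for every $m$ that is not a rest point (a Lyapunov function), then $\hat W^-_x$, $\hat W^+_x$, $\hat{\mathcal T}(x,y)$ and $\hat{\mathcal M}(x,z)$ are compact. -/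

import Mathlib

open Set Filter Topology
open scoped Manifold ContDiff

noncomputable section

namespace BrokenFlow

variable {n : ℕ} {M : Type*} [TopologicalSpace M] [ChartedSpace (EuclideanSpace ℝ (Fin n)) M]

/-! ### Rest points, hyperbolicity, index, Lyapunov functions -/

/-- The linearization `D_x(X) : T_x M → T_x M` of a vector field at a rest point `x`: trivialize the
tangent bundle near `x` (the trivialization used is the identity on the fibre `T_x M`), so that `X`
becomes a map into `T_x M`, and differentiate it at `x`. -/
def linearization [IsManifold (𝓡 n) 1 M] (X : (m : M) → TangentSpace (𝓡 n) m) (x : M) :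
    EuclideanSpace ℝ (Fin n) →L[ℝ] EuclideanSpace ℝ (Fin n) :=
  mfderiv (𝓡 n) 𝓘(ℝ, EuclideanSpace ℝ (Fin n))
    (fun y : M =>
      (trivializationAt (EuclideanSpace ℝ (Fin n)) (TangentSpace (𝓡 n)) x ⟨y, X y⟩).2) x

/-- The complex eigenvalues of the linearization at `x`, with algebraic multiplicity. -/
def eigenvalues [IsManifold (𝓡 n) 1 M] (X : (m : M) → TangentSpace (𝓡 n) m) (x : M) :
    Multiset ℂ :=
  ((linearization X x).toLinearMap.charpoly.map (algebraMap ℝ ℂ)).roots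

/-- No eigenvalue of the linearization at `x` lies on the imaginary axis. -/
def IsHyperbolic [IsManifold (𝓡 n) 1 M] (X : (m : M) → TangentSpace (𝓡 n) m) (x : M) : Prop :=
  ∀ μ ∈ eigenvalues X x, μ.re ≠ 0

open Classical in
/-- The Morse index: the number of eigenvalues with positive real part, with multiplicity. -/
def index [IsManifold (𝓡 n) 1 M] (X : (m : M) → TangentSpace (𝓡 n) m) (x : M) : ℕ :=
  Multiset.card ((eigenvalues X x).filter (fun μ => 0 < μ.re))

/-- A smooth function that strictly decreases along `X` away from the rest points. -/
def IsLyapunov (X : (m : M) → TangentSpace (𝓡 n) m) (f : M → ℝ) : Prop :=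
  ContMDiff (𝓡 n) 𝓘(ℝ, ℝ) ∞ f ∧
    ∀ m : M, X m ≠ 0 → (show ℝ from mfderiv (𝓡 n) 𝓘(ℝ, ℝ) f m (X m)) < 0

/-! ### Trajectories, stable and unstable sets, transversality -/

/-- The points reached at a time `t ∈ S` by the trajectory that is at `m` at time `0`. -/
def orbitOn (X : (m : M) → TangentSpace (𝓡 n) m) (m : M) (S : Set ℝ) : Set M :=
  {p | ∃ γ : ℝ → M, IsMIntegralCurve γ X ∧ γ 0 = m ∧ ∃ t ∈ S, γ t = p}

/-- The set of points whose trajectory converges to `x` along `l`; here `l` is `atBot` or `atTop`. -/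
def limitSet (X : (m : M) → TangentSpace (𝓡 n) m) (l : Filter ℝ) (x : M) : Set M :=
  {m | ∃ γ : ℝ → M, IsMIntegralCurve γ X ∧ γ 0 = m ∧ Tendsto γ l (𝓝 x)}

/-- The unstable set `W^-_x`. -/
def unstableSet (X : (m : M) → TangentSpace (𝓡 n) m) (x : M) : Set M := limitSet X atBot x

/-- The stable set `W^+_x`. -/
def stableSet (X : (m : M) → TangentSpace (𝓡 n) m) (x : M) : Set M := limitSet X atTop x

/-- Tangent vectors at `u` to the unstable manifold (`l = atBot`) or stable manifold (`l = atTop`)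
of the rest point `x`, i.e. the image at `u` of the differential of the inclusion `i^∓_x`.

They are the velocities at time `0` of the smooth curves `c` of `M` that lie in the unstable
(stable) set and move continuously in its manifold topology near time `0`. That topology is finer
than the one induced by `M`: points are close when their whole trajectories on the half-line that
tends to `x` are uniformly close, so its curves are those along which the convergence of the
trajectories `Γ s` of `c s` to `x` is uniform for `s` near `0`. -/
def tangentVectors (X : (m : M) → TangentSpace (𝓡 n) m) (l : Filter ℝ) (x u : M) :
    Set (EuclideanSpace ℝ (Fin n)) :=
  {v | ∃ (c : ℝ → M) (Γ : ℝ → ℝ → M),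
    ContMDiff 𝓘(ℝ, ℝ) (𝓡 n) ∞ c ∧ c 0 = u ∧
    (∀ s, c s ∈ limitSet X l x) ∧
    (∀ s, IsMIntegralCurve (Γ s) X ∧ Γ s 0 = c s) ∧
    Tendsto (fun q : ℝ × ℝ => Γ q.2 q.1) (l ×ˢ 𝓝 0) (𝓝 x) ∧
    (show EuclideanSpace ℝ (Fin n) from mfderiv 𝓘(ℝ, ℝ) (𝓡 n) c 0 (1 : ℝ)) = v}

/-- The property `P₁`: all rest points are hyperbolic. -/
def AllHyperbolic [IsManifold (𝓡 n) 1 M] (X : (m : M) → TangentSpace (𝓡 n) m) : Prop :=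
  ∀ x : M, X x = 0 → IsHyperbolic X x

/-- The property `P₂`: for any two rest points `x`, `y` (possibly equal) the unstable manifold of
`x` and the stable manifold of `y` are transversal: at each common point their tangent spaces span
the tangent space of `M`. -/
def AllTransversal (X : (m : M) → TangentSpace (𝓡 n) m) : Prop :=
  ∀ x y : M, X x = 0 → X y = 0 → ∀ u ∈ unstableSet X x ∩ stableSet X y,
    Submodule.span ℝ (tangentVectors X atBot x u) ⊔
      Submodule.span ℝ (tangentVectors X atTop y u) = ⊤

/-! ### Instantons and broken instantons -/

/-- A parametrized instanton from `x` to `y`. -/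
structure ParamInstanton (X : (m : M) → TangentSpace (𝓡 n) m) (x y : M) where
  toFun : ℝ → M
  integral : IsMIntegralCurve toFun X
  tendsto_atBot : Tendsto toFun atBot (𝓝 x)
  tendsto_atTop : Tendsto toFun atTop (𝓝 y)

/-- Two parametrized instantons are identified when they differ by a translation of time. -/
instance translationSetoid (X : (m : M) → TangentSpace (𝓡 n) m) (x y : M) :
    Setoid (ParamInstanton X x y) where
  r γ δ := ∃ a : ℝ, ∀ t, δ.toFun t = γ.toFun (t + a)
  iseqv :=
    { refl := fun γ => ⟨0, fun t => by simp⟩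
      symm := by
        rintro γ δ ⟨a, h⟩
        exact ⟨-a, fun t => by simp [h]⟩
      trans := by
        rintro γ δ ε ⟨a, h⟩ ⟨b, h'⟩
        exact ⟨b + a, fun t => by rw [h', h, add_assoc]⟩ }

/-- The set `𝒯(x,y)` of instantons from `x` to `y`, modulo translation. -/
def Instanton (X : (m : M) → TangentSpace (𝓡 n) m) (x y : M) : Type _ :=
  Quotient (translationSetoid X x y)

/-- The points of `M` on an instanton. -/
def Instanton.image {X : (m : M) → TangentSpace (𝓡 n) m} {x y : M} (γ : Instanton X x y) : Set M :=
  Quotient.lift (fun γ : ParamInstanton X x y => range γ.toFun)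
    (by
      rintro γ δ ⟨a, h⟩
      ext p
      constructor
      · rintro ⟨t, rfl⟩
        exact ⟨t - a, by simp [h]⟩
      · rintro ⟨t, rfl⟩
        exact ⟨t + a, (h t).symm⟩) γ

/-- A finite sequence of `len ≥ 0` instantons leading from `x` to `y` through the rest points
`x = pt 0, pt 1, …, pt len = y`: an element of `𝒯(pt 0, pt 1) × 𝒯(pt 1, pt 2) × ⋯`. -/
structure BrokenInstanton (X : (m : M) → TangentSpace (𝓡 n) m) (x y : M) where
  len : ℕ
  pt : Fin (len + 1) → M
  rest : ∀ i, X (pt i) = 0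
  pt_zero : pt 0 = x
  pt_last : pt (Fin.last len) = y
  inst : (i : Fin len) → Instanton X (pt i.castSucc) (pt i.succ)

namespace BrokenInstanton

variable {X : (m : M) → TangentSpace (𝓡 n) m} {x y : M}

/-- The Morse index strictly decreases along the rest points. -/
def Descending [IsManifold (𝓡 n) 1 M] (c : BrokenInstanton X x y) : Prop :=
  ∀ i : Fin c.len, index X (c.pt i.succ) < index X (c.pt i.castSucc)

/-- The images of the instantons, in order. -/
def pieces (c : BrokenInstanton X x y) (i : Fin c.len) : Set M := (c.inst i).image

/-- The points of `M` on a broken instanton, including its rest points. -/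
def carrier (c : BrokenInstanton X x y) : Set M := range c.pt ∪ ⋃ i, c.pieces i

end BrokenInstanton

/-! ### Transversal slices -/

/-- An embedded submanifold of dimension `n - 1`, diffeomorphic to an open disc (equivalently, to
Euclidean space), and transversal to `X` at each of its points. -/
def IsTransversalDisc (X : (m : M) → TangentSpace (𝓡 n) m) (U : Set M) : Prop :=
  ∃ (d : ℕ) (e : EuclideanSpace ℝ (Fin d) → M), d + 1 = n ∧ range e = U ∧
    ContMDiff (𝓡 d) (𝓡 n) ∞ e ∧ IsEmbedding e ∧
    (∀ q, Function.Injective (mfderiv (𝓡 d) (𝓡 n) e q)) ∧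
    ∀ q, LinearMap.range (mfderiv (𝓡 d) (𝓡 n) e q).toLinearMap ⊔ Submodule.span ℝ {X (e q)} = ⊤

/-- The sequence of discs `U` is a transversal slice to the broken trajectory with pieces `P 0, P 1,
…`: the discs are disjoint and transversal to `X`, they can be assigned to pieces that they meet,
consecutive discs to the same or to consecutive pieces, and each piece with label in `R` gets at
least one disc. -/
def IsSlice (X : (m : M) → TangentSpace (𝓡 n) m) {p r : ℕ} (P : Fin p → Set M) (R : Set (Fin p))
    (U : Fin r → Set M) : Prop :=
  (∀ j, IsTransversalDisc X (U j)) ∧ Pairwise (fun j j' => Disjoint (U j) (U j')) ∧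
    ∃ a : Fin r → Fin p, (∀ j, (U j ∩ P (a j)).Nonempty) ∧ (∀ i ∈ R, ∃ j, a j = i) ∧
      ∀ j j' : Fin r, (j' : ℕ) = j + 1 → (a j' = a j ∨ (a j' : ℕ) = a j + 1)

/-! ### The completed spaces with their transversal slice topologies -/

variable [IsManifold (𝓡 n) 1 M]

/-- The set of possibly broken instantons from `x` to `y`: at least one instanton, and strictly
decreasing indices if there are several. -/
def THat (X : (m : M) → TangentSpace (𝓡 n) m) (x y : M) : Type _ :=
  {c : BrokenInstanton X x y // 1 ≤ c.len ∧ (2 ≤ c.len → c.Descending)}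

/-- The completed unstable set of `x`: pairs of a broken instanton (possibly of length `0`) with
strictly decreasing indices from `x` to a rest point `base`, and a point `endpt ∈ W^-_base`. -/
structure UnstableHat (X : (m : M) → TangentSpace (𝓡 n) m) (x : M) where
  base : M
  chain : BrokenInstanton X x base
  desc : chain.Descending
  endpt : M
  mem : endpt ∈ unstableSet X base

/-- The completed stable set of `x`: pairs of a point `endpt ∈ W^+_base` and a broken instanton
(possibly of length `0`) with strictly decreasing indices from the rest point `base` to `x`. -/
structure StableHat (X : (m : M) → TangentSpace (𝓡 n) m) (x : M) where
  base : M
  endpt : M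
  mem : endpt ∈ stableSet X base
  chain : BrokenInstanton X base x
  desc : chain.Descending

/-- The completion of `ℳ(x,z)`: triples of a broken instanton from `x` to `left`, a point of
`ℳ(left, right) = W^-_left ∩ W^+_right`, and a broken instanton from `right` to `z`. -/
structure MHat (X : (m : M) → TangentSpace (𝓡 n) m) (x z : M) where
  left : M
  right : M
  chain : BrokenInstanton X x left
  desc : chain.Descending
  point : M
  mem : point ∈ unstableSet X left ∩ stableSet X right
  chain' : BrokenInstanton X right z
  desc' : chain'.Descending

variable {X : (m : M) → TangentSpace (𝓡 n) m} {x y z : M}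

/-- All instantons have to be met by the slice. -/
def THat.HasSlice (c : THat X x y) {r : ℕ} (U : Fin r → Set M) : Prop :=
  IsSlice X c.1.pieces univ U

/-- The transversal slice topology: a base consists of the sets of all possibly broken instantons
that lie in `V` and have `U` as a transversal slice, for the systems `(c, V, U)` where `V` is an
open neighbourhood of `c` and `U` a transversal slice to `c`. -/
instance : TopologicalSpace (THat X x y) :=
  TopologicalSpace.generateFrom
    {S | ∃ (c : THat X x y) (V : Set M) (r : ℕ) (U : Fin r → Set M),
      IsOpen V ∧ c.1.carrier ⊆ V ∧ c.HasSlice U ∧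
      S = {d : THat X x y | d.1.carrier ⊆ V ∧ d.HasSlice U}}

/-- The points on the broken trajectory from `x` to the end point `c.endpt`. -/
def UnstableHat.carrier (c : UnstableHat X x) : Set M :=
  c.chain.carrier ∪ orbitOn X c.endpt (Iic 0)

/-- The pieces of the broken trajectory are the instantons, which have to be met by the slice, and
the trajectory of the end point, which may be met. -/
def UnstableHat.HasSlice (c : UnstableHat X x) {r : ℕ} (U : Fin r → Set M) : Prop :=
  IsSlice X (Fin.snoc (α := fun _ => Set M) c.chain.pieces (orbitOn X c.endpt univ))
    (range Fin.castSucc) U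

/-- The transversal slice topology, with base given by the systems `(c, V, U, O)`. -/
instance : TopologicalSpace (UnstableHat X x) :=
  TopologicalSpace.generateFrom
    {S | ∃ (c : UnstableHat X x) (V O : Set M) (r : ℕ) (U : Fin r → Set M),
      IsOpen V ∧ c.carrier ⊆ V ∧ IsOpen O ∧ c.endpt ∈ O ∧ c.HasSlice U ∧
      S = {d : UnstableHat X x | d.carrier ⊆ V ∧ d.HasSlice U ∧ d.endpt ∈ O}}

/-- The points on the broken trajectory from the end point `c.endpt` to `x`. -/
def StableHat.carrier (c : StableHat X x) : Set M :=
  orbitOn X c.endpt (Ici 0) ∪ c.chain.carrier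

/-- The pieces of the broken trajectory are the trajectory of the end point, which may be met by
the slice, and the instantons, which have to be met. -/
def StableHat.HasSlice (c : StableHat X x) {r : ℕ} (U : Fin r → Set M) : Prop :=
  IsSlice X (Fin.cons (α := fun _ => Set M) (orbitOn X c.endpt univ) c.chain.pieces)
    (range Fin.succ) U

/-- The transversal slice topology; it is the one of the completed unstable set of `x` for `-X`. -/
instance : TopologicalSpace (StableHat X x) :=
  TopologicalSpace.generateFrom
    {S | ∃ (c : StableHat X x) (V O : Set M) (r : ℕ) (U : Fin r → Set M),
      IsOpen V ∧ c.carrier ⊆ V ∧ IsOpen O ∧ c.endpt ∈ O ∧ c.HasSlice U ∧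
      S = {d : StableHat X x | d.carrier ⊆ V ∧ d.HasSlice U ∧ d.endpt ∈ O}}

/-- The identification of the completion of `ℳ(x,z)` with the pairs in the product of the
completed unstable set of `x` and the completed stable set of `z` that have the same end point. -/
def MHat.toProd (c : MHat X x z) : UnstableHat X x × StableHat X z :=
  (⟨c.left, c.chain, c.desc, c.point, c.mem.1⟩, ⟨c.right, c.point, c.mem.2, c.chain', c.desc'⟩)

/-- The topology induced from the product. -/
instance : TopologicalSpace (MHat X x z) :=
  TopologicalSpace.induced MHat.toProd inferInstance

/-- The map `î^-_x` to `M`. -/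
def UnstableHat.toManifold (c : UnstableHat X x) : M := c.endpt

/-- The map `î_{x,z}` to `M`. -/
def MHat.toManifold (c : MHat X x z) : M := c.point

end BrokenFlow

end

/-!
A smooth vector field on a closed manifold has a global flow with differentiable time maps
(`exists_isFlowOf`), and all spaces of the theorem consist of broken trajectories of this flow.
They are treated as one kind of object, `BrokenOrbit`: fixed points of a flow joined by
trajectories, and a last, half-infinite trajectory that ends in an arbitrary point. The completed
unstable set consists of such broken orbits of the flow, the completed stable set of broken orbits
of the reversed flow, and the other two spaces are closed subspaces:
`THat X x y` with `x ≠ y` is the set where the end point is `y`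
(`THat.isClosedEmbedding_toUnstableHat`), `MHat X x z` is the set of pairs with equal end points
(`MHat.isClosedEmbedding_toProd`), and `THat X x x` has at most one point.

The transversal slice topology is induced by the Vietoris topology: sending a broken orbit to the
compact set of its points and to its end point is an embedding (`isEmbedding_toCompacts`). The main
point is that slices impose no further condition (`BrokenOrbit.exists_nhd_hasSlice`). If a broken
orbit `c'` stays in a small neighbourhood of `c`, then its fixed points are among those of `c`. If
moreover its end point is close to that of `c`, it cannot get past a point `q` of `c` without coming
close to `q`, since `q` cuts `c` into two pieces with disjoint neighbourhoods away from `q`; hence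
it meets each disc that `c` meets, and in the same order. Discs enter through two properties only: a
trajectory that meets a disc crosses it, so that nearby trajectories meet it too
(`IsTransversalDisc.eventually_meets`), and there are small discs through each point that is not
a rest point (`exists_isTransversalDisc`). As the space of nonempty compact subsets of a compact
metrizable space is metrizable, the completed spaces are metrizable, which gives the Hausdorff
property and paracompactness; the end point is a continuous function by construction.

With a Lyapunov function, the space of broken orbits is closed in the compact space of pairs of a
nonempty compact set and a point. The function is injective on a broken orbit; its values fill the
interval between the values at both ends. The same holds for a limit `K` of broken orbits. Points of
`K` that are not fixed are determined by their level because broken orbits near `K` contain a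
segment of trajectory through a point nearby, and two fixed points on the same level are excluded by
connectedness (`injOn_limit`). A set with these properties that is invariant up to the level of its
end point is a broken orbit (`exists_brokenOrbit`): the fixed points in it, ordered by level, are
joined by trajectories in it.

Here the index has to decrease along the trajectories found in the limit. This is `index_lt`, which
needs no invariant manifold theorem. A hyperbolic linear map has two semidefinite forms `P` and `N`,
of ranks `ind` and `n - ind`, of which the first increases and the second decreases along the linear
flow (`exists_hyperbolic_forms`). Near a rest point `y`, the form `P - N` of the difference of two
trajectories grows exponentially, so that on velocities of curves whose trajectories converge to
`y`, transported into this neighbourhood, `P` is at most `N` (`exists_submodule_le`). Thus the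
tangent vectors of the stable set of `y` span a space of dimension at most `n - ind y`, and likewise
those of the unstable set of `x` one of dimension at most `ind x`. On a common trajectory both spans
contain the value of the vector field, which is not zero, and by transversality they add up to the
whole tangent space; so `ind y < ind x`. The same estimate shows that hyperbolic rest points are
isolated, hence finite in number (`finite_rest`).
-/

set_option linter.unusedSectionVars false

noncomputable section

namespace BrokenFlow

/-! ### Smooth dependence of solutions on initial values -/

section EuclideanODE

variable {E : Type*} [NormedAddCommGroup E] [NormedSpace ℝ E]

/-- The linear variational equation along a curve has a solution on a short time interval whose
length depends only on a bound for the coefficients. -/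
theorem exists_variational_solution [CompleteSpace E] {A : ℝ → E →L[ℝ] E} {ε K : ℝ} (hε : 0 ≤ ε)
    (hA : ContinuousOn A (Icc 0 ε)) (hK : ∀ t ∈ Icc 0 ε, ‖A t‖ ≤ K) (hKε : 2 * K * ε ≤ 1) :
    ∃ W : ℝ → E →L[ℝ] E, W 0 = ContinuousLinearMap.id ℝ E ∧
      ∀ t ∈ Icc 0 ε, HasDerivWithinAt W (A t ∘L W t) (Icc 0 ε) t := by
  have hK0 : 0 ≤ K := (norm_nonneg _).trans (hK 0 ⟨le_rfl, hε⟩)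
  have h : IsPicardLindelof (fun t W => A t ∘L W) (tmin := 0) (tmax := ε)
      ⟨0, le_rfl, hε⟩ (ContinuousLinearMap.id ℝ E) 1 0 ⟨2 * K, by positivity⟩ ⟨K, hK0⟩ := by
    refine ⟨fun t ht => ?_, fun W _ => ?_, fun t ht W hW => ?_, ?_⟩
    · refine LipschitzOnWith.of_dist_le_mul fun W _ W' _ => ?_
      rw [dist_eq_norm, dist_eq_norm, ← ContinuousLinearMap.comp_sub]
      exact (ContinuousLinearMap.opNorm_comp_le _ _).trans
        (mul_le_mul_of_nonneg_right (hK t ht) (norm_nonneg _))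
    · exact hA.clm_comp continuousOn_const
    · have h1 : ‖W‖ ≤ 2 := by
        have := norm_le_norm_sub_add W (ContinuousLinearMap.id ℝ E)
        have h2 : ‖W - ContinuousLinearMap.id ℝ E‖ ≤ 1 := by simpa [dist_eq_norm] using hW
        have h3 : ‖ContinuousLinearMap.id ℝ E‖ ≤ 1 := ContinuousLinearMap.norm_id_le
        linarith
      calc ‖A t ∘L W‖ ≤ ‖A t‖ * ‖W‖ := ContinuousLinearMap.opNorm_comp_le _ _
        _ ≤ K * 2 := mul_le_mul (hK t ht) h1 (norm_nonneg _) hK0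
        _ = _ := by change K * 2 = 2 * K; ring
    · change 2 * K * max (ε - 0) (0 - 0) ≤ 1 - 0
      simpa [hε] using hKε
  obtain ⟨W, hW0, hW⟩ := h.exists_eq_forall_mem_Icc_hasDerivWithinAt₀
  exact ⟨W, hW0, hW⟩

/-- Solutions of an autonomous equation depend differentiably on the initial point, and the
derivative solves the variational equation. -/
theorem hasFDerivAt_of_variational [FiniteDimensional ℝ E] {f : E → E} {f' : E → E →L[ℝ] E}
    {x₀ q : E} {ρ ε L : ℝ}
    (hf : ∀ z ∈ Metric.closedBall x₀ ρ, HasFDerivAt f (f' z) z)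
    (hf' : ContinuousOn f' (Metric.closedBall x₀ ρ)) {α : E → ℝ → E}
    (hα : ∀ᶠ p in 𝓝 q, α p 0 = p ∧ ∀ t ∈ Icc 0 ε, α p t ∈ Metric.closedBall x₀ ρ ∧
      HasDerivWithinAt (α p) (f (α p t)) (Icc 0 ε) t)
    (hL : ∀ᶠ p in 𝓝 q, ∀ t ∈ Icc 0 ε, ‖α p t - α q t‖ ≤ L * ‖p - q‖)
    {W : ℝ → E →L[ℝ] E} (hW0 : W 0 = ContinuousLinearMap.id ℝ E)
    (hW : ∀ t ∈ Icc 0 ε, HasDerivWithinAt W (f' (α q t) ∘L W t) (Icc 0 ε) t)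
    {t : ℝ} (ht : t ∈ Icc 0 ε) : HasFDerivAt (fun p => α p t) (W t) q := by
  have hcomp : IsCompact (Metric.closedBall x₀ ρ) := isCompact_closedBall _ _
  obtain ⟨K, hK⟩ := hcomp.exists_bound_of_continuousOn hf'
  have hunif := hcomp.uniformContinuousOn_of_continuous hf'
  have hq := hα.self_of_nhds
  have hε : 0 ≤ ε := ht.1.trans ht.2
  have hK0 : 0 ≤ K := (norm_nonneg _).trans (hK _ (hq.2 0 ⟨le_rfl, hε⟩).1)
  rw [hasFDerivAt_iff_isLittleO]
  rw [Asymptotics.isLittleO_iff]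
  intro c hc
  -- The factor by which the Grönwall inequality enlarges the error on the interval.
  set G := gronwallBound 0 K 1 ε with hG
  have hGpos : 0 ≤ G := by
    have := gronwallBound_mono le_rfl zero_le_one hK0 hε
    rwa [gronwallBound_x0] at this
  obtain ⟨η, hη, hηc⟩ : ∃ η > 0, G * (η * (|L| + 1)) ≤ c := by
    refine ⟨c / ((G + 1) * (|L| + 1)), by positivity, ?_⟩
    have : G * (c / ((G + 1) * (|L| + 1)) * (|L| + 1)) = c * (G / (G + 1)) := by
      field_simp
    rw [this]
    have : G / (G + 1) ≤ 1 := by rw [div_le_one (by positivity)]; linarith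
    nlinarith
  obtain ⟨δ, hδ, hδη⟩ := Metric.uniformContinuousOn_iff.1 hunif η hη
  have hnear : ∀ᶠ p in 𝓝 q, (|L| + 1) * ‖p - q‖ < δ := by
    have : Tendsto (fun p => (|L| + 1) * ‖p - q‖) (𝓝 q) (𝓝 ((|L| + 1) * ‖q - q‖)) := by
      apply Continuous.tendsto; fun_prop
    simp only [sub_self, norm_zero, mul_zero] at this
    exact this.eventually_lt_const hδ
  filter_upwards [hα, hL, hnear] with p hp hLp hnp
  have hLp' : ∀ s ∈ Icc 0 ε, ‖α p s - α q s‖ ≤ (|L| + 1) * ‖p - q‖ := fun s hs =>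
    (hLp s hs).trans (mul_le_mul_of_nonneg_right (by linarith [le_abs_self L]) (norm_nonneg _))
  set R : ℝ → E := fun s => α p s - α q s - W s (p - q) with hR
  have hRd : ∀ s ∈ Icc 0 ε, HasDerivWithinAt R
      (f (α p s) - f (α q s) - f' (α q s) (W s (p - q))) (Icc 0 ε) s := by
    intro s hs
    have h1 := (((hp.2 s hs).2.sub (hq.2 s hs).2)).sub
      ((hW s hs).clm_apply (hasDerivWithinAt_const s (Icc 0 ε) (p - q)))
    have h2 : HasDerivWithinAt R _ (Icc 0 ε) s := h1
    exact h2.congr_deriv (by simp)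
  -- The remainder `R` solves the variational equation up to an error small relative to `p - q`.
  have hbound : ∀ s ∈ Ico 0 ε,
      ‖f (α p s) - f (α q s) - f' (α q s) (W s (p - q))‖
        ≤ K * ‖R s‖ + η * (|L| + 1) * ‖p - q‖ := by
    intro s hs
    have hs' : s ∈ Icc 0 ε := ⟨hs.1, hs.2.le⟩
    have hseg : ∀ z ∈ segment ℝ (α q s) (α p s),
        z ∈ Metric.closedBall x₀ ρ ∧ ‖f' z - f' (α q s)‖ ≤ η := by
      intro z hz
      have hzb := (convex_closedBall x₀ ρ).segment_subset (hq.2 s hs').1 (hp.2 s hs').1 hz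
      refine ⟨hzb, ?_⟩
      have hd : dist z (α q s) < δ := by
        have : dist z (α q s) ≤ dist (α p s) (α q s) := by
          have := norm_sub_le_of_mem_segment hz
          simpa [dist_eq_norm] using this
        calc _ ≤ _ := this
          _ ≤ (|L| + 1) * ‖p - q‖ := by rw [dist_eq_norm]; exact hLp' s hs'
          _ < δ := hnp
      have := hδη z hzb (α q s) (hq.2 s hs').1 hd
      rw [dist_eq_norm] at this
      exact this.le
    have h2 : ‖f (α p s) - f (α q s) - f' (α q s) (α p s - α q s)‖
        ≤ η * ‖α p s - α q s‖ :=
      (convex_segment (α q s) (α p s)).norm_image_sub_le_of_norm_hasFDerivWithin_le'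
        (fun z hz => (hf z (hseg z hz).1).hasFDerivWithinAt) (fun z hz => (hseg z hz).2)
        (left_mem_segment _ _ _) (right_mem_segment _ _ _)
    have h3 : f (α p s) - f (α q s) - f' (α q s) (W s (p - q)) =
        f' (α q s) (R s) + (f (α p s) - f (α q s) - f' (α q s) (α p s - α q s)) := by
      simp only [hR, map_sub]; abel
    rw [h3]
    calc _ ≤ ‖f' (α q s) (R s)‖ + ‖f (α p s) - f (α q s) - f' (α q s) (α p s - α q s)‖ :=
          norm_add_le _ _
      _ ≤ K * ‖R s‖ + η * ((|L| + 1) * ‖p - q‖) := by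
          gcongr
          · exact (f' (α q s)).le_of_opNorm_le (hK _ (hq.2 s hs').1) _
          · exact h2.trans (by gcongr; exact hLp' s hs')
      _ = _ := by ring
  have hR0 : ‖R 0‖ ≤ 0 := by simp [hR, hp.1, hq.1, hW0]
  have key := norm_le_gronwallBound_of_norm_deriv_right_le (f := R)
    (fun s hs => (hRd s hs).continuousWithinAt)
    (fun s hs => (hRd s ⟨hs.1, hs.2.le⟩).mono_of_mem_nhdsWithin
      (mem_of_superset (Icc_mem_nhdsGE hs.2) (Icc_subset_Icc_left hs.1))) hR0 hbound t ht
  have hlin : ∀ e : ℝ, gronwallBound 0 K e t = e * gronwallBound 0 K 1 t := by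
    intro e
    by_cases hK' : K = 0
    · subst hK'; simp [gronwallBound_K0]
    · simp [gronwallBound_of_K_ne_0 hK']; ring
  have hmono : gronwallBound 0 K 1 t ≤ G := gronwallBound_mono le_rfl zero_le_one hK0 ht.2
  calc ‖α p t - α q t - W t (p - q)‖ ≤ gronwallBound 0 K (η * (|L| + 1) * ‖p - q‖) (t - 0) := key
    _ = η * (|L| + 1) * ‖p - q‖ * gronwallBound 0 K 1 t := by rw [sub_zero, hlin]
    _ ≤ η * (|L| + 1) * ‖p - q‖ * G := by gcongr
    _ = G * (η * (|L| + 1)) * ‖p - q‖ := by ring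
    _ ≤ c * ‖p - q‖ := by gcongr

/-- A continuously differentiable vector field has a local flow that is continuous and, for positive
times, differentiable in the initial point. -/
theorem exists_local_flow [FiniteDimensional ℝ E] {f : E → E} {x₀ : E} (hf : ContDiffAt ℝ 1 f x₀)
    {O : Set E} (hO : O ∈ 𝓝 x₀) :
    ∃ r > (0 : ℝ), ∃ ε > (0 : ℝ), ∃ α : E → ℝ → E,
      (∀ x ∈ Metric.ball x₀ r, α x 0 = x ∧
        ∀ t ∈ Ioo (-ε) ε, α x t ∈ O ∧ HasDerivAt (α x) (f (α x t)) t) ∧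
      ContinuousOn (Function.uncurry α) (Metric.ball x₀ r ×ˢ Ioo (-ε) ε) ∧
      ∀ x ∈ Metric.ball x₀ r, ∀ t ∈ Ico 0 ε, DifferentiableAt ℝ (fun p => α p t) x := by
  have : CompleteSpace E := FiniteDimensional.complete ℝ E
  obtain ⟨ρ, hρ, hρs⟩ : ∃ ρ > 0, Metric.closedBall x₀ ρ ⊆ {z | ContDiffAt ℝ 1 f z} ∩ O :=
    Metric.nhds_basis_closedBall.mem_iff.1
      (inter_mem ((hf.eventually (by simp))) hO)
  have hρd : ∀ z ∈ Metric.closedBall x₀ ρ, ContDiffAt ℝ 1 f z := fun z hz => (hρs hz).1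
  have hfd : ∀ z ∈ Metric.closedBall x₀ ρ, HasFDerivAt f (fderiv ℝ f z) z := fun z hz =>
    ((hρd z hz).differentiableAt (by simp)).hasFDerivAt
  have hfc : ContinuousOn (fderiv ℝ f) (Metric.closedBall x₀ ρ) := fun z hz =>
    ((hρd z hz).continuousAt_fderiv (by simp)).continuousWithinAt
  obtain ⟨K, hK⟩ := (isCompact_closedBall x₀ ρ).exists_bound_of_continuousOn hfc
  have hK0 : 0 ≤ K := (norm_nonneg _).trans (hK _ (Metric.mem_closedBall_self hρ.le))
  obtain ⟨ε₀, hε₀, a, r₀, L, K', hr₀, hpl⟩ := IsPicardLindelof.of_contDiffAt_one hf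
  have hpl0 := hpl 0
  obtain ⟨α, hα, L', hL'⟩ :=
    hpl0.exists_forall_mem_closedBall_eq_hasDerivWithinAt_lipschitzOnWith
  simp only [zero_sub, zero_add] at hα hL'
  have hcont : ContinuousOn (Function.uncurry α)
      (Metric.closedBall x₀ r₀ ×ˢ Icc (-ε₀) ε₀) :=
    continuousOn_prod_of_continuousOn_lipschitzOnWith _ L'
      (fun x hx => HasDerivWithinAt.continuousOn (hα x hx).2) hL'
  have hr₀' : (0 : ℝ) < r₀ := hr₀
  have hnear : ∀ᶠ p in 𝓝 ((x₀, 0) : E × ℝ), Function.uncurry α p ∈ Metric.closedBall x₀ ρ := by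
    have hc : ContinuousAt (Function.uncurry α) (x₀, 0) :=
      hcont.continuousAt (prod_mem_nhds (Metric.closedBall_mem_nhds _ hr₀')
        (Icc_mem_nhds (by linarith) hε₀))
    refine hc.eventually_mem ?_
    have : Function.uncurry α (x₀, 0) = x₀ :=
      (hα x₀ (Metric.mem_closedBall_self hr₀'.le)).1
    rw [this]
    exact Metric.closedBall_mem_nhds _ hρ
  obtain ⟨δ, hδ, hδs⟩ := Metric.eventually_nhds_iff_ball.1 hnear
  -- For |t| < δ solutions starting in the ball of radius δ stay in the ball of radius ρ, on which
  -- `f` is differentiable with derivative bounded by `K`; the condition `2 K ε ≤ 1` is the one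
  -- under which the variational equation is solved on `[0, ε]`.
  set r := min δ r₀ with hr
  set ε := min (min δ ε₀) (1 / (2 * (K + 1))) / 2 with hεdef
  have hmin : 0 < min (min δ ε₀) (1 / (2 * (K + 1))) := by positivity
  have hε : 0 < ε := by positivity
  have hε1 : ε < min (min δ ε₀) (1 / (2 * (K + 1))) := by rw [hεdef]; linarith
  have hεδ : ε < δ := hε1.trans_le ((min_le_left _ _).trans (min_le_left _ _))
  have hεε : ε < ε₀ := hε1.trans_le ((min_le_left _ _).trans (min_le_right _ _))
  have hεK : 2 * K * ε ≤ 1 := by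
    have h1 : ε ≤ 1 / (2 * (K + 1)) := hε1.le.trans (min_le_right _ _)
    rw [le_div_iff₀ (by positivity)] at h1
    nlinarith
  have hrδ : Metric.ball x₀ r ⊆ Metric.ball x₀ δ := Metric.ball_subset_ball (min_le_left _ _)
  have hrr : Metric.ball x₀ r ⊆ Metric.closedBall x₀ r₀ :=
    (Metric.ball_subset_ball (min_le_right _ _)).trans Metric.ball_subset_closedBall
  have hmem : ∀ x ∈ Metric.ball x₀ r, ∀ t ∈ Icc (-ε) ε, α x t ∈ Metric.closedBall x₀ ρ := by
    intro x hx t ht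
    refine hδs (x, t) ?_
    rw [Metric.mem_ball, Prod.dist_eq, max_lt_iff]
    refine ⟨hrδ hx, ?_⟩
    rw [Real.dist_eq, sub_zero]
    exact (abs_le.2 ht).trans_lt hεδ
  have hder : ∀ x ∈ Metric.ball x₀ r, ∀ t ∈ Icc (-ε) ε, HasDerivAt (α x) (f (α x t)) t :=
    fun x hx t ht => ((hα x (hrr hx)).2 t ⟨by linarith [ht.1], by linarith [ht.2]⟩).hasDerivAt
      (Icc_mem_nhds (by linarith [ht.1]) (by linarith [ht.2]))
  refine ⟨r, by positivity, ε, hε, α, fun x hx => ⟨(hα x (hrr hx)).1, fun t ht => ⟨(hρs (hmem x hx t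
    (Ioo_subset_Icc_self ht))).2, hder x hx t (Ioo_subset_Icc_self ht)⟩⟩,
    hcont.mono (prod_mono hrr (Ioo_subset_Icc_self.trans
      (Icc_subset_Icc (by linarith) hεε.le))), fun x hx t ht => ?_⟩
  have hsub : Icc 0 ε ⊆ Icc (-ε) ε := Icc_subset_Icc (by linarith) le_rfl
  obtain ⟨W, hW0, hW⟩ := exists_variational_solution (A := fun t => fderiv ℝ f (α x t)) hε.le
    (hfc.comp (fun s hs => (hder x hx s (hsub hs)).continuousAt.continuousWithinAt)
      fun s hs => hmem x hx s (hsub hs))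
    (fun s hs => hK _ (hmem x hx s (hsub hs))) hεK
  refine (hasFDerivAt_of_variational (L := L') hfd hfc (ε := ε) ?_ ?_ hW0 hW
    (Ico_subset_Icc_self ht)).differentiableAt
  · filter_upwards [Metric.isOpen_ball.mem_nhds hx] with p hp
    exact ⟨(hα p (hrr hp)).1, fun s hs => ⟨hmem p hp s (hsub hs),
      (hder p hp s (hsub hs)).hasDerivWithinAt⟩⟩
  · filter_upwards [Metric.isOpen_ball.mem_nhds hx] with p hp s hs
    rw [← dist_eq_norm, ← dist_eq_norm]
    have hs' := hsub hs
    exact (hL' s ⟨by linarith [hs'.1], by linarith [hs'.2]⟩).dist_le_mul p (hrr hp) x (hrr hx)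

end EuclideanODE

/-! ### Vector fields in charts -/

section ChartField

variable {n : ℕ} {M : Type*} [TopologicalSpace M] [ChartedSpace (EuclideanSpace ℝ (Fin n)) M]
  [IsManifold (𝓡 n) ∞ M]

/-- The vector field `X` in the chart at `y`, as a map of the model space to itself. It is
meaningful on the target of the chart only. -/
def chartField (X : (m : M) → TangentSpace (𝓡 n) m) (y : M) (z : EuclideanSpace ℝ (Fin n)) :
    EuclideanSpace ℝ (Fin n) :=
  (trivializationAt (EuclideanSpace ℝ (Fin n)) (TangentSpace (𝓡 n)) y
    ⟨(extChartAt (𝓡 n) y).symm z, X ((extChartAt (𝓡 n) y).symm z)⟩).2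

variable {X : (m : M) → TangentSpace (𝓡 n) m} {y p : M}

theorem trivialization_snd_eq_mfderiv (hp : p ∈ (chartAt (EuclideanSpace ℝ (Fin n)) y).source)
    (v : TangentSpace (𝓡 n) p) :
    (trivializationAt (EuclideanSpace ℝ (Fin n)) (TangentSpace (𝓡 n)) y ⟨p, v⟩).2 =
      mfderiv (𝓡 n) 𝓘(ℝ, EuclideanSpace ℝ (Fin n)) (extChartAt (𝓡 n) y) p v := by
  refine Eq.trans ?_ (DFunLike.congr_fun (TangentBundle.continuousLinearMapAt_trivializationAt
    (I := 𝓡 n) hp) v)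
  change _ = (trivializationAt (EuclideanSpace ℝ (Fin n)) (TangentSpace (𝓡 n)) y).linearMapAt ℝ p v
  rw [Bundle.Trivialization.linearMapAt_apply, if_pos]
  simpa using hp

theorem chartField_apply (hp : p ∈ (chartAt (EuclideanSpace ℝ (Fin n)) y).source) :
    chartField X y (extChartAt (𝓡 n) y p) =
      mfderiv (𝓡 n) 𝓘(ℝ, EuclideanSpace ℝ (Fin n)) (extChartAt (𝓡 n) y) p (X p) := by
  rw [← trivialization_snd_eq_mfderiv hp, chartField,
    (extChartAt (𝓡 n) y).left_inv (by simpa using hp)]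

theorem contDiffOn_chartField
    (hX : ContMDiff (𝓡 n) (𝓡 n).tangent ∞ (fun m => (⟨m, X m⟩ : TangentBundle (𝓡 n) M))) (y : M) :
    ContDiffOn ℝ ∞ (chartField X y) (extChartAt (𝓡 n) y).target := by
  rw [← contMDiffOn_iff_contDiffOn]
  have h := (Bundle.Trivialization.contMDiffOn_section_baseSet_iff (IB := 𝓡 n) (n := ∞)
    (trivializationAt (EuclideanSpace ℝ (Fin n)) (TangentSpace (𝓡 n) (M := M)) y)).1 hX.contMDiffOn
  refine h.comp (contMDiffOn_extChartAt_symm y) fun z hz => ?_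
  simpa using (extChartAt (𝓡 n) y).map_target hz

theorem comp_one_smulRight {F G : Type*} [NormedAddCommGroup F] [NormedSpace ℝ F]
    [NormedAddCommGroup G] [NormedSpace ℝ G] (L : F →L[ℝ] G) (v : F) :
    L ∘L (1 : ℝ →L[ℝ] ℝ).smulRight v = (1 : ℝ →L[ℝ] ℝ).smulRight (L v) := by
  ext; simp

/-- A trajectory, read in a chart, solves the equation of the vector field in this chart. -/
theorem hasDerivAt_extChartAt_comp {γ : ℝ → M} {t : ℝ}
    (hγ : HasMFDerivAt 𝓘(ℝ, ℝ) (𝓡 n) γ t ((1 : ℝ →L[ℝ] ℝ).smulRight (X (γ t))))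
    (ht : γ t ∈ (chartAt (EuclideanSpace ℝ (Fin n)) y).source) :
    HasDerivAt (extChartAt (𝓡 n) y ∘ γ) (chartField X y (extChartAt (𝓡 n) y (γ t))) t := by
  have h := HasMFDerivAt.comp t (mdifferentiableAt_extChartAt (I := 𝓡 n) ht).hasMFDerivAt hγ
  refine hasDerivAt_iff_hasFDerivAt.2 (hasMFDerivAt_iff_hasFDerivAt.1 (h.congr_mfderiv ?_))
  rw [chartField_apply ht]
  exact comp_one_smulRight (F := EuclideanSpace ℝ (Fin n)) (G := EuclideanSpace ℝ (Fin n)) _ _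

/-- A solution of the equation of the vector field in a chart is a trajectory on the manifold. -/
theorem hasMFDerivAt_extChartAt_symm_comp {β : ℝ → EuclideanSpace ℝ (Fin n)} {t : ℝ}
    (ht : β t ∈ (extChartAt (𝓡 n) y).target)
    (hβ : HasDerivAt β (chartField X y (β t)) t) :
    HasMFDerivAt 𝓘(ℝ, ℝ) (𝓡 n) ((extChartAt (𝓡 n) y).symm ∘ β) t
      ((1 : ℝ →L[ℝ] ℝ).smulRight (X ((extChartAt (𝓡 n) y).symm (β t)))) := by
  have hs : MDifferentiableAt 𝓘(ℝ, EuclideanSpace ℝ (Fin n)) (𝓡 n) (extChartAt (𝓡 n) y).symm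
      (β t) := by
    have := mdifferentiableWithinAt_extChartAt_symm (I := 𝓡 n) ht
    rw [ModelWithCorners.range_eq_univ] at this
    exact mdifferentiableWithinAt_univ.1 this
  have h := HasMFDerivAt.comp t hs.hasMFDerivAt (hasMFDerivAt_iff_hasFDerivAt.2 hβ.hasFDerivAt)
  refine h.congr_mfderiv ?_
  have hsrc : (extChartAt (𝓡 n) y).symm (β t) ∈ (chartAt (EuclideanSpace ℝ (Fin n)) y).source := by
    simpa using (extChartAt (𝓡 n) y).map_target ht
  have hinv := mfderivWithin_extChartAt_symm_comp_mfderiv_extChartAt (I := 𝓡 n)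
    (x := y) (y := β t) ht
  have hval : chartField X y (β t) = mfderiv (𝓡 n) 𝓘(ℝ, EuclideanSpace ℝ (Fin n))
      (extChartAt (𝓡 n) y) ((extChartAt (𝓡 n) y).symm (β t))
      (X ((extChartAt (𝓡 n) y).symm (β t))) := by
    rw [← chartField_apply hsrc, (extChartAt (𝓡 n) y).right_inv ht]
  rw [ModelWithCorners.range_eq_univ, mfderivWithin_univ] at hinv
  have h2 := DFunLike.congr_fun hinv (X ((extChartAt (𝓡 n) y).symm (β t)))
  refine (comp_one_smulRight (F := EuclideanSpace ℝ (Fin n)) (G := EuclideanSpace ℝ (Fin n))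
    _ _).trans ?_
  rw [hval]
  exact congrArg (fun w : EuclideanSpace ℝ (Fin n) => (1 : ℝ →L[ℝ] ℝ).smulRight w) h2

end ChartField

/-! ### The flow of a vector field on a closed manifold -/

section Flow

variable {n : ℕ} {M : Type*} [TopologicalSpace M] [ChartedSpace (EuclideanSpace ℝ (Fin n)) M]
  [IsManifold (𝓡 n) ∞ M] {X : (m : M) → TangentSpace (𝓡 n) m}

/-- The flow `φ` consists of the trajectories of the vector field `X`, and its time `t` maps are
differentiable. -/
structure IsFlowOf (φ : Flow ℝ M) (X : (m : M) → TangentSpace (𝓡 n) m) : Prop where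
  integral : ∀ p, IsMIntegralCurve (fun t => φ t p) X
  unique : ∀ γ : ℝ → M, IsMIntegralCurve γ X → ∀ t, γ t = φ t (γ 0)
  mdifferentiableAt : ∀ t p, MDifferentiableAt (𝓡 n) (𝓡 n) (φ t) p

/-- Near each point there is a local flow for a short time, differentiable in the initial point for
nonnegative times. -/
theorem exists_local_flow_manifold
    (hX : ContMDiff (𝓡 n) (𝓡 n).tangent ∞ (fun m => (⟨m, X m⟩ : TangentBundle (𝓡 n) M))) (y : M) :
    ∃ N : Set M, IsOpen N ∧ y ∈ N ∧ ∃ ε > (0 : ℝ), ∃ α : M → ℝ → M,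
      (∀ p ∈ N, α p 0 = p ∧ IsMIntegralCurveOn (α p) X (Ioo (-ε) ε)) ∧
      ContinuousOn (Function.uncurry α) (N ×ˢ Ioo (-ε) ε) ∧
      ∀ p ∈ N, ∀ t ∈ Ico 0 ε, MDifferentiableAt (𝓡 n) (𝓡 n) (fun q => α q t) p := by
  have hT : (extChartAt (𝓡 n) y).target ∈ 𝓝 (extChartAt (𝓡 n) y y) := extChartAt_target_mem_nhds y
  have hf : ContDiffAt ℝ 1 (chartField X y) (extChartAt (𝓡 n) y y) :=
    ((contDiffOn_chartField hX y).contDiffAt hT).of_le (by exact_mod_cast le_top)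
  obtain ⟨r, hr, ε, hε, α, hα, hαc, hαd⟩ := exists_local_flow hf hT
  set N := (extChartAt (𝓡 n) y).source ∩ extChartAt (𝓡 n) y ⁻¹' Metric.ball (extChartAt (𝓡 n) y y) r
    with hN
  have hNs : ∀ p ∈ N, p ∈ (chartAt (EuclideanSpace ℝ (Fin n)) y).source := fun p hp => by
    simpa using hp.1
  refine ⟨N, isOpen_extChartAt_preimage' y Metric.isOpen_ball,
    ⟨mem_extChartAt_source y, Metric.mem_ball_self hr⟩, ε, hε,
    fun p t => (extChartAt (𝓡 n) y).symm (α (extChartAt (𝓡 n) y p) t), fun p hp => ⟨?_, ?_⟩, ?_, ?_⟩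
  · beta_reduce
    rw [(hα _ hp.2).1, (extChartAt (𝓡 n) y).left_inv hp.1]
  · intro t ht
    have h := (hα _ hp.2).2 t ht
    exact (hasMFDerivAt_extChartAt_symm_comp h.1 h.2).hasMFDerivWithinAt
  · refine (continuousOn_extChartAt_symm y).comp
      (hαc.comp (f := fun q : M × ℝ => (extChartAt (𝓡 n) y q.1, q.2)) ?_ ?_) ?_
    · exact ((continuousOn_extChartAt y).comp continuousOn_fst fun q hq => hq.1.1).prodMk
        continuousOn_snd
    · exact fun q hq => ⟨hq.1.2, hq.2⟩
    · exact fun q hq => ((hα _ hq.1.2).2 q.2 hq.2).1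
  · intro p hp t ht
    have ht' : t ∈ Ioo (-ε) ε := ⟨by linarith [ht.1], ht.2⟩
    have h1 : MDifferentiableAt 𝓘(ℝ, EuclideanSpace ℝ (Fin n)) (𝓡 n) (extChartAt (𝓡 n) y).symm
        (α (extChartAt (𝓡 n) y p) t) := by
      have := mdifferentiableWithinAt_extChartAt_symm (I := 𝓡 n) ((hα _ hp.2).2 t ht').1
      rw [ModelWithCorners.range_eq_univ] at this
      exact mdifferentiableWithinAt_univ.1 this
    have h2 : MDifferentiableAt 𝓘(ℝ, EuclideanSpace ℝ (Fin n)) 𝓘(ℝ, EuclideanSpace ℝ (Fin n))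
        (fun q => α q t) (extChartAt (𝓡 n) y p) := (hαd _ hp.2 t ht).mdifferentiableAt
    exact (h1.comp (f := fun q => α q t) (extChartAt (𝓡 n) y p) h2).comp
      (f := extChartAt (𝓡 n) y) p
      (mdifferentiableAt_extChartAt (I := 𝓡 n) (hNs p hp))

variable [T2Space M] [CompactSpace M]

omit [IsManifold (𝓡 n) ∞ M] [T2Space M] [CompactSpace M] in
theorem smooth_neg [IsManifold (𝓡 n) ∞ M]
    (hX : ContMDiff (𝓡 n) (𝓡 n).tangent ∞ (fun m => (⟨m, X m⟩ : TangentBundle (𝓡 n) M))) :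
    ContMDiff (𝓡 n) (𝓡 n).tangent ∞ (fun m => (⟨m, (-X) m⟩ : TangentBundle (𝓡 n) M)) :=
  hX.neg_section

/-- A smooth vector field on a closed manifold has a global flow; its time `t` maps with `t ≥ 0` are
differentiable. -/
theorem exists_flow_nonneg
    (hX : ContMDiff (𝓡 n) (𝓡 n).tangent ∞ (fun m => (⟨m, X m⟩ : TangentBundle (𝓡 n) M))) :
    ∃ φ : Flow ℝ M, (∀ p, IsMIntegralCurve (fun t => φ t p) X) ∧
      (∀ γ : ℝ → M, IsMIntegralCurve γ X → ∀ t, γ t = φ t (γ 0)) ∧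
      ∀ t, 0 ≤ t → ∀ p, MDifferentiableAt (𝓡 n) (𝓡 n) (φ t) p := by
  have hX1 : ContMDiff (𝓡 n) (𝓡 n).tangent 1 (fun m => (⟨m, X m⟩ : TangentBundle (𝓡 n) M)) :=
    hX.of_le (by exact_mod_cast le_top)
  choose N hNo hyN ε hε α hα hαc hαd using exists_local_flow_manifold hX
  -- By compactness the local flows are all defined up to a common time `δ`.
  obtain ⟨s, hs⟩ := isCompact_univ.elim_nhds_subcover N (fun y _ => (hNo y).mem_nhds (hyN y))
  obtain ⟨δ, hδ, hδε⟩ : ∃ δ > (0 : ℝ), ∀ y ∈ s, δ ≤ ε y := by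
    have h : ∀ᶠ δ in 𝓝[>] (0 : ℝ), ∀ y ∈ s, δ ≤ ε y :=
      (eventually_all_finset s).2 fun y _ =>
        mem_nhdsWithin_of_mem_nhds (Iic_mem_nhds (hε y))
    obtain ⟨δ, hδ, hδ'⟩ := (h.and self_mem_nhdsWithin).exists
    exact ⟨δ, hδ', hδ⟩
  have hcov : ∀ p : M, ∃ y ∈ s, p ∈ N y := fun p => by
    simpa using hs.2 (mem_univ p)
  have hsub : ∀ y ∈ s, Ioo (-δ) δ ⊆ Ioo (-ε y) (ε y) := fun y hy =>
    Ioo_subset_Ioo (neg_le_neg (hδε y hy)) (hδε y hy)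
  have hglob := exists_isMIntegralCurve_of_isMIntegralCurveOn hX1 hδ fun p => by
    obtain ⟨y, hy, hp⟩ := hcov p
    exact ⟨α y p, (hα y p hp).1, (hα y p hp).2.mono (hsub y hy)⟩
  choose Φ hΦ0 hΦ using hglob
  have huniq : ∀ γ : ℝ → M, IsMIntegralCurve γ X → ∀ t, γ t = Φ (γ 0) t := fun γ hγ t =>
    congrFun (isMIntegralCurve_Ioo_eq_of_contMDiff_boundaryless (t₀ := 0) hX1 hγ (hΦ _)
      (hΦ0 _).symm) t
  have hadd : ∀ t₁ t₂ p, Φ p (t₁ + t₂) = Φ (Φ p t₂) t₁ := fun t₁ t₂ p => by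
    have := huniq _ ((hΦ p).comp_add t₂) t₁
    simpa using this
  have hloc : ∀ y ∈ s, ∀ p ∈ N y, ∀ t ∈ Ioo (-δ) δ, Φ p t = α y p t := fun y hy p hp t ht =>
    isMIntegralCurveOn_Ioo_eqOn_of_contMDiff_boundaryless (t₀ := 0) ⟨by linarith, hδ⟩ hX1
      ((hΦ p).isMIntegralCurveOn _) ((hα y p hp).2.mono (hsub y hy))
      ((hΦ0 p).trans (hα y p hp).1.symm) ht
  have hnear : ∀ p, ∀ t ∈ Ioo (-δ) δ, ContinuousAt (fun q : ℝ × M => Φ q.2 q.1) (t, p) := by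
    intro p t ht
    obtain ⟨y, hy, hp⟩ := hcov p
    have h1 : ContinuousAt (Function.uncurry (α y)) (p, t) := (hαc y).continuousAt
      (prod_mem_nhds ((hNo y).mem_nhds hp) (isOpen_Ioo.mem_nhds (hsub y hy ht)))
    have h2 : ContinuousAt (fun q : ℝ × M => α y q.2 q.1) (t, p) :=
      h1.comp (f := fun q : ℝ × M => (q.2, q.1)) (x := (t, p)) (by fun_prop)
    refine h2.congr ?_
    filter_upwards [prod_mem_nhds (isOpen_Ioo.mem_nhds ht) ((hNo y).mem_nhds hp)] with q hq
    exact (hloc y hy q.2 hq.2 q.1 hq.1).symm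
  -- Continuity and differentiability pass from times of absolute value less than `δ` to their
  -- multiples.
  have hdiv : ∀ t : ℝ, ∃ k : ℕ, ∃ u ∈ Ioo (-δ) δ, t = k * u ∧ (0 ≤ t → 0 ≤ u) := by
    intro t
    obtain ⟨k, hk⟩ := exists_nat_gt (|t| / δ)
    have hk0 : (0 : ℝ) < k := lt_of_le_of_lt (by positivity) hk
    refine ⟨k, t / k, ?_, by field_simp, fun h => by positivity⟩
    rw [mem_Ioo, ← abs_lt, abs_div, abs_of_pos hk0, div_lt_iff₀ hk0]
    rwa [div_lt_iff₀ hδ, mul_comm] at hk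
  have hmul : ∀ (k : ℕ) (u : ℝ) (p : M), Φ p (((k + 1 : ℕ) : ℝ) * u) = Φ (Φ p (k * u)) u := by
    intro k u p
    rw [← hadd]; congr 1; push_cast; ring
  have hcont : ∀ t, Continuous fun p => Φ p t := by
    intro t
    obtain ⟨k, u, hu, rfl, -⟩ := hdiv t
    have hu' : Continuous fun p => Φ p u := continuous_iff_continuousAt.2 fun p =>
      (hnear p u hu).comp (f := fun q : M => (u, q)) (by fun_prop)
    induction k with
    | zero => simpa [hΦ0] using continuous_id'
    | succ k ih =>
      simp only [hmul]
      exact hu'.comp ih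
  refine ⟨⟨fun t p => Φ p t, ?_, hadd, hΦ0⟩, hΦ, huniq, ?_⟩
  · refine continuous_iff_continuousAt.2 fun ⟨t, p⟩ => ?_
    have h1 : (Function.uncurry fun t p => Φ p t) =
        (fun q : ℝ × M => Φ q.2 q.1) ∘ fun q : ℝ × M => (q.1 - t, Φ q.2 t) := by
      ext q
      simp [Function.uncurry, ← hadd]
    rw [h1]
    refine ContinuousAt.comp (hnear _ _ ?_) ?_
    · simpa using hδ
    · exact ((continuous_fst.sub continuous_const).prodMk
        ((hcont t).comp continuous_snd)).continuousAt
  · intro t ht p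
    obtain ⟨k, u, hu, rfl, hu0⟩ := hdiv t
    rcases Nat.eq_zero_or_pos k with rfl | hk
    · have : (fun p => Φ p ((0 : ℕ) * u)) = id := by ext; simp [hΦ0]
      change MDifferentiableAt _ _ (fun p => Φ p ((0 : ℕ) * u)) p
      rw [this]; exact mdifferentiableAt_id
    have hu0 := hu0 ht
    have hstep : ∀ p, MDifferentiableAt (𝓡 n) (𝓡 n) (fun q => Φ q u) p := by
      intro p
      obtain ⟨y, hy, hp⟩ := hcov p
      refine (hαd y p hp u ⟨hu0, (hsub y hy hu).2⟩).congr_of_eventuallyEq ?_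
      filter_upwards [(hNo y).mem_nhds hp] with q hq
      exact hloc y hy q hq u hu
    have hall : ∀ (k : ℕ) p, MDifferentiableAt (𝓡 n) (𝓡 n) (fun q => Φ q (k * u)) p := by
      intro k
      induction k with
      | zero =>
        intro p
        have : (fun p => Φ p ((0 : ℕ) * u)) = id := by ext; simp [hΦ0]
        rw [this]; exact mdifferentiableAt_id
      | succ k ih =>
        intro p
        simp only [hmul]
        exact (hstep _).comp p (ih p)
    exact hall k p

/-- A smooth vector field on a closed manifold has a flow in the sense of `IsFlowOf`: the time maps
with negative time belong to the flow of `-X`. -/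
theorem exists_isFlowOf
    (hX : ContMDiff (𝓡 n) (𝓡 n).tangent ∞ (fun m => (⟨m, X m⟩ : TangentBundle (𝓡 n) M))) :
    ∃ φ : Flow ℝ M, IsFlowOf φ X := by
  obtain ⟨φ, h1, h2, h3⟩ := exists_flow_nonneg hX
  obtain ⟨ψ, k1, k2, k3⟩ := exists_flow_nonneg (smooth_neg hX)
  have hψ : ∀ t p, φ (-t) p = ψ t p := by
    intro t p
    have h := k2 (fun t => φ (-t) p) (by
      have := (h1 p).comp_mul (-1)
      simpa [Function.comp_def] using this) t
    simpa [φ.map_zero_apply] using h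
  refine ⟨φ, h1, h2, fun t p => ?_⟩
  rcases le_total 0 t with ht | ht
  · exact h3 t ht p
  · have : φ t = ψ (-t) := by ext q; rw [← hψ, neg_neg]
    rw [this]
    exact k3 _ (by linarith) p

/-- The flow of `-X` is the reversed flow of `X`. -/
theorem IsFlowOf.reverse {φ : Flow ℝ M} (h : IsFlowOf φ X) : IsFlowOf φ.reverse (-X) where
  integral p := by
    have := (h.integral p).comp_mul (-1)
    simpa [Function.comp_def] using this
  unique γ hγ t := by
    have h1 := hγ.comp_mul (-1)
    have h2 := h.unique (γ ∘ fun t => t * (-1)) (by simpa using h1) (-t)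
    simpa using h2
  mdifferentiableAt t p := h.mdifferentiableAt (-t) p

end Flow

/-! ### Bilinear forms with definite symmetric part -/

section PositiveForms

open LinearMap (BilinForm)

/-- A linear functional is bounded by a positive definite, not necessarily symmetric, form. -/
theorem exists_sq_le_of_pos {V : Type*} [AddCommGroup V] [Module ℝ V] [FiniteDimensional ℝ V]
    (P : BilinForm ℝ V) (hP : ∀ v, v ≠ 0 → 0 < P v v) (g : V →ₗ[ℝ] ℝ) :
    ∃ C : ℝ, 0 ≤ C ∧ ∀ v, g v ^ 2 ≤ C * P v v := by
  set S : BilinForm ℝ V := P + P.flip with hS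
  have hSs : ∀ x y, S x y = S y x := fun x y => by simp [hS, add_comm]
  have hSv : ∀ v, S v v = 2 * P v v := fun v => by simp [hS]; ring
  have hS0 : ∀ v, 0 ≤ S v v := fun v => by
    rcases eq_or_ne v 0 with rfl | h
    · simp
    · rw [hSv]; linarith [hP v h]
  have hinj : Function.Injective S := by
    rw [injective_iff_map_eq_zero]
    intro v hv
    by_contra h
    have h1 := hP v h
    have h2 := hSv v
    rw [hv] at h2
    simp at h2
    linarith
  have hsurj : Function.Surjective S := by
    have hd : Module.finrank ℝ V = Module.finrank ℝ (V →ₗ[ℝ] ℝ) :=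
      (Subspace.dual_finrank_eq (K := ℝ) (V := V)).symm
    exact (LinearMap.injective_iff_surjective_of_finrank_eq_finrank hd).1 hinj
  obtain ⟨a, ha⟩ := hsurj g
  refine ⟨S a a * 2, by linarith [hS0 a], fun v => ?_⟩
  have h := LinearMap.BilinForm.apply_mul_apply_le_of_forall_zero_le S hS0 a v
  have h2 : g a = S a a := by rw [ha]
  rw [hSs v a, ha, hSv v, h2] at h
  nlinarith

/-- Completing the square absorbs the mixed terms of a block triangular quadratic form. -/
theorem pos_of_absorb {a b x y c d p C₁ C₂ : ℝ} (ha : 0 < a) (hC₁ : 0 ≤ C₁) (hC₂ : 0 ≤ C₂)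
    (hc : c ^ 2 ≤ C₁ * p) (hd : d ^ 2 ≤ C₂ * p) (h : 0 < p ∨ (p = 0 ∧ 0 < x * x + y * y)) :
    0 < p + a / (C₁ + C₂ + 1) * (x * (a * x - b * y + c) + y * (a * y + b * x + d)) := by
  have hp : 0 ≤ p := h.elim le_of_lt fun h => h.1.ge
  have h1 : a * (x * x + y * y) / 2 - (C₁ + C₂) * p / (2 * a) ≤
      x * (a * x - b * y + c) + y * (a * y + b * x + d) := by
    have h2 : 0 ≤ ((a * x + c) ^ 2 + (a * y + d) ^ 2) / (2 * a) := by positivity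
    have h3 : ((a * x + c) ^ 2 + (a * y + d) ^ 2) / (2 * a) =
        a * (x * x + y * y) / 2 + (x * c + y * d) + (c ^ 2 + d ^ 2) / (2 * a) := by
      field_simp; ring
    have h4 : (c ^ 2 + d ^ 2) / (2 * a) ≤ (C₁ + C₂) * p / (2 * a) := by gcongr; linarith
    linarith
  have h5 : a / (C₁ + C₂ + 1) * ((C₁ + C₂) * p / (2 * a)) ≤ p / 2 := by
    have : a / (C₁ + C₂ + 1) * ((C₁ + C₂) * p / (2 * a)) = (C₁ + C₂) / (C₁ + C₂ + 1) * (p / 2) := by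
      field_simp
    rw [this]
    exact mul_le_of_le_one_left (by linarith) ((div_le_one (by positivity)).2 (by linarith))
  have hε : 0 < a / (C₁ + C₂ + 1) := by positivity
  have h6 := mul_le_mul_of_nonneg_left h1 hε.le
  rw [mul_sub] at h6
  have hxy : 0 ≤ x * x + y * y := add_nonneg (mul_self_nonneg x) (mul_self_nonneg y)
  rcases h with h | ⟨h, h'⟩
  · have : 0 ≤ a / (C₁ + C₂ + 1) * (a * (x * x + y * y) / 2) := by positivity
    linarith
  · have : 0 < a / (C₁ + C₂ + 1) * (a * (x * x + y * y) / 2) := by positivity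
    linarith

/-- An endomorphism of a complex vector space all of whose eigenvalues have positive real part is
expanding for a suitable Euclidean form. -/
theorem exists_expanding_form_complex (d : ℕ) : ∀ (V : Type*) [AddCommGroup V] [Module ℂ V]
    [FiniteDimensional ℂ V], Module.finrank ℂ V = d → ∀ T : Module.End ℂ V,
    (∀ μ, T.HasEigenvalue μ → 0 < μ.re) → ∃ H : BilinForm ℝ V, (∀ v w, H v w = H w v) ∧
      (∀ v, v ≠ 0 → 0 < H v v) ∧ ∀ v, v ≠ 0 → 0 < H v (T v) := by
  induction d with
  | zero =>
    intro V _ _ _ hd T _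
    have := Module.finrank_zero_iff.1 hd
    exact ⟨0, by simp, fun v hv => (hv (Subsingleton.elim _ _)).elim,
      fun v hv => (hv (Subsingleton.elim _ _)).elim⟩
  | succ d ih =>
    intro V _ _ _ hd T hT
    have hnt : Nontrivial V := Module.nontrivial_of_finrank_pos (R := ℂ) (by omega)
    obtain ⟨μ, hμ⟩ := Module.End.exists_eigenvalue T
    obtain ⟨v₀, hv₀⟩ := hμ.exists_hasEigenvector
    have hTv : T v₀ = μ • v₀ := hv₀.apply_eq_smul
    have hv0 : v₀ ≠ 0 := hv₀.2
    set a := μ.re with ha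
    have ha0 : 0 < a := hT μ hμ
    -- In the quotient by the line of an eigenvector `v₀` there is a form `H'` by induction. With a
    -- functional `ℓ` that is `1` at `v₀`, the form `H' + ε |ℓ|²` is expanding for small `ε`.
    set W := Submodule.span ℂ {v₀} with hW
    have hmap : W ≤ W.comap T := by
      rw [hW, Submodule.span_le, singleton_subset_iff]
      change T v₀ ∈ Submodule.span ℂ {v₀}
      rw [hTv]
      exact Submodule.smul_mem _ _ (Submodule.mem_span_singleton_self _)
    set T' : Module.End ℂ (V ⧸ W) := W.mapQ W T hmap with hT'
    have hd' : Module.finrank ℂ (V ⧸ W) = d := by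
      have := Submodule.finrank_quotient_add_finrank W
      rw [finrank_span_singleton hv0] at this
      omega
    obtain ⟨H', hs', hp', hx'⟩ := ih (V ⧸ W) hd' T' (fun ν hν => by
      refine hT ν ?_
      by_contra hcon
      -- If `ν` is not an eigenvalue of `T`, then `T - ν` is surjective, hence so is the map induced
      -- on the quotient.
      have hinj : Function.Injective (T - algebraMap ℂ (Module.End ℂ V) ν) := by
        rw [← LinearMap.ker_eq_bot]
        by_contra h
        exact hcon ((Module.End.hasEigenvalue_iff.2 (by rwa [Module.End.eigenspace_def])))
      have hsurj := LinearMap.injective_iff_surjective.1 hinj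
      have hsurj' : Function.Surjective (T' - algebraMap ℂ (Module.End ℂ (V ⧸ W)) ν) := by
        intro q
        obtain ⟨v, rfl⟩ := Submodule.mkQ_surjective W q
        obtain ⟨w, rfl⟩ := hsurj v
        exact ⟨W.mkQ w, by simp [hT', Module.algebraMap_end_apply]⟩
      have hinj' := LinearMap.injective_iff_surjective.2 hsurj'
      obtain ⟨q, hq⟩ := hν.exists_hasEigenvector
      refine hq.2 (hinj' ?_)
      simp [hq.apply_eq_smul, Module.algebraMap_end_apply])
    obtain ⟨ℓ, hℓ⟩ : ∃ ℓ : V →ₗ[ℂ] ℂ, ℓ v₀ = 1 := by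
      obtain ⟨f, hf⟩ : ∃ f : Module.Dual ℂ V, f v₀ ≠ 0 := by
        by_contra! h
        exact hv0 ((Module.forall_dual_apply_eq_zero_iff ℂ v₀).1 h)
      exact ⟨(f v₀)⁻¹ • f, by simp [hf]⟩
    -- The mixed term `ℓ ∘ T - μ ℓ` vanishes at `v₀`, so it is bounded by the form on the quotient.
    set k : V →ₗ[ℂ] ℂ := ℓ ∘ₗ T - μ • ℓ with hk
    have hkW : W ≤ LinearMap.ker k := by
      rw [hW, Submodule.span_le, singleton_subset_iff]
      change k v₀ = 0
      simp [hk, hTv, hℓ]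
    set k' := W.liftQ k hkW with hk'
    set P : BilinForm ℝ (V ⧸ W) := H'.compRight (T'.restrictScalars ℝ) with hP
    have hPos : ∀ q, q ≠ 0 → 0 < P q q := fun q hq => hx' q hq
    have : FiniteDimensional ℝ (V ⧸ W) := FiniteDimensional.complexToReal _
    obtain ⟨C₁, hC₁, hb₁⟩ := exists_sq_le_of_pos P hPos
      (Complex.reLm ∘ₗ k'.restrictScalars ℝ)
    obtain ⟨C₂, hC₂, hb₂⟩ := exists_sq_le_of_pos P hPos
      (Complex.imLm ∘ₗ k'.restrictScalars ℝ)
    set ε := a / (C₁ + C₂ + 1) with hε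
    have hε0 : 0 < ε := by positivity
    set π : V →ₗ[ℝ] V ⧸ W := W.mkQ.restrictScalars ℝ with hπ
    set ℓr : V →ₗ[ℝ] ℝ := Complex.reLm ∘ₗ ℓ.restrictScalars ℝ with hℓr
    set ℓi : V →ₗ[ℝ] ℝ := Complex.imLm ∘ₗ ℓ.restrictScalars ℝ with hℓi
    have hker : ∀ v, π v = 0 → ℓ v = 0 → v = 0 := by
      intro v h1 h2
      obtain ⟨c, rfl⟩ := Submodule.mem_span_singleton.1 ((Submodule.Quotient.mk_eq_zero W).1 h1)
      simp [hℓ] at h2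
      simp [h2]
    have hval : ∀ v w, (H'.comp π π + ε • (BilinForm.linMulLin ℓr ℓr + BilinForm.linMulLin ℓi ℓi))
        v w = H' (π v) (π w) + ε * ((ℓ v).re * (ℓ w).re + (ℓ v).im * (ℓ w).im) := by
      intro v w; simp [hℓr, hℓi]; ring
    refine ⟨H'.comp π π + ε • (BilinForm.linMulLin ℓr ℓr + BilinForm.linMulLin ℓi ℓi),
      fun v w => ?_, fun v hv => ?_, fun v hv => ?_⟩
    · rw [hval, hval, hs']; ring
    · rw [hval]
      by_cases h : π v = 0
      · have h2 : ℓ v ≠ 0 := fun h2 => hv (hker v h h2)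
        have := Complex.normSq_pos.2 h2
        rw [Complex.normSq_apply] at this
        rw [h]; simp; positivity
      · have := hp' _ h
        nlinarith [mul_self_nonneg (ℓ v).re, mul_self_nonneg (ℓ v).im]
    · rw [hval]
      have hπT : π (T v) = T' (π v) := by simp [hπ, hT']
      have hℓT : ℓ (T v) = μ * ℓ v + k' (π v) := by simp [hπ, hk', hk]
      rw [hπT, hℓT]
      have e1 := hb₁ (π v)
      have e2 := hb₂ (π v)
      change (k' (π v)).re ^ 2 ≤ C₁ * H' (π v) (T' (π v)) at e1
      change (k' (π v)).im ^ 2 ≤ C₂ * H' (π v) (T' (π v)) at e2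
      have e3 : π v ≠ 0 → 0 < H' (π v) (T' (π v)) := hx' _
      have e4 : π v = 0 → 0 < (ℓ v).re * (ℓ v).re + (ℓ v).im * (ℓ v).im := fun h => by
        have h2 : ℓ v ≠ 0 := fun h2 => hv (hker v h h2)
        have := Complex.normSq_pos.2 h2
        rwa [Complex.normSq_apply] at this
      have e5 : π v = 0 → H' (π v) (T' (π v)) = 0 := fun h => by rw [h]; simp
      have h := pos_of_absorb (b := μ.im) ha0 hC₁ hC₂ e1 e2 (x := (ℓ v).re) (y := (ℓ v).im) (by
        by_cases h : π v = 0
        · exact Or.inr ⟨e5 h, e4 h⟩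
        · exact Or.inl (e3 h))
      simp only [Complex.add_re, Complex.mul_re, Complex.add_im, Complex.mul_im]
      rw [← hε] at h
      convert h using 5

end PositiveForms

/-! ### Quadratic forms adapted to a hyperbolic linear map -/

section HyperbolicForms

open LinearMap (BilinForm)
open Polynomial TensorProduct

/-- The roots of an irreducible real polynomial are conjugate, hence have the same real part. -/
theorem re_eq_of_irreducible {p : ℝ[X]} (hp : Irreducible p) {z w : ℂ} (hz : aeval z p = 0)
    (hw : aeval w p = 0) : z.re = w.re := by
  have h : minpoly ℝ z = minpoly ℝ w :=
    (minpoly.eq_of_irreducible hp hz).symm.trans (minpoly.eq_of_irreducible hp hw)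
  have hc : IsConjRoot ℝ z w := h
  have : Normal ℝ ℂ :=
    normal_iff.2 fun x => ⟨Algebra.IsIntegral.isIntegral x, IsAlgClosed.splits _⟩
  obtain ⟨σ, rfl⟩ := (isConjRoot_iff_exists_algEquiv).1 hc
  rcases Complex.real_algHom_eq_id_or_conj (σ : ℂ →ₐ[ℝ] ℂ) with h | h
  · have := DFunLike.congr_fun h w
    simp at this
    rw [this]
  · have := DFunLike.congr_fun h w
    simp at this
    rw [this]; simp

/-- A real polynomial without imaginary roots is the product of one whose roots have positive real
parts and one whose roots have negative real parts. -/
theorem exists_factorization_of_re_ne_zero (p : ℝ[X]) (hp : p ≠ 0) :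
    (∀ z : ℂ, aeval z p = 0 → z.re ≠ 0) → ∃ q r : ℝ[X], p = q * r ∧
      (∀ z : ℂ, aeval z q = 0 → 0 < z.re) ∧ (∀ z : ℂ, aeval z r = 0 → z.re < 0) := by
  induction p using WfDvdMonoid.induction_on_irreducible with
  | zero => exact (hp rfl).elim
  | unit u hu =>
    intro _
    refine ⟨u, 1, by simp, fun z hz => ?_, fun z hz => by simp at hz⟩
    exact ((hu.map (aeval z)).ne_zero hz).elim
  | mul a i ha hi ih =>
    intro h
    obtain ⟨q, r, rfl, hq, hr⟩ := ih ha fun z hz => h z (by simp [hz])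
    obtain ⟨z₀, hz₀⟩ : ∃ z : ℂ, aeval z i = 0 :=
      IsAlgClosed.exists_aeval_eq_zero ℂ i (degree_pos_of_irreducible hi).ne'
    rcases lt_or_gt_of_ne (h z₀ (by simp [hz₀])) with h0 | h0
    · refine ⟨q, i * r, by ring, hq, fun z hz => ?_⟩
      rw [map_mul, mul_eq_zero] at hz
      rcases hz with hz | hz
      · rwa [re_eq_of_irreducible hi hz hz₀]
      · exact hr z hz
    · refine ⟨i * q, r, by ring, fun z hz => ?_, hr⟩
      rw [map_mul, mul_eq_zero] at hz
      rcases hz with hz | hz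
      · rwa [re_eq_of_irreducible hi hz hz₀]
      · exact hq z hz

universe u in
/-- An expanding form for a complex endomorphism restricts to an invariant real subspace. -/
theorem exists_form_of_complex_embedding {V V' : Type u} [AddCommGroup V] [Module ℝ V]
    [AddCommGroup V'] [Module ℂ V'] [FiniteDimensional ℂ V'] (B : Module.End ℝ V)
    (T : Module.End ℂ V') (ι : V →+ V') (hι : Function.Injective ι)
    (hs : ∀ (r : ℝ) v, ι (r • v) = (r : ℂ) • ι v) (hT : ∀ v, T (ι v) = ι (B v))
    (hpos : ∀ μ, T.HasEigenvalue μ → 0 < μ.re) : ∃ H : BilinForm ℝ V, (∀ v w, H v w = H w v) ∧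
      (∀ v, v ≠ 0 → 0 < H v v) ∧ ∀ v, v ≠ 0 → 0 < H v (B v) := by
  obtain ⟨H, h1, h2, h3⟩ := exists_expanding_form_complex _ V' rfl T hpos
  set ι' : V →ₗ[ℝ] V' := { ι with map_smul' := fun r v => by simpa using! hs r v } with hι'
  have h0 : ∀ v, v ≠ 0 → ι v ≠ 0 := fun v hv h => hv (hι (by simpa using h))
  refine ⟨H.comp ι' ι', fun v w => h1 _ _, fun v hv => h2 _ (h0 v hv), fun v hv => ?_⟩
  have := h3 _ (h0 v hv)
  rwa [hT] at this

theorem aeval_eigenvalue_baseChange {V : Type*} [AddCommGroup V] [Module ℝ V]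
    {B : Module.End ℝ V} {q : ℝ[X]} (hq : aeval B q = 0) {μ : ℂ}
    (hμ : (Module.End.baseChangeHom ℝ ℂ V B).HasEigenvalue μ) : aeval μ q = 0 := by
  obtain ⟨w, hw⟩ := hμ.exists_hasEigenvector
  have h1 := Module.End.aeval_apply_of_hasEigenvector (p := q.map (algebraMap ℝ ℂ)) hw
  rw [aeval_map_algebraMap, aeval_algHom_apply, hq, map_zero] at h1
  simp only [LinearMap.zero_apply, eval_map_algebraMap] at h1
  exact (smul_eq_zero.1 h1.symm).resolve_right hw.2

/-- An endomorphism of a real vector space annihilated by a polynomial whose roots have positive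
real parts is expanding for a suitable Euclidean form. -/
theorem exists_expanding_form {V : Type*} [AddCommGroup V] [Module ℝ V] [FiniteDimensional ℝ V]
    (B : Module.End ℝ V) {q : ℝ[X]} (hq : aeval B q = 0)
    (hpos : ∀ z : ℂ, aeval z q = 0 → 0 < z.re) : ∃ H : BilinForm ℝ V, (∀ v w, H v w = H w v) ∧
      (∀ v, v ≠ 0 → 0 < H v v) ∧ ∀ v, v ≠ 0 → 0 < H v (B v) := by
  refine exists_form_of_complex_embedding B (Module.End.baseChangeHom ℝ ℂ V B)
    (TensorProduct.mk ℝ ℂ V 1).toAddMonoidHom ?_ ?_ ?_ ?_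
  · exact Module.FaithfullyFlat.tensorProduct_mk_injective V
  · intro r v
    change (1 : ℂ) ⊗ₜ[ℝ] (r • v) = (r : ℂ) • ((1 : ℂ) ⊗ₜ[ℝ] v)
    rw [TensorProduct.smul_tmul', TensorProduct.tmul_smul, TensorProduct.smul_tmul']
    simp
  · intro v
    rfl
  · exact fun μ hμ => hpos μ (aeval_eigenvalue_baseChange hq hμ)

theorem roots_charpoly_of_aeval {V : Type*} [AddCommGroup V] [Module ℝ V] [FiniteDimensional ℝ V]
    {B : Module.End ℝ V} {q : ℝ[X]} (hq : aeval B q = 0) {μ : ℂ}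
    (hμ : μ ∈ (B.charpoly.map (algebraMap ℝ ℂ)).roots) : aeval μ q = 0 := by
  refine aeval_eigenvalue_baseChange hq ?_
  rw [Module.End.hasEigenvalue_iff_isRoot_charpoly]
  have := isRoot_of_mem_roots hμ
  rw [← LinearMap.charpoly_baseChange] at this
  exact this

theorem card_roots_charpoly {V : Type*} [AddCommGroup V] [Module ℝ V] [FiniteDimensional ℝ V]
    (B : Module.End ℝ V) :
    Multiset.card (B.charpoly.map (algebraMap ℝ ℂ)).roots = Module.finrank ℝ V := by
  rw [splits_iff_card_roots.1 (IsAlgClosed.splits _), natDegree_map, LinearMap.charpoly_natDegree]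

/-- The linear normal form of a hyperbolic endomorphism `A`: there are positive semidefinite forms
`P` and `N`, Euclidean on the unstable and the stable subspace respectively and zero on the other
one, such that `P` increases and `N` decreases along the linear flow of `A`. -/
theorem exists_hyperbolic_forms {V : Type*} [AddCommGroup V] [Module ℝ V] [FiniteDimensional ℝ V]
    (A : Module.End ℝ V) (hA : ∀ μ ∈ (A.charpoly.map (algebraMap ℝ ℂ)).roots, μ.re ≠ 0) :
    ∃ P N : BilinForm ℝ V, (∀ v w, P v w = P w v) ∧ (∀ v w, N v w = N w v) ∧
      (∀ v, 0 ≤ P v v) ∧ (∀ v, 0 ≤ N v v) ∧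
      (∀ v, 0 ≤ P v (A v)) ∧ (∀ v, N v (A v) ≤ 0) ∧ (∀ v, v ≠ 0 → 0 < P v (A v) - N v (A v)) ∧
      (∀ S : Submodule ℝ V, (∀ v ∈ S, P v v ≤ N v v) → Module.finrank ℝ S +
        Multiset.card ((A.charpoly.map (algebraMap ℝ ℂ)).roots.filter fun μ => 0 < μ.re) ≤
          Module.finrank ℝ V) ∧
      ∀ S : Submodule ℝ V, (∀ v ∈ S, N v v ≤ P v v) → Module.finrank ℝ S ≤
        Multiset.card ((A.charpoly.map (algebraMap ℝ ℂ)).roots.filter fun μ => 0 < μ.re) := by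
  have hne : A.charpoly ≠ 0 := (LinearMap.charpoly_monic A).ne_zero
  have hne' : A.charpoly.map (algebraMap ℝ ℂ) ≠ 0 := by
    rwa [Polynomial.map_ne_zero_iff (algebraMap ℝ ℂ).injective]
  -- The space is the sum of `ker q(A)` and `ker r(A)`, on which `A` and `-A` respectively are
  -- expanding for some Euclidean form; `P` and `N` are these forms composed with the projections.
  obtain ⟨q, r, hqr, hq, hr⟩ := exists_factorization_of_re_ne_zero A.charpoly hne fun z hz =>
    hA z (by rw [mem_roots hne', IsRoot.def, eval_map_algebraMap, hz])
  have hcop : IsCoprime q r := by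
    rw [← isCoprime_map (algebraMap ℝ ℂ), isCoprime_iff_aeval_ne_zero_of_isAlgClosed ℂ ℂ]
    intro z
    by_contra! h
    have h1 := hq z (by simpa using h.1)
    have h2 := hr z (by simpa using h.2)
    linarith
  set U := LinearMap.ker (aeval A q) with hU
  set S := LinearMap.ker (aeval A r) with hS
  have hUS : IsCompl U S := by
    refine ⟨Polynomial.disjoint_ker_aeval_of_isCoprime A hcop, codisjoint_iff.2 ?_⟩
    rw [hU, hS, Polynomial.sup_ker_aeval_eq_ker_aeval_mul_of_coprime A hcop, ← hqr,
      LinearMap.aeval_self_charpoly, LinearMap.ker_zero]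
  have hinv : ∀ p : ℝ[X], ∀ v ∈ LinearMap.ker (aeval A p), A v ∈ LinearMap.ker (aeval A p) := by
    intro p v hv
    rw [LinearMap.mem_ker] at hv ⊢
    have : aeval A p * A = A * aeval A p := by
      have := congrArg (aeval A) (mul_comm p X)
      simpa using this
    have h2 := DFunLike.congr_fun this v
    simp only [Module.End.mul_apply] at h2
    rw [h2, hv, map_zero]
  set F : Module.End ℝ U := A.restrict (hinv q) with hF
  set G : Module.End ℝ S := A.restrict (hinv r) with hG
  have haev : ∀ (p : ℝ[X]) (W : Submodule ℝ V) (h : ∀ v ∈ W, A v ∈ W) (v : W),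
      ((aeval (A.restrict h) p v : W) : V) = aeval A p (v : V) := by
    intro p W h v
    induction p using Polynomial.induction_on' with
    | add p q hp hq => simp [hp, hq]
    | monomial k c =>
      simp only [aeval_monomial, Module.End.mul_apply, Module.algebraMap_end_apply,
        Module.End.pow_restrict _ h, LinearMap.coe_restrict_apply, Submodule.coe_smul]
  have hFq : aeval F q = 0 := by
    ext v; rw [haev]; exact v.2
  have hGr : aeval G r = 0 := by
    ext v; rw [haev]; exact v.2
  set e := Submodule.prodEquivOfIsCompl U S hUS with he
  have hψ : F.prodMap G = e.symm.conj A := by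
    refine LinearMap.ext fun ⟨u, s⟩ => ?_
    rw [LinearEquiv.conj_apply]
    simp only [LinearMap.prodMap_apply, LinearMap.comp_apply, LinearEquiv.coe_coe,
      LinearEquiv.symm_symm, LinearEquiv.eq_symm_apply]
    simp [he, hF, hG]
  have hchar : A.charpoly = F.charpoly * G.charpoly := by
    rw [← e.symm.charpoly_conj A, ← hψ, LinearMap.charpoly_prodMap]
  have hcard : Multiset.card ((A.charpoly.map (algebraMap ℝ ℂ)).roots.filter fun μ => 0 < μ.re) =
      Module.finrank ℝ U := by
    rw [hchar, Polynomial.map_mul, roots_mul (by rwa [← Polynomial.map_mul, ← hchar]),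
      Multiset.filter_add,
      Multiset.filter_eq_self.2 fun z hz => hq z (roots_charpoly_of_aeval hFq hz),
      Multiset.filter_eq_nil.2 fun z hz => (hr z (roots_charpoly_of_aeval hGr hz)).not_gt,
      add_zero, card_roots_charpoly]
  have hdim : Module.finrank ℝ U + Module.finrank ℝ S = Module.finrank ℝ V :=
    Submodule.finrank_add_eq_of_isCompl hUS
  obtain ⟨HU, hU1, hU2, hU3⟩ := exists_expanding_form F hFq hq
  obtain ⟨HS, hS1, hS2, hS3⟩ := exists_expanding_form (-G) (q := r.comp (-X)) (by
    rw [aeval_comp]; simpa using hGr) (fun z hz => by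
      rw [aeval_comp] at hz
      have := hr (-z) (by simpa using hz)
      simpa using this)
  set πU : V →ₗ[ℝ] U := LinearMap.fst ℝ U S ∘ₗ e.symm.toLinearMap with hπU
  set πS : V →ₗ[ℝ] S := LinearMap.snd ℝ U S ∘ₗ e.symm.toLinearMap with hπS
  have hUA : ∀ v, πU (A v) = F (πU v) := fun v => by
    have := congrArg Prod.fst (DFunLike.congr_fun hψ (e.symm v))
    rw [LinearEquiv.conj_apply] at this
    simpa [hπU] using this.symm
  have hSA : ∀ v, πS (A v) = G (πS v) := fun v => by
    have := congrArg Prod.snd (DFunLike.congr_fun hψ (e.symm v))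
    rw [LinearEquiv.conj_apply] at this
    simpa [hπS] using this.symm
  have hzero : ∀ v, πU v = 0 → πS v = 0 → v = 0 := fun v h1 h2 => by
    have : e.symm v = 0 := Prod.ext h1 h2
    simpa using this
  have hU2' : ∀ u, 0 ≤ HU u u := fun u => by
    rcases eq_or_ne u 0 with rfl | h
    exacts [by simp, (hU2 u h).le]
  have hS2' : ∀ u, 0 ≤ HS u u := fun u => by
    rcases eq_or_ne u 0 with rfl | h
    exacts [by simp, (hS2 u h).le]
  have hU3' : ∀ u, 0 ≤ HU u (F u) := fun u => by
    rcases eq_or_ne u 0 with rfl | h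
    exacts [by simp, (hU3 u h).le]
  have hS3' : ∀ u, HS u (G u) ≤ 0 := fun u => by
    rcases eq_or_ne u 0 with rfl | h
    · simp
    · have := hS3 u h
      simp at this
      exact this.le
  refine ⟨HU.comp πU πU, HS.comp πS πS, fun v w => hU1 _ _, fun v w => hS1 _ _, fun v => hU2' _,
    fun v => hS2' _, fun v => ?_, fun v => ?_, fun v hv => ?_, fun W hW => ?_, fun W hW => ?_⟩
  · simp only [LinearMap.BilinForm.comp_apply, hUA]; exact hU3' _
  · simp only [LinearMap.BilinForm.comp_apply, hSA]; exact hS3' _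
  · simp only [LinearMap.BilinForm.comp_apply, hUA, hSA]
    by_cases h : πU v = 0
    · have h2 := hS3 (πS v) fun h2 => hv (hzero v h h2)
      simp at h2
      rw [h]; simpa using h2
    · have := hU3 _ h; have := hS3' (πS v)
      linarith
  · rw [hcard]
    -- Where `P ≤ N`, the stable component determines the vector.
    have hinj : Function.Injective (πS ∘ₗ W.subtype) := by
      rw [injective_iff_map_eq_zero]
      rintro ⟨v, hv⟩ h
      simp only [LinearMap.comp_apply, Submodule.subtype_apply] at h
      have h1 := hW v hv
      simp only [LinearMap.BilinForm.comp_apply, h, map_zero] at h1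
      have h2 : πU v = 0 := by
        by_contra h2
        exact absurd (hU2 _ h2) (not_lt.2 h1)
      exact Subtype.ext (hzero v h2 h)
    have := LinearMap.finrank_le_finrank_of_injective hinj
    omega
  · rw [hcard]
    -- Where `N ≤ P`, the unstable component determines the vector.
    have hinj : Function.Injective (πU ∘ₗ W.subtype) := by
      rw [injective_iff_map_eq_zero]
      rintro ⟨v, hv⟩ h
      simp only [LinearMap.comp_apply, Submodule.subtype_apply] at h
      have h1 := hW v hv
      simp only [LinearMap.BilinForm.comp_apply, h, map_zero] at h1
      have h2 : πS v = 0 := by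
        by_contra h2
        exact absurd (hS2 _ h2) (not_lt.2 h1)
      exact Subtype.ext (hzero v h h2)
    exact LinearMap.finrank_le_finrank_of_injective hinj

end HyperbolicForms

/-! ### Expansion near a hyperbolic zero -/

section LocalExpansion

open LinearMap (BilinForm)

variable {E : Type*} [NormedAddCommGroup E] [NormedSpace ℝ E] [FiniteDimensional ℝ E]

theorem exists_bilin_bound (Q : BilinForm ℝ E) :
    ∃ C : ℝ, 0 < C ∧ ∀ v w, |Q v w| ≤ C * ‖v‖ * ‖w‖ := by
  set Q' : E →L[ℝ] E →L[ℝ] ℝ := LinearMap.toContinuousLinearMap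
    ((LinearMap.toContinuousLinearMap (𝕜 := ℝ) (E := E) (F' := ℝ)).toLinearMap ∘ₗ Q) with hQ'
  refine ⟨‖Q'‖ + 1, by positivity, fun v w => ?_⟩
  have h : Q v w = Q' v w := rfl
  rw [h, ← Real.norm_eq_abs]
  refine (Q'.le_opNorm₂ v w).trans ?_
  gcongr
  linarith

theorem continuous_bilin (Q : BilinForm ℝ E) : Continuous fun p : E × E => Q p.1 p.2 := by
  set Q' : E →L[ℝ] E →L[ℝ] ℝ := LinearMap.toContinuousLinearMap
    ((LinearMap.toContinuousLinearMap (𝕜 := ℝ) (E := E) (F' := ℝ)).toLinearMap ∘ₗ Q) with hQ'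
  have : (fun p : E × E => Q p.1 p.2) = fun p => Q' p.1 p.2 := rfl
  rw [this]
  fun_prop

theorem hasDerivAt_bilin_self {Q : BilinForm ℝ E} (hQ : ∀ v w, Q v w = Q w v) {g : ℝ → E} {g' : E}
    {t : ℝ} (hg : HasDerivAt g g' t) : HasDerivAt (fun t => Q (g t) (g t)) (2 * Q (g t) g') t := by
  set Q' : E →L[ℝ] E →L[ℝ] ℝ := LinearMap.toContinuousLinearMap
    ((LinearMap.toContinuousLinearMap (𝕜 := ℝ) (E := E) (F' := ℝ)).toLinearMap ∘ₗ Q) with hQ'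
  have h : HasDerivAt (fun t => Q' (g t) (g t)) (Q' (g t) g' + Q' g' (g t)) t :=
    (Q'.hasFDerivAt_of_bilinear hg.hasFDerivAt hg.hasFDerivAt).hasDerivAt.congr_deriv (by simp)
  refine h.congr_deriv ?_
  have e1 : Q' (g t) g' = Q (g t) g' := rfl
  have e2 : Q' g' (g t) = Q g' (g t) := rfl
  rw [e1, e2, hQ g']; ring

/-- Near a zero of a vector field, differences of solutions expand with respect to each form that
expands under the linearization. -/
theorem exists_local_expansion {Y : E → E} {z₀ : E} {A : E →L[ℝ] E} (hY : HasStrictFDerivAt Y A z₀)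
    (Q : BilinForm ℝ E) (hQ : ∀ v, v ≠ 0 → 0 < Q v (A v)) :
    ∃ c > (0 : ℝ), ∀ᶠ p : E × E in 𝓝 (z₀, z₀),
      c * ‖p.1 - p.2‖ ^ 2 ≤ Q (p.1 - p.2) (Y p.1 - Y p.2) := by
  obtain ⟨C, hC, hCb⟩ := exists_bilin_bound Q
  -- The constant is the minimum of the quadratic form on the unit sphere.
  obtain ⟨c, hc, hcb⟩ : ∃ c > (0 : ℝ), ∀ v, c * ‖v‖ ^ 2 ≤ Q v (A v) := by
    rcases subsingleton_or_nontrivial E with h | h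
    · exact ⟨1, one_pos, fun v => by simp [Subsingleton.elim v 0]⟩
    have hcont : Continuous fun v => Q v (A v) :=
      (continuous_bilin Q).comp (continuous_id.prodMk A.continuous)
    obtain ⟨v₀, hv₀, hmin⟩ := (isCompact_sphere (0 : E) 1).exists_isMinOn
      (NormedSpace.sphere_nonempty.2 zero_le_one) hcont.continuousOn
    have hv0 : v₀ ≠ 0 := by
      rintro rfl; simp at hv₀
    refine ⟨Q v₀ (A v₀), hQ v₀ hv0, fun v => ?_⟩
    rcases eq_or_ne v 0 with rfl | hv
    · simp
    have hn : ‖v‖ ≠ 0 := norm_ne_zero_iff.2 hv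
    have h1 : Q v₀ (A v₀) ≤ Q (‖v‖⁻¹ • v) (A (‖v‖⁻¹ • v)) :=
      hmin (by simp [norm_smul, hn])
    simp only [map_smul, LinearMap.smul_apply, smul_eq_mul] at h1
    calc Q v₀ (A v₀) * ‖v‖ ^ 2 ≤ ‖v‖⁻¹ * (‖v‖⁻¹ * Q v (A v)) * ‖v‖ ^ 2 := by gcongr
      _ = Q v (A v) := by field_simp
  refine ⟨c / 2, by positivity, ?_⟩
  have h := hY.isLittleO.def (c := c / (2 * C)) (by positivity)
  filter_upwards [h] with p hp
  have h1 : Q (p.1 - p.2) (Y p.1 - Y p.2) = Q (p.1 - p.2) (A (p.1 - p.2)) +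
      Q (p.1 - p.2) (Y p.1 - Y p.2 - A (p.1 - p.2)) := by
    rw [← map_add]; congr 1; abel
  have h2 := hCb (p.1 - p.2) (Y p.1 - Y p.2 - A (p.1 - p.2))
  have h3 : C * ‖p.1 - p.2‖ * ‖Y p.1 - Y p.2 - A (p.1 - p.2)‖ ≤ c / 2 * ‖p.1 - p.2‖ ^ 2 := by
    calc _ ≤ C * ‖p.1 - p.2‖ * (c / (2 * C) * ‖p.1 - p.2‖) := by gcongr
      _ = _ := by field_simp
  have h4 := hcb (p.1 - p.2)
  have h5 := (abs_le.1 (h2.trans h3)).1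
  rw [h1]; linarith

/-- A function whose derivative is at least `k` times the function grows at least exponentially with
rate `k`. -/
theorem exp_mul_le_of_deriv_ge {f f' : ℝ → ℝ} {k T : ℝ} (hT : 0 ≤ T)
    (hf : ∀ t ∈ Icc 0 T, HasDerivAt f (f' t) t) (hk : ∀ t ∈ Icc 0 T, k * f t ≤ f' t) :
    Real.exp (k * T) * f 0 ≤ f T := by
  have hd : ∀ t ∈ Icc 0 T, HasDerivAt (fun t => Real.exp (-k * t) * f t)
      (Real.exp (-k * t) * (-k * 1) * f t + Real.exp (-k * t) * f' t) t := fun t ht =>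
    (((hasDerivAt_id t).const_mul (-k)).exp).mul (hf t ht)
  have hm : MonotoneOn (fun t => Real.exp (-k * t) * f t) (Icc 0 T) := by
    refine monotoneOn_of_deriv_nonneg (convex_Icc 0 T)
      (fun t ht => (hd t ht).continuousAt.continuousWithinAt)
      (fun t ht => ((hd t (interior_subset ht)).differentiableAt).differentiableWithinAt)
      fun t ht => ?_
    rw [(hd t (interior_subset ht)).deriv]
    have h1 := hk t (interior_subset ht)
    have h2 := Real.exp_pos (-k * t)
    nlinarith
  have h := hm ⟨le_rfl, hT⟩ ⟨hT, le_rfl⟩ hT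
  simp only [mul_zero, Real.exp_zero, one_mul] at h
  have h2 : Real.exp (k * T) * (Real.exp (-k * T) * f T) = f T := by
    rw [← mul_assoc, ← Real.exp_add]; simp
  calc _ ≤ Real.exp (k * T) * (Real.exp (-k * T) * f T) := by gcongr
    _ = _ := h2

/-- Quadratic inequalities between the increments of two curves pass to their velocities. -/
theorem bilin_le_of_hasDerivAt {Q₁ Q₂ : BilinForm ℝ E} {g h : ℝ → E} {a b : E}
    (hg : HasDerivAt g a 0) (hh : HasDerivAt h b 0)
    (hle : ∀ᶠ s in 𝓝 (0 : ℝ), Q₁ (g s - g 0) (g s - g 0) ≤ Q₂ (h s - h 0) (h s - h 0)) :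
    Q₁ a a ≤ Q₂ b b := by
  have hlim : ∀ {Q : BilinForm ℝ E} {g : ℝ → E} {a : E}, HasDerivAt g a 0 →
      Tendsto (fun s : ℝ => Q (s⁻¹ • (g s - g 0)) (s⁻¹ • (g s - g 0))) (𝓝[≠] 0) (𝓝 (Q a a)) := by
    intro Q g a hg
    have h1 := hasDerivAt_iff_tendsto_slope_zero.1 hg
    simp only [zero_add] at h1
    exact ((continuous_bilin Q).tendsto (a, a)).comp (h1.prodMk_nhds h1)
  refine le_of_tendsto_of_tendsto (hlim hg) (hlim hh) ?_
  filter_upwards [hle.filter_mono nhdsWithin_le_nhds] with s hs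
  simp only [map_smul, LinearMap.smul_apply, smul_eq_mul, ← mul_assoc]
  exact mul_le_mul_of_nonneg_left hs (mul_self_nonneg _)

end LocalExpansion

/-! ### Trajectories that stay near a hyperbolic rest point -/

section LocalInvariantSets

open LinearMap (BilinForm)

variable {n : ℕ} {M : Type*} [TopologicalSpace M] [ChartedSpace (EuclideanSpace ℝ (Fin n)) M]
  [IsManifold (𝓡 n) ∞ M] {X : (m : M) → TangentSpace (𝓡 n) m} {φ : Flow ℝ M}

theorem IsFlowOf.apply_rest (hφ : IsFlowOf φ X) {p : M} (hp : X p = 0) (t : ℝ) : φ t p = p :=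
  (hφ.unique (fun _ => p) (isMIntegralCurve_const hp) t).symm

theorem IsFlowOf.continuous_time (φ : Flow ℝ M) (p : M) : Continuous fun t => φ t p :=
  φ.continuous continuous_id continuous_const

/-- At a base point of a chart the vector field in the chart has the linearization as strict
derivative. -/
theorem hasStrictFDerivAt_chartField
    (hX : ContMDiff (𝓡 n) (𝓡 n).tangent ∞ (fun m => (⟨m, X m⟩ : TangentBundle (𝓡 n) M))) (y : M) :
    HasStrictFDerivAt (chartField X y) (linearization X y) (extChartAt (𝓡 n) y y) := by
  have h1 : ContDiffAt ℝ ∞ (chartField X y) (extChartAt (𝓡 n) y y) :=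
    (contDiffOn_chartField hX y).contDiffAt (extChartAt_target_mem_nhds y)
  have h2 : MDifferentiableAt (𝓡 n) 𝓘(ℝ, EuclideanSpace ℝ (Fin n)) (fun p : M =>
      (trivializationAt (EuclideanSpace ℝ (Fin n)) (TangentSpace (𝓡 n)) y ⟨p, X p⟩).2) y :=
    ((Bundle.contMDiffAt_section (n := ∞) y).1 hX.contMDiffAt).mdifferentiableAt (by simp)
  have h3 : linearization X y = fderiv ℝ (chartField X y) (extChartAt (𝓡 n) y y) := by
    refine h2.mfderiv.trans ?_
    rw [ModelWithCorners.range_eq_univ, fderivWithin_univ]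
    rfl
  rw [h3]
  exact h1.hasStrictFDerivAt (by simp)

/-- Near a rest point, the difference of two trajectories in the chart expands exponentially with
respect to each form that expands under the linearization. -/
theorem exists_expanding_nhd (hφ : IsFlowOf φ X)
    (hX : ContMDiff (𝓡 n) (𝓡 n).tangent ∞ (fun m => (⟨m, X m⟩ : TangentBundle (𝓡 n) M))) {y : M}
    (hy : X y = 0) {Q : BilinForm ℝ (EuclideanSpace ℝ (Fin n))} (hQs : ∀ v w, Q v w = Q w v)
    (hQ : ∀ v, v ≠ 0 → 0 < Q v (linearization X y v)) :
    ∃ O : Set M, IsOpen O ∧ y ∈ O ∧ O ⊆ (chartAt (EuclideanSpace ℝ (Fin n)) y).source ∧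
      (∀ p ∈ O, X p = 0 → p = y) ∧ ∃ l > (0 : ℝ), ∃ C : ℝ,
      (∀ p ∈ O, ∀ q ∈ O, Q (extChartAt (𝓡 n) y p - extChartAt (𝓡 n) y q)
        (extChartAt (𝓡 n) y p - extChartAt (𝓡 n) y q) ≤ C) ∧
      ∀ T, 0 ≤ T → ∀ p q, (∀ t ∈ Icc 0 T, φ t p ∈ O ∧ φ t q ∈ O) → ∀ k ∈ ({0, l} : Set ℝ),
        Real.exp (k * T) * Q (extChartAt (𝓡 n) y p - extChartAt (𝓡 n) y q)
          (extChartAt (𝓡 n) y p - extChartAt (𝓡 n) y q) ≤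
        Q (extChartAt (𝓡 n) y (φ T p) - extChartAt (𝓡 n) y (φ T q))
          (extChartAt (𝓡 n) y (φ T p) - extChartAt (𝓡 n) y (φ T q)) := by
  obtain ⟨c, hc, hloc⟩ := exists_local_expansion (hasStrictFDerivAt_chartField hX y) Q hQ
  obtain ⟨C, hC, hCb⟩ := exists_bilin_bound Q
  obtain ⟨r, hr, hrs⟩ := Metric.eventually_nhds_iff_ball.1 hloc
  set ξ := extChartAt (𝓡 n) y with hξ
  set O := ξ.source ∩ ξ ⁻¹' Metric.ball (ξ y) r with hO
  have hOs : O ⊆ (chartAt (EuclideanSpace ℝ (Fin n)) y).source := fun p hp => by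
    simpa [hξ] using hp.1
  have hOe : ∀ p ∈ O, ∀ q ∈ O, c * ‖ξ p - ξ q‖ ^ 2 ≤
      Q (ξ p - ξ q) (chartField X y (ξ p) - chartField X y (ξ q)) := fun p hp q hq =>
    hrs (ξ p, ξ q) (by
      rw [Metric.mem_ball, Prod.dist_eq]; exact max_lt hp.2 hq.2)
  have hQC : ∀ v, Q v v ≤ C * ‖v‖ ^ 2 := fun v => by
    have := (le_abs_self _).trans (hCb v v); linarith [this, sq ‖v‖]
  have hyO : y ∈ O := ⟨mem_extChartAt_source y, Metric.mem_ball_self hr⟩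
  refine ⟨O, isOpen_extChartAt_preimage' y Metric.isOpen_ball, hyO, hOs, fun p hp hp0 => ?_,
    2 * c / C, by positivity, C * (2 * r) ^ 2, fun p hp q hq => ?_, fun T hT p q hpq k hk => ?_⟩
  -- A second rest point in `O` would violate the expansion of differences at time `0`.
  · have h := hOe p hp y hyO
    have z1 : chartField X y (ξ p) = 0 :=
      (chartField_apply (hOs hp)).trans (by rw [hp0]; exact map_zero _)
    have z2 : chartField X y (ξ y) = 0 :=
      (chartField_apply (hOs hyO)).trans (by rw [hy]; exact map_zero _)
    rw [z1, z2, sub_zero, map_zero] at h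
    have h2 : ‖ξ p - ξ y‖ = 0 := by
      have := norm_nonneg (ξ p - ξ y)
      by_contra hne
      have : 0 < c * ‖ξ p - ξ y‖ ^ 2 := by positivity
      linarith
    exact ξ.injOn hp.1 hyO.1 (sub_eq_zero.1 (norm_eq_zero.1 h2))
  · refine (hQC _).trans ?_
    gcongr
    rw [← dist_eq_norm]
    have h1 : dist (ξ p) (ξ y) < r := hp.2
    have h2 : dist (ξ q) (ξ y) < r := hq.2
    linarith [dist_triangle_right (ξ p) (ξ q) (ξ y)]
  · have hd : ∀ t ∈ Icc 0 T, HasDerivAt (fun t => Q (ξ (φ t p) - ξ (φ t q)) (ξ (φ t p) - ξ (φ t q)))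
        (2 * Q (ξ (φ t p) - ξ (φ t q))
          (chartField X y (ξ (φ t p)) - chartField X y (ξ (φ t q)))) t := by
      intro t ht
      have h1 := hasDerivAt_extChartAt_comp (y := y) (hφ.integral p t) (hOs (hpq t ht).1)
      have h2 := hasDerivAt_extChartAt_comp (y := y) (hφ.integral q t) (hOs (hpq t ht).2)
      exact hasDerivAt_bilin_self hQs (h1.sub h2)
    have h := exp_mul_le_of_deriv_ge (k := k) hT hd fun t ht => by
      have h1 := hOe _ (hpq t ht).1 _ (hpq t ht).2
      have h2 := hQC (ξ (φ t p) - ξ (φ t q))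
      rcases hk with rfl | hk
      · have : 0 ≤ c * ‖ξ (φ t p) - ξ (φ t q)‖ ^ 2 := by positivity
        linarith
      · rw [mem_singleton_iff.1 hk]
        calc 2 * c / C * Q (ξ (φ t p) - ξ (φ t q)) (ξ (φ t p) - ξ (φ t q))
            ≤ 2 * c / C * (C * ‖ξ (φ t p) - ξ (φ t q)‖ ^ 2) := by gcongr
          _ = 2 * (c * ‖ξ (φ t p) - ξ (φ t q)‖ ^ 2) := by field_simp
          _ ≤ _ := by linarith
    simpa only [φ.map_zero_apply] using h

/-- The forms of a hyperbolic rest point `y`, together with a neighbourhood of `y` on which they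
control differences of trajectories: if two trajectories stay in it for all positive times, then
`P` of the difference at a later time is at most `N` of the initial difference; in general
`P - N` grows exponentially while they stay in it. -/
theorem exists_hyperbolic_nhd (hφ : IsFlowOf φ X)
    (hX : ContMDiff (𝓡 n) (𝓡 n).tangent ∞ (fun m => (⟨m, X m⟩ : TangentBundle (𝓡 n) M))) {y : M}
    (hy : X y = 0) {P N : BilinForm ℝ (EuclideanSpace ℝ (Fin n))}
    (hPs : ∀ v w, P v w = P w v) (hNs : ∀ v w, N v w = N w v) (hP0 : ∀ v, 0 ≤ P v v)
    (hP : ∀ v, 0 ≤ P v (linearization X y v))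
    (hPN : ∀ v, v ≠ 0 → 0 < P v (linearization X y v) - N v (linearization X y v)) :
    ∃ O : Set M, IsOpen O ∧ y ∈ O ∧ O ⊆ (chartAt (EuclideanSpace ℝ (Fin n)) y).source ∧
      (∀ p ∈ O, X p = 0 → p = y) ∧
      (∃ l > (0 : ℝ), ∀ T, 0 ≤ T → ∀ p q, (∀ t ∈ Icc 0 T, φ t p ∈ O ∧ φ t q ∈ O) →
        Real.exp (l * T) * (P - N) (extChartAt (𝓡 n) y p - extChartAt (𝓡 n) y q)
          (extChartAt (𝓡 n) y p - extChartAt (𝓡 n) y q) ≤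
        (P - N) (extChartAt (𝓡 n) y (φ T p) - extChartAt (𝓡 n) y (φ T q))
          (extChartAt (𝓡 n) y (φ T p) - extChartAt (𝓡 n) y (φ T q))) ∧
      ∀ p q, (∀ t, 0 ≤ t → φ t p ∈ O ∧ φ t q ∈ O) → ∀ T, 0 ≤ T →
        P (extChartAt (𝓡 n) y (φ T p) - extChartAt (𝓡 n) y (φ T q))
          (extChartAt (𝓡 n) y (φ T p) - extChartAt (𝓡 n) y (φ T q)) ≤
        N (extChartAt (𝓡 n) y p - extChartAt (𝓡 n) y q)
          (extChartAt (𝓡 n) y p - extChartAt (𝓡 n) y q) := by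
  obtain ⟨O₁, h1o, h1y, h1s, h1r, l₁, hl₁, C₁, h1C, h1⟩ := exists_expanding_nhd hφ hX hy
    (Q := P - N) (fun v w => by simp [hPs v w, hNs v w]) (fun v hv => by simpa using hPN v hv)
  obtain ⟨O₂, h2o, h2y, h2s, h2r, l₂, hl₂, C₂, h2C, h2⟩ := exists_expanding_nhd hφ hX hy
    (Q := P + (P - N)) (fun v w => by simp [hPs v w, hNs v w])
    (fun v hv => by have := hPN v hv; have := hP v; simp; linarith)
  refine ⟨O₁ ∩ O₂, h1o.inter h2o, ⟨h1y, h2y⟩, fun p hp => h1s hp.1, fun p hp => h1r p hp.1,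
    ⟨l₁, hl₁, fun T hT p q hpq => h1 T hT p q (fun t ht => ⟨(hpq t ht).1.1, (hpq t ht).2.1⟩) l₁
      (by simp)⟩, fun p q hpq T hT => ?_⟩
  set ξ := extChartAt (𝓡 n) y with hξ
  have e1 := h1 T hT p q (fun t ht => ⟨(hpq t ht.1).1.1, (hpq t ht.1).2.1⟩) 0 (by simp)
  -- The form `2 P - N` is bounded along the trajectories, hence cannot be positive.
  have e2 : (P + (P - N)) (ξ (φ T p) - ξ (φ T q)) (ξ (φ T p) - ξ (φ T q)) ≤ 0 := by
    by_contra! hcon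
    have hgrow : ∀ S, 0 ≤ S → Real.exp (l₂ * S) *
        (P + (P - N)) (ξ (φ T p) - ξ (φ T q)) (ξ (φ T p) - ξ (φ T q)) ≤ C₂ := by
      intro S hS
      refine (h2 S hS (φ T p) (φ T q) (fun t ht => ?_) l₂ (by simp)).trans (h2C _ ?_ _ ?_)
      · rw [← φ.map_add, ← φ.map_add]
        have := hpq (t + T) (by linarith [ht.1])
        exact ⟨this.1.2, this.2.2⟩
      · rw [← φ.map_add]; exact (hpq (S + T) (by linarith)).1.2
      · rw [← φ.map_add]; exact (hpq (S + T) (by linarith)).2.2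
    have hlim : Tendsto (fun S => Real.exp (l₂ * S) *
        (P + (P - N)) (ξ (φ T p) - ξ (φ T q)) (ξ (φ T p) - ξ (φ T q))) atTop atTop :=
      (Real.tendsto_exp_atTop.comp (tendsto_id.const_mul_atTop hl₂)).atTop_mul_const hcon
    obtain ⟨S, hS, hS'⟩ := ((hlim.eventually_gt_atTop C₂).and (eventually_ge_atTop 0)).exists
    exact absurd (hgrow S hS') (not_le.2 hS)
  have e3 := hP0 (ξ p - ξ q)
  simp only [zero_mul, Real.exp_zero, one_mul, LinearMap.sub_apply, LinearMap.add_apply] at e1 e2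
  linarith

end LocalInvariantSets

/-! ### Decrease of the index along trajectories -/

section Velocities

open LinearMap (BilinForm)

variable {n : ℕ} {M : Type*} [TopologicalSpace M] [ChartedSpace (EuclideanSpace ℝ (Fin n)) M]
  [IsManifold (𝓡 n) ∞ M] {X : (m : M) → TangentSpace (𝓡 n) m} {φ : Flow ℝ M}

/-- The curve `c` is differentiable at time `0`, with velocity `v` in the chart at `b`. -/
def HasVelocity (b : M) (c : ℝ → M) (v : EuclideanSpace ℝ (Fin n)) : Prop :=
  ContinuousAt c 0 ∧ HasDerivAt (extChartAt (𝓡 n) b ∘ c) v 0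

/-- The derivative of `g` at `u` in the charts at `a` and `b`. -/
def chartDeriv (a b : M) (g : M → M) (u : M) :
    EuclideanSpace ℝ (Fin n) →L[ℝ] EuclideanSpace ℝ (Fin n) :=
  fderiv ℝ (extChartAt (𝓡 n) b ∘ g ∘ (extChartAt (𝓡 n) a).symm) (extChartAt (𝓡 n) a u)

theorem HasVelocity.comp {a b : M} {c : ℝ → M} {v : EuclideanSpace ℝ (Fin n)}
    (hc : HasVelocity a c v) {g : M → M} (hg : MDifferentiableAt (𝓡 n) (𝓡 n) g (c 0))
    (ha : c 0 ∈ (chartAt (EuclideanSpace ℝ (Fin n)) a).source)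
    (hb : g (c 0) ∈ (chartAt (EuclideanSpace ℝ (Fin n)) b).source) :
    HasVelocity b (g ∘ c) (chartDeriv a b g (c 0) v) := by
  have : IsManifold (𝓡 n) 1 M := IsManifold.of_le (n := ∞) (by simp)
  have h1 := ((mdifferentiableAt_iff_of_mem_source ha hb).1 hg).2
  rw [ModelWithCorners.range_eq_univ, differentiableWithinAt_univ] at h1
  refine ⟨hg.continuousAt.comp hc.1, ?_⟩
  have h2 := h1.hasFDerivAt.comp_hasDerivAt (0 : ℝ) hc.2
  refine h2.congr_of_eventuallyEq ?_
  filter_upwards [hc.1.preimage_mem_nhds (extChartAt_source_mem_nhds' (I := 𝓡 n)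
    (by simpa using ha))] with s hs
  simp only [Function.comp_apply]
  rw [(extChartAt (𝓡 n) a).left_inv hs]

theorem hasVelocity_line {b u : M} (hu : u ∈ (chartAt (EuclideanSpace ℝ (Fin n)) b).source)
    (v : EuclideanSpace ℝ (Fin n)) :
    ∃ c : ℝ → M, c 0 = u ∧ HasVelocity b c v := by
  have hu' : u ∈ (extChartAt (𝓡 n) b).source := by simpa using hu
  have hline : HasDerivAt (fun s : ℝ => extChartAt (𝓡 n) b u + s • v) v 0 := by
    simpa using ((hasDerivAt_id (0 : ℝ)).smul_const v).const_add (extChartAt (𝓡 n) b u)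
  refine ⟨fun s => (extChartAt (𝓡 n) b).symm (extChartAt (𝓡 n) b u + s • v), ?_, ?_, ?_⟩
  · simp only [zero_smul, add_zero]
    exact (extChartAt (𝓡 n) b).left_inv hu'
  · refine ContinuousAt.comp (g := (extChartAt (𝓡 n) b).symm) ?_ hline.continuousAt
    simp only [zero_smul, add_zero]
    exact continuousAt_extChartAt_symm' hu'
  · refine hline.congr_of_eventuallyEq ?_
    have hmem : ∀ᶠ s in 𝓝 (0 : ℝ),
        extChartAt (𝓡 n) b u + s • v ∈ (extChartAt (𝓡 n) b).target := by
      refine hline.continuousAt.preimage_mem_nhds ?_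
      simp only [zero_smul, add_zero]
      exact (isOpen_extChartAt_target b).mem_nhds ((extChartAt (𝓡 n) b).map_source hu')
    filter_upwards [hmem] with s hs
    exact (extChartAt (𝓡 n) b).right_inv hs

theorem chartDeriv_injective {a b u : M} {g h : M → M}
    (hg : MDifferentiableAt (𝓡 n) (𝓡 n) g u) (hh : MDifferentiableAt (𝓡 n) (𝓡 n) h (g u))
    (hgh : ∀ p, h (g p) = p) (ha : u ∈ (chartAt (EuclideanSpace ℝ (Fin n)) a).source)
    (hb : g u ∈ (chartAt (EuclideanSpace ℝ (Fin n)) b).source) :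
    Function.Injective (chartDeriv (n := n) a b g u) := by
  refine Function.LeftInverse.injective (g := chartDeriv b a h (g u)) fun v => ?_
  obtain ⟨c, rfl, hc⟩ := hasVelocity_line ha v
  have h1 := hc.comp hg ha hb
  have h2 := h1.comp (b := a) (g := h) hh hb (by simpa [hgh] using ha)
  have h3 : h ∘ g ∘ c = c := funext fun s => hgh _
  rw [h3] at h2
  exact h2.2.unique hc.2

/-- The velocities at `u` of curves whose trajectories converge to `y`, uniformly near time `0` of
the curve. -/
def velocitySet (φ : Flow ℝ M) (y u : M) : Set (EuclideanSpace ℝ (Fin n)) :=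
  {v | ∃ c : ℝ → M, c 0 = u ∧ HasVelocity u c v ∧
    Tendsto (fun q : ℝ × ℝ => φ q.1 (c q.2)) (atTop ×ˢ 𝓝 0) (𝓝 y)}

theorem hasVelocity_of_hasMFDerivAt {c : ℝ → M} {L : ℝ →L[ℝ] EuclideanSpace ℝ (Fin n)}
    (hc : HasMFDerivAt 𝓘(ℝ, ℝ) (𝓡 n) c 0 L) : HasVelocity (c 0) c (L 1) := by
  refine ⟨hc.1, ?_⟩
  have h : HasFDerivWithinAt (extChartAt (𝓡 n) (c 0) ∘ c) L (range 𝓘(ℝ, ℝ)) 0 := hc.2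
  rw [ModelWithCorners.range_eq_univ, hasFDerivWithinAt_univ] at h
  exact h.hasDerivAt

theorem tangentVectors_atTop_subset (hφ : IsFlowOf φ X) (y u : M) :
    tangentVectors X atTop y u ⊆ velocitySet φ y u := by
  rintro v ⟨c, Γ, hc, rfl, -, hΓ, hlim, rfl⟩
  refine ⟨c, rfl, hasVelocity_of_hasMFDerivAt (hc.mdifferentiableAt (by simp)).hasMFDerivAt, ?_⟩
  refine hlim.congr fun q => ?_
  rw [hφ.unique _ (hΓ q.2).1, (hΓ q.2).2]

theorem tangentVectors_atBot_subset (hφ : IsFlowOf φ X) (x u : M) :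
    tangentVectors X atBot x u ⊆ velocitySet φ.reverse x u := by
  rintro v ⟨c, Γ, hc, rfl, -, hΓ, hlim, rfl⟩
  refine ⟨c, rfl, hasVelocity_of_hasMFDerivAt (hc.mdifferentiableAt (by simp)).hasMFDerivAt, ?_⟩
  refine (hlim.comp (tendsto_neg_atTop_atBot.prodMap tendsto_id)).congr fun q => ?_
  simp only [Function.comp_apply, Prod.map_fst, Prod.map_snd, id]
  rw [hφ.unique _ (hΓ q.2).1, (hΓ q.2).2]
  rfl

theorem IsFlowOf.hasVelocity (hφ : IsFlowOf φ X) (u : M) :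
    HasVelocity u (fun s => φ s u) (show EuclideanSpace ℝ (Fin n) from X u) := by
  have h := hasVelocity_of_hasMFDerivAt (hφ.integral u 0)
  have h0 : φ 0 u = u := φ.map_zero_apply u
  rw [h0] at h
  have e : ((1 : ℝ →L[ℝ] ℝ).smulRight (show EuclideanSpace ℝ (Fin n) from X (φ 0 u))) 1 =
      (show EuclideanSpace ℝ (Fin n) from X u) := by
    rw [ContinuousLinearMap.smulRight_apply, one_apply_eq_self, one_smul]
    exact congrArg (fun p => (show EuclideanSpace ℝ (Fin n) from X p)) h0
  rw [← e]
  exact h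

theorem apply_mem_velocitySet (hφ : IsFlowOf φ X) {y u : M}
    (hu : Tendsto (fun t => φ t u) atTop (𝓝 y)) :
    (show EuclideanSpace ℝ (Fin n) from X u) ∈ velocitySet φ y u := by
  refine ⟨fun s => φ s u, φ.map_zero_apply u, hφ.hasVelocity u, ?_⟩
  have h1 : Tendsto (fun q : ℝ × ℝ => q.1 + q.2) (atTop ×ˢ 𝓝 0) atTop :=
    tendsto_fst.atTop_add tendsto_snd
  refine (hu.comp h1).congr fun q => ?_
  exact φ.map_add _ _ _

/-- On the velocities of curves that converge uniformly to the hyperbolic rest point `y`,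
transported into a neighbourhood of `y` by the flow, the form that expands under the linearization
is dominated by the one that contracts. -/
theorem exists_submodule_le [T2Space M] [CompactSpace M] (hφ : IsFlowOf φ X)
    (hX : ContMDiff (𝓡 n) (𝓡 n).tangent ∞ (fun m => (⟨m, X m⟩ : TangentBundle (𝓡 n) M))) {y : M}
    (hy : X y = 0) {P N : BilinForm ℝ (EuclideanSpace ℝ (Fin n))}
    (hPs : ∀ v w, P v w = P w v) (hNs : ∀ v w, N v w = N w v) (hP0 : ∀ v, 0 ≤ P v v)
    (hN0 : ∀ v, 0 ≤ N v v)
    (hP : ∀ v, 0 ≤ P v (linearization X y v))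
    (hPN : ∀ v, v ≠ 0 → 0 < P v (linearization X y v) - N v (linearization X y v)) (u : M) :
    ∃ S : Submodule ℝ (EuclideanSpace ℝ (Fin n)),
      Module.finrank ℝ S = Module.finrank ℝ (Submodule.span ℝ (velocitySet (n := n) φ y u)) ∧
      ∀ w ∈ S, P w w ≤ N w w := by
  obtain ⟨O, hO, hyO, hOs, -, ⟨l, hl, hexp⟩, hst⟩ :=
    exists_hyperbolic_nhd hφ hX hy hPs hNs hP0 hP hPN
  obtain ⟨t, ht, hspan, hli⟩ := exists_linearIndependent ℝ (velocitySet (n := n) φ y u)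
  have htf : t.Finite := hli.setFinite
  have hev : ∀ v ∈ t, ∃ c : ℝ → M, c 0 = u ∧ HasVelocity u c v ∧
      ∃ T : ℝ, ∀ T' ≥ T, ∀ᶠ s in 𝓝 (0 : ℝ), ∀ τ ≥ 0, φ (T' + τ) (c s) ∈ O := by
    intro v hv
    obtain ⟨c, h1, h2, h3⟩ := ht hv
    have h4 := h3.eventually (hO.mem_nhds hyO)
    obtain ⟨pa, ha, pb, hb, hab⟩ := eventually_prod_iff.1 h4
    obtain ⟨T, hT⟩ := eventually_atTop.1 ha
    refine ⟨c, h1, h2, T, fun T' hT' => ?_⟩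
    filter_upwards [hb] with s hs τ hτ
    exact hab (hT _ (by linarith)) hs
  have : Nonempty M := ⟨u⟩
  choose! c hc0 hcv T hT using hev
  -- A common time after which the trajectories of the curves that represent a basis stay in `O`.
  obtain ⟨T₀, hT₀⟩ := (htf.image T).bddAbove
  have hT₀' : ∀ v ∈ t, ∀ᶠ s in 𝓝 (0 : ℝ), ∀ τ ≥ 0, φ (T₀ + τ) (c v s) ∈ O := fun v hv =>
    hT v hv T₀ (hT₀ (mem_image_of_mem T hv))
  by_cases hne : t.Nonempty
  swap
  · rw [not_nonempty_iff_eq_empty] at hne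
    refine ⟨⊥, ?_, fun w hw => ?_⟩
    · rw [← hspan, hne, Submodule.span_empty]
    · rw [(Submodule.mem_bot ℝ).1 hw]; simp
  obtain ⟨v₀, hv₀⟩ := hne
  have huO : ∀ τ ≥ 0, φ (T₀ + τ) u ∈ O := fun τ hτ => by
    have := (hT₀' v₀ hv₀).self_of_nhds τ hτ
    rwa [hc0 v₀ hv₀] at this
  have hu'O : φ T₀ u ∈ O := by simpa using huO 0 le_rfl
  have hOτ : ∀ τ ≥ 0, φ τ (φ T₀ u) ∈ O := fun τ hτ => by
    rw [← φ.map_add, add_comm]; exact huO τ hτ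
  set ξ := extChartAt (𝓡 n) y with hξ
  set L := chartDeriv (n := n) u y (φ T₀) u with hL
  set D : ℝ → _ := fun τ => chartDeriv (n := n) y y (φ τ) (φ T₀ u) with hD
  have hLinj : Function.Injective L := chartDeriv_injective (h := φ (-T₀))
    (hφ.mdifferentiableAt _ _) (hφ.mdifferentiableAt _ _)
    (fun p => by rw [← φ.map_add, neg_add_cancel, φ.map_zero_apply])
    (mem_chart_source _ u) (hOs hu'O)
  -- On basis vectors transported by the flow, `P` is bounded for all later times.
  have hgen : ∀ v ∈ t, ∀ τ ≥ 0, P (D τ (L v)) (D τ (L v)) ≤ N (L v) (L v) := by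
    intro v hv τ hτ
    have h1 := (hcv v hv).comp (b := y) (g := φ T₀) (hφ.mdifferentiableAt _ _)
      (by rw [hc0 v hv]; exact mem_chart_source _ u) (by rw [hc0 v hv]; exact hOs hu'O)
    have h2 := h1.comp (b := y) (g := φ τ) (hφ.mdifferentiableAt _ _)
      (by simp only [Function.comp_apply, hc0 v hv]; exact hOs hu'O)
      (by simp only [Function.comp_apply, hc0 v hv]; exact hOs (hOτ τ hτ))
    simp only [Function.comp_apply, hc0 v hv] at h1 h2
    refine bilin_le_of_hasDerivAt h2.2 h1.2 ?_
    filter_upwards [hT₀' v hv] with s hs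
    have h3 := hst (φ T₀ (c v s)) (φ T₀ u) (fun τ' hτ' => ⟨by
      rw [← φ.map_add, add_comm]; exact hs τ' hτ', hOτ τ' hτ'⟩) τ hτ
    simpa only [Function.comp_apply, hc0 v hv] using h3
  -- The derivative of the flow increases `P - N` exponentially, on every vector.
  have hgrow : ∀ w, ∀ τ ≥ 0, Real.exp (l * τ) * (P - N) w w ≤ (P - N) (D τ w) (D τ w) := by
    intro w τ hτ
    obtain ⟨e, he0, hev⟩ := hasVelocity_line (hOs hu'O) w
    have h2 := hev.comp (b := y) (g := φ τ) (hφ.mdifferentiableAt _ _)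
      (by rw [he0]; exact hOs hu'O) (by rw [he0]; exact hOs (hOτ τ hτ))
    rw [he0] at h2
    have h3 := bilin_le_of_hasDerivAt (Q₁ := Real.exp (l * τ) • (P - N)) (Q₂ := P - N)
      hev.2 h2.2 ?_
    · simpa using h3
    have htube : ∀ᶠ p in 𝓝 (φ T₀ u), ∀ s ∈ Icc 0 τ, φ s p ∈ O := by
      have := (isCompact_Icc (a := (0 : ℝ)) (b := τ)).eventually_forall_of_forall_eventually
        (x₀ := φ T₀ u) (P := fun p s => φ s p ∈ O) (fun s hs => ?_)
      · exact this
      · have hcont : Continuous fun z : M × ℝ => φ z.2 z.1 :=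
          φ.continuous continuous_snd continuous_fst
        exact hcont.continuousAt.preimage_mem_nhds (hO.mem_nhds (hOτ s hs.1))
    have hce := hev.1
    rw [ContinuousAt, he0] at hce
    filter_upwards [hce.eventually htube] with s hs
    have h4 := hexp τ hτ (e s) (φ T₀ u) (fun t' ht' => ⟨hs t' ht', hOτ t' ht'.1⟩)
    simpa only [Function.comp_apply, he0, LinearMap.smul_apply, smul_eq_mul] using h4
  refine ⟨(Submodule.span ℝ t).map L.toLinearMap, ?_, fun w hw => ?_⟩
  · rw [← hspan]
    exact (Submodule.equivMapOfInjective L.toLinearMap hLinj _).symm.finrank_eq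
  · rw [Submodule.map_span] at hw
    have hbd : ∃ C, ∀ τ ≥ 0, P (D τ w) (D τ w) ≤ C := by
      induction hw using Submodule.span_induction with
      | mem w hw =>
        obtain ⟨v, hv, rfl⟩ := hw
        exact ⟨_, hgen v hv⟩
      | zero => exact ⟨0, fun τ _ => by simp⟩
      | add a b _ _ ha hb =>
        obtain ⟨A, hA⟩ := ha
        obtain ⟨B, hB⟩ := hb
        refine ⟨2 * A + 2 * B, fun τ hτ => ?_⟩
        have h1 := hA τ hτ
        have h2 := hB τ hτ
        have h3 := hP0 (D τ a - D τ b)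
        simp only [map_add, map_sub, LinearMap.add_apply, LinearMap.sub_apply] at h3 ⊢
        linarith
      | smul r a _ ha =>
        obtain ⟨A, hA⟩ := ha
        refine ⟨r * r * A, fun τ hτ => ?_⟩
        simp only [map_smul, LinearMap.smul_apply, smul_eq_mul]
        rw [← mul_assoc]
        exact mul_le_mul_of_nonneg_left (hA τ hτ) (mul_self_nonneg r)
    obtain ⟨C, hC⟩ := hbd
    -- If `P - N` were positive at `w`, then `P` would be unbounded along the flow.
    by_contra! hcon
    have hpos : 0 < (P - N) w w := by simpa using hcon
    have hlim : Tendsto (fun τ => Real.exp (l * τ) * (P - N) w w) atTop atTop :=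
      (Real.tendsto_exp_atTop.comp (tendsto_id.const_mul_atTop hl)).atTop_mul_const hpos
    obtain ⟨τ, hτ, hτ'⟩ := ((hlim.eventually_gt_atTop C).and (eventually_ge_atTop 0)).exists
    have h1 := hgrow w τ hτ'
    have h2 := hC τ hτ'
    have h3 := hN0 (D τ w)
    have h4 : (P - N) (D τ w) (D τ w) = P (D τ w) (D τ w) - N (D τ w) (D τ w) := by simp
    linarith

theorem linearization_neg
    (hX : ContMDiff (𝓡 n) (𝓡 n).tangent ∞ (fun m => (⟨m, X m⟩ : TangentBundle (𝓡 n) M))) {y : M}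
    (v : EuclideanSpace ℝ (Fin n)) :
    linearization (-X) y v = -linearization X y v := by
  have h1 := (hasStrictFDerivAt_chartField hX y).hasFDerivAt
  have h2 := (hasStrictFDerivAt_chartField (smooth_neg hX) y).hasFDerivAt
  have h3 : chartField (-X) y =ᶠ[𝓝 (extChartAt (𝓡 n) y y)] -chartField X y := by
    filter_upwards [extChartAt_target_mem_nhds (I := 𝓡 n) y] with z hz
    have hp : (extChartAt (𝓡 n) y).symm z ∈ (chartAt (EuclideanSpace ℝ (Fin n)) y).source := by
      simpa using (extChartAt (𝓡 n) y).map_target hz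
    have e1 := chartField_apply (X := X) hp
    have e2 := chartField_apply (X := -X) hp
    rw [(extChartAt (𝓡 n) y).right_inv hz] at e1 e2
    rw [Pi.neg_apply, e2, e1]
    exact map_neg _ _
  have h4 := h2.unique (h1.neg.congr_of_eventuallyEq h3)
  rw [h4]; rfl

/-- Transversality of unstable and stable manifolds implies that the Morse index decreases along
nonconstant trajectories between rest points. -/
theorem index_lt [IsManifold (𝓡 n) 1 M] [T2Space M] [CompactSpace M] (hφ : IsFlowOf φ X)
    (hX : ContMDiff (𝓡 n) (𝓡 n).tangent ∞ (fun m => (⟨m, X m⟩ : TangentBundle (𝓡 n) M)))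
    (hP1 : AllHyperbolic X) (hP2 : AllTransversal X) {x y u : M} (hx : X x = 0) (hy : X y = 0)
    (hux : Tendsto (fun t => φ t u) atBot (𝓝 x)) (huy : Tendsto (fun t => φ t u) atTop (𝓝 y))
    (hu : X u ≠ 0) : index X y < index X x := by
  obtain ⟨S₁, hS₁, hS₁'⟩ : ∃ S : Submodule ℝ (EuclideanSpace ℝ (Fin n)),
      Module.finrank ℝ S = Module.finrank ℝ (Submodule.span ℝ (velocitySet (n := n) φ y u)) ∧
      Module.finrank ℝ S + index X y ≤ n := by
    obtain ⟨P, N, hPs, hNs, hP0, hN0, hP, -, hPN, hd, -⟩ :=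
      exists_hyperbolic_forms (linearization X y).toLinearMap (hP1 y hy)
    obtain ⟨S, hS, hS'⟩ := exists_submodule_le hφ hX hy hPs hNs hP0 hN0 hP hPN u
    have := hd S hS'
    rw [finrank_euclideanSpace_fin] at this
    refine ⟨S, hS, ?_⟩
    unfold index eigenvalues
    convert this using 3
  -- For the unstable set, the flow is reversed and the two forms exchange their roles.
  obtain ⟨S₂, hS₂, hS₂'⟩ : ∃ S : Submodule ℝ (EuclideanSpace ℝ (Fin n)),
      Module.finrank ℝ S =
        Module.finrank ℝ (Submodule.span ℝ (velocitySet (n := n) φ.reverse x u)) ∧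
      Module.finrank ℝ S ≤ index X x := by
    obtain ⟨P, N, hPs, hNs, hP0, hN0, -, hN, hPN, -, hd⟩ :=
      exists_hyperbolic_forms (linearization X x).toLinearMap (hP1 x hx)
    have hneg := linearization_neg hX (y := x)
    obtain ⟨S, hS, hS'⟩ := exists_submodule_le hφ.reverse (smooth_neg hX) (y := x)
      (by simp [hx]) hNs hPs hN0 hP0 (fun v => by
        have := hN v
        rw [hneg, map_neg]
        simpa using this) (fun v hv => by
        have := hPN v hv
        rw [hneg, map_neg, map_neg]
        simp only [ContinuousLinearMap.coe_coe] at this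
        linarith) u
    have := hd S hS'
    refine ⟨S, hS, ?_⟩
    unfold index eigenvalues
    convert this using 3
  have hA : Submodule.span ℝ (tangentVectors X atBot x u) ≤
      Submodule.span ℝ (velocitySet (n := n) φ.reverse x u) :=
    Submodule.span_mono (tangentVectors_atBot_subset hφ x u)
  have hB : Submodule.span ℝ (tangentVectors X atTop y u) ≤
      Submodule.span ℝ (velocitySet (n := n) φ y u) :=
    Submodule.span_mono (tangentVectors_atTop_subset hφ y u)
  have hmem : u ∈ unstableSet X x ∩ stableSet X y :=
    ⟨⟨fun t => φ t u, hφ.integral u, φ.map_zero_apply u, hux⟩,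
      ⟨fun t => φ t u, hφ.integral u, φ.map_zero_apply u, huy⟩⟩
  -- Both spans together are the whole tangent space, and they have `X u ≠ 0` in common.
  have htop : Submodule.span ℝ (velocitySet (n := n) φ.reverse x u) ⊔
      Submodule.span ℝ (velocitySet (n := n) φ y u) = ⊤ :=
    top_unique ((hP2 x y hx hy u hmem).symm.le.trans (sup_le_sup hA hB))
  have hXB : (show EuclideanSpace ℝ (Fin n) from X u) ∈
      Submodule.span ℝ (velocitySet (n := n) φ y u) :=
    Submodule.subset_span (apply_mem_velocitySet hφ huy)
  have hXA : (show EuclideanSpace ℝ (Fin n) from X u) ∈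
      Submodule.span ℝ (velocitySet (n := n) φ.reverse x u) := by
    rw [← Submodule.neg_mem_iff]
    refine Submodule.subset_span (apply_mem_velocitySet hφ.reverse (X := -X) (y := x) ?_)
    exact hux.comp tendsto_neg_atTop_atBot
  have hinf : 0 < Module.finrank ℝ (Submodule.span ℝ (velocitySet (n := n) φ.reverse x u) ⊓
      Submodule.span ℝ (velocitySet (n := n) φ y u) : Submodule ℝ (EuclideanSpace ℝ (Fin n))) := by
    rw [Module.finrank_pos_iff_exists_ne_zero]
    exact ⟨⟨_, hXA, hXB⟩, fun h => hu (congrArg Subtype.val h)⟩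
  have hsum := Submodule.finrank_sup_add_finrank_inf_eq
    (Submodule.span ℝ (velocitySet (n := n) φ.reverse x u))
    (Submodule.span ℝ (velocitySet (n := n) φ y u))
  rw [htop, finrank_top, finrank_euclideanSpace_fin] at hsum
  omega

theorem IsFlowOf.rest_iff (hφ : IsFlowOf φ X) {p : M} : X p = 0 ↔ ∀ t, φ t p = p := by
  refine ⟨fun hp => hφ.apply_rest hp, fun h => ?_⟩
  refine (hφ.hasVelocity p).2.unique (f₁' := 0) ?_
  have h1 : (fun t => φ t p) = fun _ => p := funext h
  rw [h1]
  exact hasDerivAt_const (0 : ℝ) (extChartAt (𝓡 n) p p)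

/-- Hyperbolic rest points of a closed manifold are isolated, hence finite in number. -/
theorem finite_rest [IsManifold (𝓡 n) 1 M] [T2Space M] [CompactSpace M] (hφ : IsFlowOf φ X)
    (hX : ContMDiff (𝓡 n) (𝓡 n).tangent ∞ (fun m => (⟨m, X m⟩ : TangentBundle (𝓡 n) M)))
    (hP1 : AllHyperbolic X) : {p : M | X p = 0}.Finite := by
  by_contra hinf
  -- An infinite set of rest points would accumulate at a rest point, but rest points are isolated.
  obtain ⟨y, hy⟩ := Set.Infinite.exists_accPt_principal hinf
  have hcl : IsClosed {p : M | X p = 0} := by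
    have : {p : M | X p = 0} = ⋂ t : ℝ, {p | φ t p = p} := by
      ext p; simp [hφ.rest_iff]
    rw [this]
    exact isClosed_iInter fun t => isClosed_eq (φ.continuous continuous_const continuous_id)
      continuous_id
  have hy0 : X y = 0 := hcl.closure_subset (mem_closure_iff_clusterPt.2 hy.clusterPt)
  obtain ⟨P, N, hPs, hNs, hP0, hN0, hP, -, hPN, -, -⟩ :=
    exists_hyperbolic_forms (linearization X y).toLinearMap (hP1 y hy0)
  obtain ⟨O, hO, hyO, -, hiso, -⟩ := exists_hyperbolic_nhd hφ hX hy0 hPs hNs hP0 hP hPN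
  rw [accPt_iff_nhds] at hy
  obtain ⟨p, ⟨hpO, hp0⟩, hne⟩ := hy O (hO.mem_nhds hyO)
  exact hne (hiso p hpO hp0)

end Velocities

/-! ### Existence of transversal discs -/

section Discs

variable {n : ℕ} {M : Type*} [TopologicalSpace M] [ChartedSpace (EuclideanSpace ℝ (Fin n)) M]
  [IsManifold (𝓡 n) ∞ M] {X : (m : M) → TangentSpace (𝓡 n) m} {φ : Flow ℝ M}

theorem univBall_apply {E : Type*} [NormedAddCommGroup E] [InnerProductSpace ℝ E] (z : E) {r : ℝ}
    (hr : 0 < r) (x : E) :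
    OpenPartialHomeomorph.univBall z r x = r • ((√(1 + ‖x‖ ^ 2))⁻¹ • x) + z := by
  rw [OpenPartialHomeomorph.univBall, dif_pos hr]
  rfl

theorem fderiv_univBall_injective {E : Type*} [NormedAddCommGroup E] [InnerProductSpace ℝ E]
    (z : E) {r : ℝ} (hr : 0 < r) (x : E) :
    Function.Injective (fderiv ℝ (OpenPartialHomeomorph.univBall z r) x) := by
  set b := OpenPartialHomeomorph.univBall z r with hb
  have hmem : b x ∈ Metric.ball z r := by
    rw [← OpenPartialHomeomorph.univBall_target z hr]
    exact b.map_source (by simp [hb])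
  have h1 : HasFDerivAt b (fderiv ℝ b x) x :=
    (OpenPartialHomeomorph.contDiff_univBall.differentiable (n := 1) (by simp)
      x).hasFDerivAt
  have h2 : DifferentiableAt ℝ b.symm (b x) :=
    (OpenPartialHomeomorph.contDiffOn_univBall_symm.contDiffAt (n := 1)
      (Metric.isOpen_ball.mem_nhds hmem)).differentiableAt (by simp)
  have h3 := h2.hasFDerivAt.comp x h1
  have h4 : b.symm ∘ b = id := funext fun y => b.left_inv (by simp [hb])
  rw [h4] at h3
  have h5 := h3.unique (hasFDerivAt_id x)
  exact Function.LeftInverse.injective (g := fderiv ℝ b.symm (b x)) fun w =>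
    congrArg (fun L : E →L[ℝ] E => L w) h5

theorem range_sup_span_singleton_eq_top {d n : ℕ} (hd : d + 1 = n)
    {J : EuclideanSpace ℝ (Fin d) →ₗ[ℝ] EuclideanSpace ℝ (Fin n)} (hJ : Function.Injective J)
    {x : EuclideanSpace ℝ (Fin n)} (hx : x ∉ LinearMap.range J) :
    LinearMap.range J ⊔ Submodule.span ℝ {x} = ⊤ := by
  refine Submodule.eq_top_of_finrank_eq (le_antisymm (Submodule.finrank_le _) ?_)
  have hlt : LinearMap.range J < LinearMap.range J ⊔ Submodule.span ℝ {x} := by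
    refine lt_of_le_of_ne le_sup_left fun h => hx ?_
    rw [h]
    exact Submodule.mem_sup_right (Submodule.mem_span_singleton_self x)
  have h1 := Submodule.finrank_lt_finrank_of_lt hlt
  have h2 := LinearMap.finrank_range_of_inj hJ
  rw [finrank_euclideanSpace_fin] at h2 ⊢
  omega

theorem range_ne_top {d n : ℕ} (hd : d + 1 = n)
    (J : EuclideanSpace ℝ (Fin d) →ₗ[ℝ] EuclideanSpace ℝ (Fin n)) : LinearMap.range J ≠ ⊤ := by
  intro h
  have h1 := LinearMap.finrank_range_le J
  rw [h, finrank_top, finrank_euclideanSpace_fin, finrank_euclideanSpace_fin] at h1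
  omega

/-- Through each point that is not a rest point there are arbitrarily small transversal discs:
in a chart, small balls in the hyperplane orthogonal to the vector field at the point. -/
theorem exists_isTransversalDisc
    (hX : ContMDiff (𝓡 n) (𝓡 n).tangent ∞ (fun m => (⟨m, X m⟩ : TangentBundle (𝓡 n) M))) {p : M}
    (hp : X p ≠ 0) {W : Set M} (hW : W ∈ 𝓝 p) : ∃ U ⊆ W, p ∈ U ∧ IsTransversalDisc X U := by
  set ξ := extChartAt (𝓡 n) p with hξ
  set z := ξ p with hz
  set v := chartField X p z with hv
  have hpz : ξ.symm z = p := extChartAt_to_inv p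
  have hv0 : v ≠ 0 := by
    intro h0
    apply hp
    rw [hv, chartField_apply (mem_chart_source _ p)] at h0
    have hinj : Function.Injective (mfderiv (𝓡 n) 𝓘(ℝ, EuclideanSpace ℝ (Fin n)) ξ p) :=
      (isInvertible_mfderiv_extChartAt (mem_extChartAt_source p)).injective
    exact hinj (h0.trans (map_zero _).symm)
  have : Nontrivial (EuclideanSpace ℝ (Fin n)) := ⟨v, 0, hv0⟩
  have hn : 0 < n := by
    have := Module.finrank_pos (R := ℝ) (M := EuclideanSpace ℝ (Fin n))
    rwa [finrank_euclideanSpace_fin] at this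
  obtain ⟨d, rfl⟩ : ∃ d, n = d + 1 := ⟨n - 1, by omega⟩
  have hfin : Fact (Module.finrank ℝ (EuclideanSpace ℝ (Fin (d + 1))) = d + 1) :=
    ⟨finrank_euclideanSpace_fin⟩
  have hd : Module.finrank ℝ (ℝ ∙ v)ᗮ = d := Submodule.finrank_orthogonal_span_singleton hv0
  -- An isometry onto the hyperplane orthogonal to `v`.
  set A : EuclideanSpace ℝ (Fin d) →ₗᵢ[ℝ] EuclideanSpace ℝ (Fin (d + 1)) :=
    (ℝ ∙ v)ᗮ.subtypeₗᵢ.comp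
      (((stdOrthonormalBasis ℝ (ℝ ∙ v)ᗮ).reindex (finCongr hd)).repr.symm.toLinearIsometry) with hA
  have hAv : ∀ q, inner ℝ v (A q) = 0 := fun q =>
    Submodule.mem_orthogonal_singleton_iff_inner_right.1
      (((stdOrthonormalBasis ℝ (ℝ ∙ v)ᗮ).reindex (finCongr hd)).repr.symm q).2
  -- A ball in the chart on which the vector field is transversal to the hyperplane.
  have hcont : ContinuousAt (chartField X p) z :=
    (contDiffOn_chartField hX p).continuousOn.continuousAt (extChartAt_target_mem_nhds p)
  have hev : ∀ᶠ y in 𝓝 z, y ∈ ξ.target ∧ ξ.symm y ∈ W ∧ 0 < inner ℝ v (chartField X p y) := by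
    refine Eventually.and (extChartAt_target_mem_nhds p) (Eventually.and ?_ ?_)
    · exact (continuousAt_extChartAt_symm p).preimage_mem_nhds (by rw [extChartAt_to_inv]; exact hW)
    · refine (ContinuousAt.inner (𝕜 := ℝ) continuousAt_const hcont).eventually (lt_mem_nhds ?_)
      exact real_inner_self_pos.2 hv0
  obtain ⟨r, hr, hball⟩ := Metric.eventually_nhds_iff_ball.1 hev
  -- The diffeomorphism of the whole space onto a ball is radial, so it maps the hyperplane into
  -- itself up to translation.
  set b := OpenPartialHomeomorph.univBall z r with hb
  have hbmem : ∀ x, b x ∈ Metric.ball z r := fun x => by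
    rw [← OpenPartialHomeomorph.univBall_target z hr]
    exact b.map_source (by simp [hb])
  set e : EuclideanSpace ℝ (Fin d) → M := fun q => ξ.symm (b (A q)) with he
  have hesrc : ∀ q, e q ∈ (chartAt (EuclideanSpace ℝ (Fin (d + 1))) p).source := fun q => by
    have h := ξ.map_target (hball _ (hbmem (A q))).1
    rwa [hξ, extChartAt_source] at h
  have hξe : ∀ q, ξ (e q) = b (A q) := fun q => ξ.right_inv (hball _ (hbmem (A q))).1
  have hbs : ContDiff ℝ ∞ b := OpenPartialHomeomorph.contDiff_univBall
  have hes : ContMDiff (𝓡 d) (𝓡 (d + 1)) ∞ e :=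
    (contMDiffOn_extChartAt_symm p).comp_contMDiff
      (hbs.comp A.contDiff).contMDiff fun q => (hball _ (hbmem (A q))).1
  have hemb : IsEmbedding e := by
    have h1 : (b.trans (chartAt (EuclideanSpace ℝ (Fin (d + 1))) p).symm).source = univ := by
      ext x
      simp only [OpenPartialHomeomorph.trans_source, mem_inter_iff, mem_preimage, mem_univ,
        iff_true]
      exact ⟨by simp [hb], by simpa [hξ] using (hball _ (hbmem x)).1⟩
    exact ((b.trans (chartAt (EuclideanSpace ℝ (Fin (d + 1))) p).symm).isOpenEmbedding
      h1).isEmbedding.comp A.isometry.isEmbedding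
  set F : EuclideanSpace ℝ (Fin d) → (EuclideanSpace ℝ (Fin d) →L[ℝ] EuclideanSpace ℝ (Fin (d + 1)))
    := fun q => (fderiv ℝ b (A q)).comp A.toContinuousLinearMap with hF
  have hFd : ∀ q, HasFDerivAt (b ∘ A) (F q) q := fun q =>
    (hbs.differentiable (by simp) (A q)).hasFDerivAt.comp q A.toContinuousLinearMap.hasFDerivAt
  have hFinj : ∀ q, Function.Injective (F q) := fun q =>
    (fderiv_univBall_injective z hr (A q)).comp A.injective
  have hFv : ∀ q w, inner ℝ v (F q w) = 0 := by
    intro q w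
    have h1 : HasFDerivAt (fun q => inner ℝ v ((b ∘ A) q)) ((innerSL ℝ v).comp (F q)) q :=
      (innerSL ℝ v).hasFDerivAt.comp q (hFd q)
    have h2 : (fun q => inner ℝ v ((b ∘ A) q)) = fun _ => inner ℝ v z := by
      funext q
      rw [Function.comp_apply, hb, univBall_apply z hr, inner_add_right, inner_smul_right,
        inner_smul_right, hAv]
      simp
    rw [h2] at h1
    have h3 := h1.unique (hasFDerivAt_const _ _)
    exact congrArg (fun L : EuclideanSpace ℝ (Fin d) →L[ℝ] ℝ => L w) h3
  have hmf : ∀ q w, (mfderiv (𝓡 (d + 1)) 𝓘(ℝ, EuclideanSpace ℝ (Fin (d + 1))) ξ (e q))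
      (mfderiv (𝓡 d) (𝓡 (d + 1)) e q w) = F q w := by
    intro q w
    have h1 := HasMFDerivAt.comp q (mdifferentiableAt_extChartAt (I := 𝓡 (d + 1))
      (hesrc q)).hasMFDerivAt (hes.mdifferentiableAt (by simp) (x := q)).hasMFDerivAt
    have h2 : ξ ∘ e = b ∘ A := funext hξe
    rw [← hξ, h2] at h1
    have h3 := hasMFDerivAt_unique h1 (hasMFDerivAt_iff_hasFDerivAt.2 (hFd q))
    exact congrArg (fun L : EuclideanSpace ℝ (Fin d) →L[ℝ] EuclideanSpace ℝ (Fin (d + 1)) => L w) h3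
  refine ⟨range e, ?_, ⟨0, ?_⟩, d, e, rfl, rfl, hes, hemb, fun q => ?_, fun q => ?_⟩
  · rintro _ ⟨q, rfl⟩
    exact (hball _ (hbmem (A q))).2.1
  · simp [he, hb, hpz]
  · intro w w' h
    refine hFinj q ?_
    rw [← hmf, ← hmf, h]
  · have hinj : Function.Injective (mfderiv (𝓡 d) (𝓡 (d + 1)) e q) := by
      intro w w' h
      refine hFinj q ?_
      rw [← hmf, ← hmf, h]
    refine range_sup_span_singleton_eq_top rfl hinj ?_
    rintro ⟨w, hw⟩
    have h1 := (hball _ (hbmem (A q))).2.2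
    rw [← hξe q, chartField_apply (hesrc q)] at h1
    have h2 : F q w = (mfderiv (𝓡 (d + 1)) 𝓘(ℝ, EuclideanSpace ℝ (Fin (d + 1))) ξ (e q))
      (X (e q)) := (hmf q w).symm.trans (congrArg _ hw)
    refine h1.ne' ?_
    exact (congrArg (fun y => inner ℝ v y) h2).symm.trans (hFv q w)

theorem IsTransversalDisc.ne_zero {U : Set M} (hU : IsTransversalDisc X U) {p : M} (hp : p ∈ U) :
    X p ≠ 0 := by
  obtain ⟨d, e, hd, rfl, -, -, -, htr⟩ := hU
  obtain ⟨q, rfl⟩ := hp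
  intro h0
  have h1 := htr q
  rw [h0, Submodule.span_zero_singleton, sup_bot_eq] at h1
  exact range_ne_top hd _ h1

end Discs

/-! ### Trajectories cross transversal discs -/

section Crossing

variable {n : ℕ} {M : Type*} [TopologicalSpace M] [ChartedSpace (EuclideanSpace ℝ (Fin n)) M]
  [IsManifold (𝓡 n) ∞ M] {X : (m : M) → TangentSpace (𝓡 n) m} {φ : Flow ℝ M}

theorem bijective_add_smul {d n : ℕ} (hd : d + 1 = n)
    {J : EuclideanSpace ℝ (Fin d) →ₗ[ℝ] EuclideanSpace ℝ (Fin n)} {v : EuclideanSpace ℝ (Fin n)}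
    (hv : LinearMap.range J ⊔ Submodule.span ℝ {v} = ⊤) :
    Function.Bijective (J.coprod (LinearMap.toSpanSingleton ℝ _ v)) := by
  have hsurj : Function.Surjective (J.coprod (LinearMap.toSpanSingleton ℝ _ v)) := by
    rw [← LinearMap.range_eq_top, LinearMap.range_coprod, LinearMap.range_toSpanSingleton, hv]
  refine ⟨(LinearMap.injective_iff_surjective_of_finrank_eq_finrank ?_).2 hsurj, hsurj⟩
  rw [Module.finrank_prod, finrank_euclideanSpace_fin, finrank_euclideanSpace_fin,
    Module.finrank_self, hd]

/-- Near a point of a transversal disc, the disc contains the zero set of a continuous function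
that has derivative `1` along the trajectory of the point: the time coordinate of the flow box. -/
theorem IsTransversalDisc.exists_local_function (hφ : IsFlowOf φ X) {U : Set M}
    (hU : IsTransversalDisc X U) {u : M} (hu : u ∈ U) :
    ∃ g : M → ℝ, (∀ᶠ p in 𝓝 u, ContinuousAt g p ∧ (g p = 0 → p ∈ U)) ∧ g u = 0 ∧
      HasDerivAt (fun t => g (φ t u)) 1 0 := by
  obtain ⟨d, e, hd, rfl, hes, hemb, -, htr⟩ := hU
  obtain ⟨q, rfl⟩ := hu
  set ξ := extChartAt (𝓡 n) (e q) with hξ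
  have hξe : ContDiffAt ℝ ∞ (ξ ∘ e) q :=
    ((contMDiffAt_extChartAt (x := e q)).comp q hes.contMDiffAt).contDiffAt
  set J : EuclideanSpace ℝ (Fin d) →L[ℝ] EuclideanSpace ℝ (Fin n) := mfderiv (𝓡 d) (𝓡 n) e q
    with hJ
  set v : EuclideanSpace ℝ (Fin n) := X (e q) with hv
  have hJd : HasStrictFDerivAt (ξ ∘ e) J q := by
    have h1 : HasFDerivWithinAt (ξ ∘ e) J (range (𝓡 d)) q :=
      (hes.mdifferentiableAt (by simp) (x := q)).hasMFDerivAt.2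
    rw [ModelWithCorners.range_eq_univ, hasFDerivWithinAt_univ] at h1
    rw [← h1.fderiv]
    exact hξe.hasStrictFDerivAt (by simp)
  have hvel : HasDerivAt (fun t => ξ (φ t (e q))) v 0 := (hφ.hasVelocity (e q)).2
  have hbij := bijective_add_smul (J := J.toLinearMap) (v := v) hd (htr q)
  set G' : (EuclideanSpace ℝ (Fin d) × ℝ) ≃L[ℝ] EuclideanSpace ℝ (Fin n) :=
    (LinearEquiv.ofBijective _ hbij).toContinuousLinearEquiv with hG'
  have hG'a : ∀ w t, G' (w, t) = J w + t • v := fun w t => by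
    simp [hG', LinearMap.toSpanSingleton_apply]
  -- The inverse of a chart in which the disc is `ℝᵈ × {0}` and the second coordinate has derivative
  -- `1` along the vector field at the given point; only this derivative matters, so straight lines
  -- can replace trajectories.
  set G : EuclideanSpace ℝ (Fin d) × ℝ → EuclideanSpace ℝ (Fin n) :=
    fun s => (ξ ∘ e) s.1 + s.2 • v with hG
  have hGd : HasStrictFDerivAt G (G' : EuclideanSpace ℝ (Fin d) × ℝ →L[ℝ] _) (q, 0) := by
    have h1 : HasStrictFDerivAt (fun s : EuclideanSpace ℝ (Fin d) × ℝ => (ξ ∘ e) s.1)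
        (J.comp (ContinuousLinearMap.fst ℝ _ ℝ)) (q, 0) :=
      HasStrictFDerivAt.comp (q, (0 : ℝ)) (g := ξ ∘ e) hJd hasStrictFDerivAt_fst
    have h2 : HasStrictFDerivAt (fun s : EuclideanSpace ℝ (Fin d) × ℝ => s.2 • v)
        ((ContinuousLinearMap.snd ℝ (EuclideanSpace ℝ (Fin d)) ℝ).smulRight v) (q, 0) :=
      (hasStrictFDerivAt_snd).smul_const v
    refine (h1.add h2).congr_fderiv ?_
    ext s <;> simp [hG'a]
  have hGq : G (q, 0) = ξ (e q) := by simp [hG]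
  set g₀ := hGd.localInverse G G' (q, 0) with hg₀
  have hg₀d : HasStrictFDerivAt g₀ (G'.symm : EuclideanSpace ℝ (Fin n) →L[ℝ] _) (ξ (e q)) := by
    rw [← hGq]; exact hGd.to_localInverse
  have hg₀q : g₀ (ξ (e q)) = (q, 0) := by rw [← hGq]; exact hGd.localInverse_apply_image
  refine ⟨fun p => (g₀ (ξ p)).2, ?_, by simp [hg₀q], ?_⟩
  · have hsrc : ∀ᶠ p in 𝓝 (e q), p ∈ ξ.source := extChartAt_source_mem_nhds _
    have hξc : ContinuousAt ξ (e q) := continuousAt_extChartAt _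
    have h1 : ∀ᶠ p in 𝓝 (e q), ContinuousAt g₀ (ξ p) :=
      hξc.eventually (by
        filter_upwards [(hGd.toOpenPartialHomeomorph G).open_target.mem_nhds
          (hGq ▸ hGd.image_mem_toOpenPartialHomeomorph_target)] with z hz
        exact (hGd.toOpenPartialHomeomorph G).symm.continuousAt hz)
    have h2 : ∀ᶠ p in 𝓝 (e q), G (g₀ (ξ p)) = ξ p :=
      hξc.eventually (by rw [← hGq]; exact hGd.eventually_right_inverse)
    have h3 : ∀ᶠ p in 𝓝 (e q), e (g₀ (ξ p)).1 ∈ ξ.source := by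
      have hc : ContinuousAt (fun p => e (g₀ (ξ p)).1) (e q) := by
        refine hes.continuous.continuousAt.comp (continuousAt_fst.comp ?_)
        exact hg₀d.continuousAt.comp hξc
      refine hc.preimage_mem_nhds ?_
      simp only [hg₀q]
      exact extChartAt_source_mem_nhds _
    filter_upwards [hsrc, h1, h2, h3, hsrc.eventually_nhds] with p hp hp1 hp2 hp3 hp4
    refine ⟨continuousAt_snd.comp (ContinuousAt.comp hp1 (continuousAt_extChartAt' hp)),
      fun h0 => ⟨(g₀ (ξ p)).1, ξ.injOn hp3 hp ?_⟩⟩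
    rw [hG] at hp2
    simpa [h0] using hp2
  · have h1 := hg₀d.hasFDerivAt.comp_hasDerivAt_of_eq (0 : ℝ) hvel (by rw [φ.map_zero_apply])
    have h2 : G'.symm v = (0, 1) := by
      rw [ContinuousLinearEquiv.symm_apply_eq, hG'a]; simp
    have h3 := (hasFDerivAt_snd (𝕜 := ℝ) (p := g₀ (ξ (φ 0 (e q))))).comp_hasDerivAt (0 : ℝ) h1
    simpa [h2, Function.comp_def] using h3

/-- A trajectory that meets a transversal disc crosses it, so nearby trajectories meet it too. -/
theorem IsTransversalDisc.eventually_meets (hφ : IsFlowOf φ X) {U : Set M}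
    (hU : IsTransversalDisc X U) {p : M} {τ : ℝ} (hp : φ τ p ∈ U) :
    ∀ᶠ q in 𝓝 p, ∃ t, φ t q ∈ U := by
  obtain ⟨g, hg, hg0, hgd⟩ := hU.exists_local_function hφ hp
  set u := φ τ p with hu
  obtain ⟨N, hN, hNo, huN⟩ := eventually_nhds_iff.1 hg
  have hcu : Continuous fun t => φ t u := IsFlowOf.continuous_time φ u
  have hu0 : φ 0 u = u := φ.map_zero_apply u
  -- The function is negative shortly before and positive shortly after the trajectory meets the
  -- disc; nearby trajectories inherit the change of sign.
  have hsign : ∀ᶠ t in 𝓝[>] (0 : ℝ), 0 < g (φ t u) ∧ g (φ (-t) u) < 0 := by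
    have h1 := hgd.isLittleO.def (c := 1 / 2) (by norm_num)
    have h2 : ∀ᶠ t in 𝓝 (0 : ℝ), |g (φ (-t) u) + t| ≤ 1 / 2 * |t| := by
      have hneg : Tendsto (fun t : ℝ => -t) (𝓝 0) (𝓝 0) := by
        simpa using (continuous_neg (G := ℝ)).tendsto 0
      filter_upwards [hneg.eventually h1] with t ht
      simpa [hu0, hg0] using ht
    filter_upwards [nhdsWithin_le_nhds h1, nhdsWithin_le_nhds h2, self_mem_nhdsWithin]
      with t h1 h2 ht
    have ht' : (0 : ℝ) < t := ht
    simp only [hu0, hg0, sub_zero, smul_eq_mul, mul_one, Real.norm_eq_abs] at h1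
    rw [abs_of_pos ht'] at h1 h2
    have := abs_le.1 h1
    have := abs_le.1 h2
    constructor <;> linarith
  have hstay : ∀ᶠ t in 𝓝[>] (0 : ℝ), ∀ s ∈ Icc (-t) t, φ s u ∈ N := by
    have h1 : ∀ᶠ s in 𝓝 (0 : ℝ), φ s u ∈ N :=
      hcu.continuousAt.preimage_mem_nhds (by rw [hu0]; exact hNo.mem_nhds huN)
    obtain ⟨δ, hδ, h2⟩ := Metric.eventually_nhds_iff.1 h1
    filter_upwards [Ioo_mem_nhdsGT hδ] with t ht s hs
    refine h2 ?_
    rw [Real.dist_eq, sub_zero]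
    exact (abs_le.2 hs).trans_lt ht.2
  obtain ⟨t₀, ⟨⟨hpos, hneg⟩, hmem⟩, ht₀⟩ :=
    ((hsign.and hstay).and (self_mem_nhdsWithin : Ioi (0 : ℝ) ∈ 𝓝[>] 0)).exists
  have ht₀' : (0 : ℝ) < t₀ := ht₀
  have hcont : Continuous fun z : M × ℝ => φ z.2 z.1 := φ.continuous continuous_snd continuous_fst
  have hgc : ∀ s ∈ Icc (-t₀) t₀, ContinuousAt (fun q => g (φ s q)) u := fun s hs =>
    ContinuousAt.comp (g := g) (hN _ (hmem s hs)).1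
      (φ.continuous continuous_const continuous_id).continuousAt
  have htube : ∀ᶠ q in 𝓝 u, ∀ s ∈ Icc (-t₀) t₀, φ s q ∈ N :=
    isCompact_Icc.eventually_forall_of_forall_eventually (P := fun q s => φ s q ∈ N)
      fun s hs => hcont.continuousAt.preimage_mem_nhds (hNo.mem_nhds (hmem s hs))
  have hev : ∀ᶠ q in 𝓝 u, ∃ t, φ t q ∈ U := by
    filter_upwards [htube, (hgc t₀ ⟨by linarith, le_rfl⟩).eventually (lt_mem_nhds hpos),
      (hgc (-t₀) ⟨le_rfl, by linarith⟩).eventually (gt_mem_nhds hneg)] with q hq hq1 hq2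
    have hc : ContinuousOn (fun s => g (φ s q)) (Icc (-t₀) t₀) := fun s hs =>
      (ContinuousAt.comp (g := g) (f := fun s => φ s q) (hN _ (hq s hs)).1
        (IsFlowOf.continuous_time φ q).continuousAt).continuousWithinAt
    obtain ⟨s, hs, hs0⟩ := intermediate_value_Icc (by linarith) hc ⟨hq2.le, hq1.le⟩
    exact ⟨s, (hN _ (hq s hs)).2 hs0⟩
  have hτ : Tendsto (fun q => φ τ q) (𝓝 p) (𝓝 u) :=
    (φ.continuous continuous_const continuous_id).tendsto p
  filter_upwards [hτ.eventually hev] with q ⟨t, ht⟩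
  exact ⟨t + τ, by rwa [φ.map_add]⟩

end Crossing

/-! ### Broken orbits of a flow -/

section BrokenOrbits

variable {M : Type*} [TopologicalSpace M] {φ : Flow ℝ M} {h : M → ℤ} {x : M}

/-- A broken trajectory of a flow that starts at the fixed point `x` and ends at an arbitrary
point: fixed points `x = pt 0, …, pt len` along which `h` increases, for `i < len` a point `rep i`
on a trajectory from `pt i` to `pt (i + 1)`, and as last point `rep len` the end point, whose
trajectory comes from `pt len`. -/
structure BrokenOrbit (φ : Flow ℝ M) (h : M → ℤ) (x : M) where
  len : ℕ
  pt : Fin (len + 1) → M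
  rep : Fin (len + 1) → M
  fixed : ∀ i t, φ t (pt i) = pt i
  pt_zero : pt 0 = x
  strictMono : StrictMono (h ∘ pt)
  tendsto_atBot : ∀ i, Tendsto (fun t => φ t (rep i)) atBot (𝓝 (pt i))
  tendsto_atTop : ∀ i : Fin len, Tendsto (fun t => φ t (rep i.castSucc)) atTop (𝓝 (pt i.succ))

namespace BrokenOrbit

/-- The whole trajectories of the broken orbit; the last one is not cut off at the end point. -/
def piece (c : BrokenOrbit φ h x) (i : Fin (c.len + 1)) : Set M := range fun t => φ t (c.rep i)

/-- The end point of the broken orbit. -/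
def endpt (c : BrokenOrbit φ h x) : M := c.rep (Fin.last c.len)

/-- The points of the broken orbit up to its end point. -/
def carrier (c : BrokenOrbit φ h x) : Set M :=
  range c.pt ∪ (⋃ i : Fin c.len, c.piece i.castSucc) ∪ (fun t => φ t c.endpt) '' Iic 0

variable (c : BrokenOrbit φ h x)

theorem pt_injective : Function.Injective c.pt := c.strictMono.injective.of_comp

theorem pt_mem_carrier (i) : c.pt i ∈ c.carrier := Or.inl (Or.inl ⟨i, rfl⟩)

theorem piece_subset_carrier (i : Fin c.len) : c.piece i.castSucc ⊆ c.carrier := fun _ hp =>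
  Or.inl (Or.inr (mem_iUnion.2 ⟨i, hp⟩))

theorem endpt_mem_carrier : c.endpt ∈ c.carrier :=
  Or.inr ⟨0, mem_Iic.2 le_rfl, φ.map_zero_apply _⟩

theorem rep_mem_piece (i) : c.rep i ∈ c.piece i := ⟨0, φ.map_zero_apply _⟩

theorem carrier_subset_piece :
    c.carrier ⊆ range c.pt ∪ ⋃ i : Fin (c.len + 1), c.piece i := by
  rintro p ((hp | hp) | ⟨t, -, rfl⟩)
  · exact Or.inl hp
  · obtain ⟨i, hi⟩ := mem_iUnion.1 hp
    exact Or.inr (mem_iUnion.2 ⟨_, hi⟩)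
  · exact Or.inr (mem_iUnion.2 ⟨Fin.last _, t, rfl⟩)

theorem continuous_orbit (φ : Flow ℝ M) (p : M) : Continuous fun t => φ t p :=
  φ.continuous continuous_id continuous_const

theorem tendsto_orbit {l : Filter ℝ} {a b : M} (hl : ∀ s, Tendsto (fun t => t + s) l l)
    (ha : Tendsto (fun t => φ t a) l (𝓝 b)) (s : ℝ) :
    Tendsto (fun t => φ t (φ s a)) l (𝓝 b) :=
  (ha.comp (hl s)).congr fun t => φ.map_add t s a

theorem tendsto_atBot_of_mem {i} {p : M} (hp : p ∈ c.piece i) :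
    Tendsto (fun t => φ t p) atBot (𝓝 (c.pt i)) := by
  obtain ⟨s, rfl⟩ := hp
  exact tendsto_orbit (fun s => tendsto_atBot_add_const_right _ s tendsto_id) (c.tendsto_atBot i) s

theorem tendsto_atTop_of_mem {i : Fin c.len} {p : M} (hp : p ∈ c.piece i.castSucc) :
    Tendsto (fun t => φ t p) atTop (𝓝 (c.pt i.succ)) := by
  obtain ⟨s, rfl⟩ := hp
  exact tendsto_orbit (fun s => tendsto_atTop_add_const_right _ s tendsto_id) (c.tendsto_atTop i) s

theorem isCompact_insert_image_Iic {γ : ℝ → M} (hγ : Continuous γ) {p : M}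
    (hp : Tendsto γ atBot (𝓝 p)) : IsCompact (insert p (γ '' Iic 0)) := by
  have h1 : Tendsto (fun t : ℝ => -|t|) (cocompact ℝ) atBot := by
    rw [cocompact_eq_atBot_atTop]
    exact tendsto_neg_atTop_atBot.comp (tendsto_sup.2 ⟨tendsto_abs_atBot_atTop,
      tendsto_abs_atTop_atTop⟩)
  have h2 : range (γ ∘ fun t => -|t|) = γ '' Iic 0 := by
    rw [range_comp]
    congr 1
    ext t
    constructor
    · rintro ⟨s, rfl⟩; simp
    · intro ht; exact ⟨t, by simp [abs_of_nonpos (mem_Iic.1 ht)]⟩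
  rw [← h2]
  exact (hp.comp h1).isCompact_insert_range_of_cocompact (by fun_prop)

theorem isCompact_insert_image_Ici {γ : ℝ → M} (hγ : Continuous γ) {p : M}
    (hp : Tendsto γ atTop (𝓝 p)) : IsCompact (insert p (γ '' Ici 0)) := by
  have h := isCompact_insert_image_Iic (γ := fun t => γ (-t)) (by fun_prop)
    (hp.comp tendsto_neg_atBot_atTop)
  have h2 : (fun t => γ (-t)) '' Iic 0 = γ '' Ici 0 := by
    ext p
    constructor
    · rintro ⟨t, ht, rfl⟩; exact ⟨-t, by simpa using ht, rfl⟩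
    · rintro ⟨t, ht, rfl⟩; exact ⟨-t, by simpa using ht, by simp⟩
  rwa [h2] at h

variable [T2Space M]

/-- A trajectory whose limits at both ends are different is not periodic. -/
theorem orbit_injective {q a b : M} (ha : Tendsto (fun t => φ t q) atBot (𝓝 a))
    (hb : Tendsto (fun t => φ t q) atTop (𝓝 b)) (hab : a ≠ b) :
    Function.Injective fun t => φ t q := by
  suffices key : ∀ s t, s < t → φ s q ≠ φ t q by
    intro s t hst
    rcases lt_trichotomy s t with hlt | heq | hlt
    · exact absurd hst (key s t hlt)
    · exact heq
    · exact absurd hst.symm (key t s hlt)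
  intro s t hst heq
  -- A periodic trajectory returns to `q` arbitrarily late and early, so both limits are `q`.
  have hper : Function.Periodic (fun t => φ t q) (t - s) := fun r => by
    have h1 : φ (r + (t - s)) q = φ (r - s) (φ t q) := by rw [← φ.map_add]; congr 1; ring
    have h2 : φ r q = φ (r - s) (φ s q) := by rw [← φ.map_add]; congr 1; ring
    simp only
    rw [h1, h2, heq]
  have hpos : 0 < t - s := sub_pos.2 hst
  have h1 : Tendsto (fun k : ℕ => (k : ℝ) * (t - s)) atTop atTop :=
    tendsto_natCast_atTop_atTop.atTop_mul_const hpos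
  have h2 : ∀ k : ℕ, φ ((k : ℝ) * (t - s)) q = φ 0 q := fun k => by
    have := hper.nat_mul k 0
    simpa using this
  have h3 : ∀ k : ℕ, φ (-((k : ℝ) * (t - s))) q = φ 0 q := fun k => by
    have := hper.nat_mul k (-((k : ℝ) * (t - s)))
    simpa using this.symm
  have hb' := tendsto_nhds_unique ((hb.comp h1).congr h2) tendsto_const_nhds
  have ha' := tendsto_nhds_unique ((ha.comp (tendsto_neg_atTop_atBot.comp h1)).congr h3)
    tendsto_const_nhds
  exact hab (ha'.trans hb'.symm)

theorem not_fixed_of_mem {i : Fin c.len} {p : M} (hp : p ∈ c.piece i.castSucc) :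
    ¬ ∀ t, φ t p = p := by
  intro hfix
  have h1 := orbit_injective (c.tendsto_atBot_of_mem hp) (c.tendsto_atTop_of_mem hp)
    (fun heq => (Fin.castSucc_lt_succ (i := i)).ne (c.pt_injective heq))
  exact zero_ne_one (h1 (by simp only [hfix] : φ 0 p = φ 1 p))

theorem eq_of_mem_piece {i j} {p : M} (hi : p ∈ c.piece i) (hj : p ∈ c.piece j) : i = j :=
  c.pt_injective (tendsto_nhds_unique (c.tendsto_atBot_of_mem hi) (c.tendsto_atBot_of_mem hj))

theorem piece_eq_of_mem {i} {p : M} (hp : p ∈ c.piece i) : c.piece i = range fun t => φ t p := by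
  obtain ⟨s, rfl⟩ := hp
  ext q
  constructor
  · rintro ⟨t, rfl⟩
    refine ⟨t - s, ?_⟩
    simp only [← φ.map_add, sub_add_cancel]
  · rintro ⟨t, rfl⟩
    refine ⟨t + s, ?_⟩
    simp only [← φ.map_add]

theorem pt_notMem_piece (a) (i : Fin c.len) : c.pt a ∉ c.piece i.castSucc := fun ha =>
  c.not_fixed_of_mem ha (c.fixed a)

/-- The `i`-th trajectory together with its limits. -/
def arc (i : Fin c.len) : Set M :=
  insert (c.pt i.castSucc) ((fun t => φ t (c.rep i.castSucc)) '' Iic 0) ∪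
    insert (c.pt i.succ) ((fun t => φ t (c.rep i.castSucc)) '' Ici 0)

theorem isCompact_arc (i : Fin c.len) : IsCompact (c.arc i) :=
  (isCompact_insert_image_Iic (continuous_orbit φ _) (c.tendsto_atBot _)).union
    (isCompact_insert_image_Ici (continuous_orbit φ _) (c.tendsto_atTop _))

theorem mem_arc_iff {i : Fin c.len} {p : M} :
    p ∈ c.arc i ↔ p = c.pt i.castSucc ∨ p = c.pt i.succ ∨ p ∈ c.piece i.castSucc := by
  constructor
  · rintro ((rfl | ⟨t, -, rfl⟩) | (rfl | ⟨t, -, rfl⟩))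
    · exact Or.inl rfl
    · exact Or.inr (Or.inr ⟨t, rfl⟩)
    · exact Or.inr (Or.inl rfl)
    · exact Or.inr (Or.inr ⟨t, rfl⟩)
  · rintro (rfl | rfl | ⟨t, rfl⟩)
    · exact Or.inl (mem_insert _ _)
    · exact Or.inr (mem_insert _ _)
    · rcases le_total t 0 with ht | ht
      · exact Or.inl (Or.inr ⟨t, ht, rfl⟩)
      · exact Or.inr (Or.inr ⟨t, ht, rfl⟩)

/-- The last, half-infinite trajectory together with its limit. -/
def lastArc : Set M := insert (c.pt (Fin.last c.len)) ((fun t => φ t c.endpt) '' Iic 0)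

theorem isCompact_lastArc : IsCompact c.lastArc :=
  isCompact_insert_image_Iic (continuous_orbit φ _) (c.tendsto_atBot _)

theorem carrier_eq : c.carrier = (⋃ i, c.arc i) ∪ c.lastArc := by
  ext p
  constructor
  · rintro ((⟨i, rfl⟩ | hp) | hp)
    · refine i.lastCases (Or.inr (mem_insert _ _)) fun i => ?_
      exact Or.inl (mem_iUnion.2 ⟨i, c.mem_arc_iff.2 (Or.inl rfl)⟩)
    · obtain ⟨i, hi⟩ := mem_iUnion.1 hp
      exact Or.inl (mem_iUnion.2 ⟨i, c.mem_arc_iff.2 (Or.inr (Or.inr hi))⟩)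
    · exact Or.inr (Or.inr hp)
  · rintro (hp | (rfl | hp))
    · obtain ⟨i, hi⟩ := mem_iUnion.1 hp
      rcases c.mem_arc_iff.1 hi with rfl | rfl | hi
      · exact c.pt_mem_carrier _
      · exact c.pt_mem_carrier _
      · exact c.piece_subset_carrier i hi
    · exact c.pt_mem_carrier _
    · exact Or.inr hp

theorem isCompact_carrier : IsCompact c.carrier := by
  rw [carrier_eq]
  exact (isCompact_iUnion c.isCompact_arc).union c.isCompact_lastArc

theorem isPreconnected_arc (i : Fin c.len) : IsPreconnected (c.arc i) := by
  refine (isPreconnected_range (continuous_orbit φ (c.rep i.castSucc))).subset_closure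
    (fun p hp => c.mem_arc_iff.2 (Or.inr (Or.inr hp))) fun p hp => ?_
  rcases c.mem_arc_iff.1 hp with rfl | rfl | hp
  · exact mem_closure_of_tendsto (c.tendsto_atBot _) (Eventually.of_forall fun t => ⟨t, rfl⟩)
  · exact mem_closure_of_tendsto (c.tendsto_atTop _) (Eventually.of_forall fun t => ⟨t, rfl⟩)
  · exact subset_closure hp

theorem isPreconnected_lastArc : IsPreconnected c.lastArc := by
  refine (isPreconnected_Iic.image _ (continuous_orbit φ c.endpt).continuousOn).subset_closure
    (subset_insert _ _) fun p hp => ?_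
  rcases hp with rfl | hp
  · exact mem_closure_of_tendsto (c.tendsto_atBot _)
      ((eventually_le_atBot 0).mono fun t ht => ⟨t, ht, rfl⟩)
  · exact subset_closure hp

/-- The part of the broken orbit up to a point `q` of its `i`-th trajectory. -/
def before (i : Fin c.len) (q : M) : Set M :=
  (⋃ a : {a : Fin c.len // a < i}, c.arc a) ∪
    insert (c.pt i.castSucc) ((fun t => φ t q) '' Iic 0)

/-- The part of the broken orbit after a point `q` of its `i`-th trajectory. -/
def after (i : Fin c.len) (q : M) : Set M :=
  (⋃ a : {a : Fin c.len // i < a}, c.arc a) ∪ c.lastArc ∪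
    insert (c.pt i.succ) ((fun t => φ t q) '' Ici 0)

theorem isCompact_before {i : Fin c.len} {q : M} (hq : q ∈ c.piece i.castSucc) :
    IsCompact (c.before i q) :=
  (isCompact_iUnion fun _ => c.isCompact_arc _).union
    (isCompact_insert_image_Iic (continuous_orbit φ _) (c.tendsto_atBot_of_mem hq))

theorem isCompact_after {i : Fin c.len} {q : M} (hq : q ∈ c.piece i.castSucc) :
    IsCompact (c.after i q) :=
  ((isCompact_iUnion fun _ => c.isCompact_arc _).union c.isCompact_lastArc).union
    (isCompact_insert_image_Ici (continuous_orbit φ _) (c.tendsto_atTop_of_mem hq))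

theorem pt_mem_before {i : Fin c.len} {q : M} {a : Fin (c.len + 1)} (ha : a ≤ i.castSucc) :
    c.pt a ∈ c.before i q := by
  rcases ha.eq_or_lt with rfl | ha
  · exact Or.inr (mem_insert _ _)
  · have ha' : (a : ℕ) < i := ha
    have := i.2
    exact Or.inl (mem_iUnion.2 ⟨⟨⟨a, by omega⟩, ha'⟩, c.mem_arc_iff.2 (Or.inl rfl)⟩)

theorem pt_mem_after {i : Fin c.len} {q : M} {a : Fin (c.len + 1)} (ha : i.castSucc < a) :
    c.pt a ∈ c.after i q := by
  have ha' : (i : ℕ) < a := ha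
  by_cases hai : a = i.succ
  · rw [hai]
    exact Or.inr (mem_insert _ _)
  · have hne : (a : ℕ) ≠ i + 1 := fun he => hai (Fin.ext he)
    have := a.2
    refine Or.inl (Or.inl (mem_iUnion.2 ⟨⟨⟨a - 1, by omega⟩, ?_⟩, c.mem_arc_iff.2 (Or.inr (Or.inl
      (congrArg c.pt (Fin.ext ?_))))⟩))
    · change (i : ℕ) < a - 1
      omega
    · simp; omega

theorem carrier_subset_before_union_after {i : Fin c.len} {q : M} (hq : q ∈ c.piece i.castSucc) :
    c.carrier ⊆ c.before i q ∪ c.after i q := by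
  rw [carrier_eq]
  rintro p (hp | hp)
  · obtain ⟨a, ha⟩ := mem_iUnion.1 hp
    rcases lt_trichotomy a i with hai | rfl | hai
    · exact Or.inl (Or.inl (mem_iUnion.2 ⟨⟨a, hai⟩, ha⟩))
    · rcases c.mem_arc_iff.1 ha with rfl | rfl | ha
      · exact Or.inl (Or.inr (mem_insert _ _))
      · exact Or.inr (Or.inr (mem_insert _ _))
      · rw [c.piece_eq_of_mem hq] at ha
        obtain ⟨t, rfl⟩ := ha
        rcases le_total t 0 with ht | ht
        · exact Or.inl (Or.inr (Or.inr ⟨t, ht, rfl⟩))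
        · exact Or.inr (Or.inr (Or.inr ⟨t, ht, rfl⟩))
    · exact Or.inr (Or.inl (Or.inl (mem_iUnion.2 ⟨⟨a, hai⟩, ha⟩)))
  · exact Or.inr (Or.inl (Or.inr hp))

/-- The two parts into which a point cuts a broken orbit meet in this point only: limits at `-∞`
tell their points apart. -/
theorem before_inter_after {i : Fin c.len} {q p : M} (hq : q ∈ c.piece i.castSucc)
    (hb : p ∈ c.before i q) (ha : p ∈ c.after i q) : p = q := by
  have hbot : ∃ a ≤ i.castSucc, Tendsto (fun t => φ t p) atBot (𝓝 (c.pt a)) := by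
    rcases hb with hb | (rfl | ⟨t, -, rfl⟩)
    · obtain ⟨⟨a, hai⟩, hp⟩ := mem_iUnion.1 hb
      have ha' : (a : ℕ) < i := hai
      rcases c.mem_arc_iff.1 hp with rfl | rfl | hp
      · exact ⟨_, Fin.castSucc_le_castSucc_iff.2 hai.le, by simp [c.fixed]⟩
      · exact ⟨_, (by exact ha' : a.succ ≤ i.castSucc), by simp [c.fixed]⟩
      · exact ⟨_, Fin.castSucc_le_castSucc_iff.2 hai.le, c.tendsto_atBot_of_mem hp⟩
    · exact ⟨_, le_rfl, by simp [c.fixed]⟩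
    · refine ⟨_, le_rfl, c.tendsto_atBot_of_mem ?_⟩
      rw [c.piece_eq_of_mem hq]
      exact ⟨t, rfl⟩
  obtain ⟨a, hai, hta⟩ := hbot
  have hcontra : ∀ b, i.castSucc < b → ¬ Tendsto (fun t => φ t p) atBot (𝓝 (c.pt b)) :=
    fun b hb htb => absurd (c.pt_injective (tendsto_nhds_unique hta htb)) (hai.trans_lt hb).ne
  rcases ha with (ha | (rfl | ⟨t, -, rfl⟩)) | (rfl | ⟨t, ht, rfl⟩)
  · obtain ⟨⟨b, hib⟩, hp⟩ := mem_iUnion.1 ha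
    exfalso
    rcases c.mem_arc_iff.1 hp with rfl | rfl | hp
    · exact hcontra _ (Fin.castSucc_lt_castSucc_iff.2 hib) (by simp [c.fixed])
    · exact hcontra _ ((Fin.castSucc_lt_castSucc_iff.2 hib).trans Fin.castSucc_lt_succ)
        (by simp [c.fixed])
    · exact hcontra _ (Fin.castSucc_lt_castSucc_iff.2 hib) (c.tendsto_atBot_of_mem hp)
  · exact absurd (by simp [c.fixed]) (hcontra _ (Fin.castSucc_lt_last i))
  · exact absurd (c.tendsto_atBot_of_mem ⟨t, rfl⟩) (hcontra _ (Fin.castSucc_lt_last i))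
  · exact absurd (by simp [c.fixed]) (hcontra _ Fin.castSucc_lt_succ)
  · have hpi : φ t q ∈ c.piece i.castSucc := by
      rw [c.piece_eq_of_mem hq]
      exact ⟨t, rfl⟩
    simp only at hb hpi ⊢
    rcases hb with hb | (hb | ⟨s, hs, hst⟩)
    · obtain ⟨⟨b, hb⟩, hp⟩ := mem_iUnion.1 hb
      exfalso
      rcases c.mem_arc_iff.1 hp with h1 | h1 | h1
      · exact c.pt_notMem_piece _ i (h1 ▸ hpi)
      · exact c.pt_notMem_piece _ i (h1 ▸ hpi)
      · exact hb.ne (Fin.castSucc_injective _ (c.eq_of_mem_piece h1 hpi))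
    · exact absurd (hb ▸ hpi) (c.pt_notMem_piece _ i)
    · have hinj := orbit_injective (c.tendsto_atBot_of_mem hq) (c.tendsto_atTop_of_mem hq)
        (fun heq => (Fin.castSucc_lt_succ (i := i)).ne (c.pt_injective heq))
      have hst' : s = t := hinj hst
      rw [hst'] at hs
      have : t = 0 := le_antisymm hs ht
      rw [this, φ.map_zero_apply]

theorem endpt_notMem_piece (i : Fin c.len) : c.endpt ∉ c.piece i.castSucc := fun hm =>
  (Fin.castSucc_lt_last i).ne (c.eq_of_mem_piece hm (c.rep_mem_piece _))

/-- Every broken orbit close to `c` passes near each point `q` of `c`: the points before and those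
after `q` are separated by a neighbourhood of `q`. -/
theorem exists_nhd_meets {i : Fin c.len} {q : M} (hq : q ∈ c.piece i.castSucc) {W : Set M}
    (hW : W ∈ 𝓝 q) (hfin : {p | ∀ t, φ t p = p}.Finite) :
    ∃ V O : Set M, IsOpen V ∧ IsOpen O ∧ c.carrier ⊆ V ∧ c.endpt ∈ O ∧
      ∀ c' : BrokenOrbit φ h x, c'.carrier ⊆ V → c'.endpt ∈ O → ∀ l,
        (∃ a ≤ i.castSucc, c'.pt l = c.pt a) →
        (∀ l' : Fin (c'.len + 1), (l' : ℕ) = l + 1 → ∃ a > i.castSucc, c'.pt l' = c.pt a) →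
        (c'.piece l ∩ c'.carrier ∩ W).Nonempty := by
  -- Fixed points and the end point are removed from the neighbourhood, so that each of them lies on
  -- a definite side of `q`.
  set W' := interior W \ insert c.endpt {p | ∀ t, φ t p = p} with hW'
  have hW'o : IsOpen W' := isOpen_interior.sdiff (hfin.insert _).isClosed
  have hqW' : q ∈ W' := by
    refine ⟨mem_interior_iff_mem_nhds.2 hW, ?_⟩
    rintro (rfl | hq')
    · exact c.endpt_notMem_piece i hq
    · exact c.not_fixed_of_mem hq hq'
  have hdisj : Disjoint (c.before i q \ W') (c.after i q \ W') := by
    rw [Set.disjoint_left]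
    rintro p ⟨h1, h2⟩ ⟨h3, -⟩
    exact h2 (c.before_inter_after hq h1 h3 ▸ hqW')
  -- Outside `W'`, the parts before and after `q` have disjoint neighbourhoods `A` and `B`.
  obtain ⟨A, B, hA, hB, hAs, hBs, hAB⟩ := SeparatedNhds.of_isCompact_isCompact
    ((c.isCompact_before hq).diff hW'o) ((c.isCompact_after hq).diff hW'o) hdisj
  have hptW : ∀ p, (∀ t, φ t p = p) → p ∉ W' := fun p hp hpW => hpW.2 (Or.inr hp)
  refine ⟨A ∪ B ∪ W', B, (hA.union hB).union hW'o, hB, ?_, ?_, ?_⟩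
  · intro p hp
    by_cases hpW : p ∈ W'
    · exact Or.inr hpW
    · rcases c.carrier_subset_before_union_after hq hp with h1 | h1
      · exact Or.inl (Or.inl (hAs ⟨h1, hpW⟩))
      · exact Or.inl (Or.inr (hBs ⟨h1, hpW⟩))
  · exact hBs ⟨Or.inl (Or.inr (Or.inr ⟨0, mem_Iic.2 le_rfl, φ.map_zero_apply _⟩)),
      fun hm => hm.2 (mem_insert _ _)⟩
  intro c' hc' hm' l ⟨a, ha, hla⟩ hl'
  have hlA : c'.pt l ∈ A := hla ▸ hAs ⟨c.pt_mem_before ha, hptW _ (c.fixed a)⟩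
  -- A connected set that leads from `A` to `B` passes through `W'`.
  have key : ∀ S ⊆ c'.carrier, IsPreconnected S → c'.pt l ∈ S → (∃ p ∈ S, p ∈ B) →
      (S ∩ W').Nonempty := by
    intro S hS hSc hlS ⟨p, hpS, hpB⟩
    by_contra hne
    have hsub : S ⊆ A ∪ B := fun z hz => by
      rcases hc' (hS hz) with h1 | h1
      · exact h1
      · exact absurd ⟨z, hz, h1⟩ hne
    obtain ⟨z, -, hzA, hzB⟩ := hSc A B hA hB hsub ⟨_, hlS, hlA⟩ ⟨p, hpS, hpB⟩
    exact Set.disjoint_left.1 hAB hzA hzB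
  induction l using Fin.lastCases with
  | last =>
    obtain ⟨z, hz, hzW⟩ := key c'.lastArc (by rw [carrier_eq]; exact subset_union_right)
      c'.isPreconnected_lastArc (mem_insert _ _)
      ⟨c'.endpt, Or.inr ⟨0, mem_Iic.2 le_rfl, φ.map_zero_apply _⟩, hm'⟩
    rcases hz with rfl | ⟨t, ht, rfl⟩
    · exact absurd hzW (hptW _ (c'.fixed _))
    · exact ⟨_, ⟨⟨t, rfl⟩, Or.inr ⟨t, ht, rfl⟩⟩, interior_subset hzW.1⟩
  | cast l =>
    obtain ⟨b, hb, hlb⟩ := hl' l.succ rfl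
    have hBm : c'.pt l.succ ∈ B := hlb ▸ hBs ⟨c.pt_mem_after hb, hptW _ (c.fixed b)⟩
    obtain ⟨z, hz, hzW⟩ := key (c'.arc l)
      (by rw [carrier_eq]; exact (subset_iUnion c'.arc l).trans subset_union_left)
      (c'.isPreconnected_arc l) (c'.mem_arc_iff.2 (Or.inl rfl))
      ⟨_, c'.mem_arc_iff.2 (Or.inr (Or.inl rfl)), hBm⟩
    rcases c'.mem_arc_iff.1 hz with rfl | rfl | hz
    · exact absurd hzW (hptW _ (c'.fixed _))
    · exact absurd hzW (hptW _ (c'.fixed _))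
    · exact ⟨z, ⟨hz, c'.piece_subset_carrier l hz⟩, interior_subset hzW.1⟩

end BrokenOrbit
end BrokenOrbits

/-! ### Slices to broken orbits -/

section Slices

/-- A strictly increasing map `g` that starts at `0` cuts its codomain into consecutive blocks; `b`
assigns to an element the number of its block. -/
theorem exists_block_map {N N' : ℕ} {g : Fin (N' + 1) → Fin (N + 1)} (hg : StrictMono g)
    (hg0 : g 0 = 0) : ∃ b : Fin (N + 1) → Fin (N' + 1), (∀ i, g (b i) ≤ i) ∧
      (∀ i (l' : Fin (N' + 1)), (l' : ℕ) = b i + 1 → i < g l') ∧ b (Fin.last N) = Fin.last N' ∧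
      (∀ l : Fin N', ∃ i : Fin N, b i.castSucc = l.castSucc) ∧
      ∀ i i' : Fin (N + 1), (i' : ℕ) = i + 1 → b i' = b i ∨ (b i' : ℕ) = b i + 1 := by
  have hex : ∀ i, ∃ l, g l ≤ i ∧ ∀ l', g l' ≤ i → l' ≤ l := fun i => by
    obtain ⟨l, hl, hmax⟩ := Finset.exists_max_image (Finset.univ.filter fun l => g l ≤ i) id
      ⟨0, by simp [hg0]⟩
    exact ⟨l, by simpa using hl, fun l' hl' => hmax l' (by simpa using hl')⟩
  choose b hb hmax using hex
  refine ⟨b, hb, fun i l' hl' => ?_, ?_, fun l => ?_, fun i i' hi => ?_⟩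
  · by_contra! hcon
    have : (l' : ℕ) ≤ b i := hmax i l' hcon
    omega
  · exact le_antisymm (Fin.le_last _) (hmax _ _ (Fin.le_last _))
  · have hlt : g l.castSucc < g l.succ := hg Fin.castSucc_lt_succ
    have hlt' : (g l.castSucc : ℕ) < N := lt_of_lt_of_le hlt (Nat.lt_succ_iff.1 (g l.succ).2)
    refine ⟨⟨g l.castSucc, hlt'⟩, ?_⟩
    have he : (⟨g l.castSucc, hlt'⟩ : Fin N).castSucc = g l.castSucc := rfl
    rw [he]
    exact le_antisymm (hg.le_iff_le.1 (hb _)) (hmax _ _ le_rfl)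
  · have hle : b i ≤ b i' := hmax _ _ ((hb i).trans (by rw [Fin.le_def]; omega))
    have hle' : (b i : ℕ) ≤ b i' := hle
    by_contra! hcon
    have hne : (b i : ℕ) ≠ b i' := fun he => hcon.1 (Fin.ext he.symm)
    have h2 : (b i : ℕ) + 1 < b i' := by omega
    have h3 : b i' < N' + 1 := (b i').2
    set l : Fin (N' + 1) := ⟨b i + 1, by omega⟩ with hl
    have h4 : i < g l := by
      by_contra! hc
      have : (l : ℕ) ≤ b i := hmax i l hc
      simp [hl] at this
    have h5 : g l < g (b i') := hg (by rw [Fin.lt_def]; exact h2)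
    have h6 := hb i'
    rw [Fin.lt_def] at h4 h5
    rw [Fin.le_def] at h6
    omega

/-- Two sequences along which `h` increases are equal if they have the same values. -/
theorem eq_of_range_eq {M : Type*} {h : M → ℤ} {N N' : ℕ} (hN : N = N') {f : Fin (N + 1) → M}
    {f' : Fin (N' + 1) → M} (hf : StrictMono (h ∘ f)) (hf' : StrictMono (h ∘ f'))
    (hr : range f = range f') (i : Fin (N + 1)) : f i = f' (Fin.cast (by rw [hN]) i) := by
  subst hN
  have he : h ∘ f = h ∘ f' := (hf.range_inj hf').1 (by rw [range_comp, hr, range_comp])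
  obtain ⟨j, hj⟩ : f i ∈ range f' := hr ▸ mem_range_self i
  have h1 : (h ∘ f') j = (h ∘ f') i := (congrArg h hj).trans (congrFun he i)
  rw [← hj, hf'.injective h1]
  rfl

/-- Transversal slices built from an arbitrary supply `D` of discs. -/
def IsSliceOf {M : Type*} (D : Set M → Prop) {p r : ℕ} (P : Fin p → Set M) (R : Set (Fin p))
    (U : Fin r → Set M) : Prop :=
  (∀ j, D (U j)) ∧ Pairwise (fun j j' => Disjoint (U j) (U j')) ∧
    ∃ a : Fin r → Fin p, (∀ j, (U j ∩ P (a j)).Nonempty) ∧ (∀ i ∈ R, ∃ j, a j = i) ∧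
      ∀ j j' : Fin r, (j' : ℕ) = j + 1 → (a j' = a j ∨ (a j' : ℕ) = a j + 1)

variable {M : Type*} [TopologicalSpace M] {φ : Flow ℝ M} {h : M → ℤ} {x : M}

/-- The properties of transversal discs used for slices: they contain no fixed points, nearby
trajectories meet the same discs, and there are small discs through each point. -/
structure IsDiscFamily (φ : Flow ℝ M) (D : Set M → Prop) : Prop where
  not_fixed : ∀ U, D U → ∀ p ∈ U, ¬ ∀ t, φ t p = p
  eventually_meets : ∀ U, D U → ∀ p τ, φ τ p ∈ U → ∀ᶠ q in 𝓝 p, ∃ t, φ t q ∈ U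
  exists_disc : ∀ p, (¬ ∀ t, φ t p = p) → ∀ W ∈ 𝓝 p, ∃ U ⊆ W, p ∈ U ∧ D U

namespace BrokenOrbit

/-- The slices to a broken orbit; the last trajectory may, but need not be met. -/
def HasSlice (D : Set M → Prop) (c : BrokenOrbit φ h x) {r : ℕ} (U : Fin r → Set M) : Prop :=
  IsSliceOf D c.piece (range Fin.castSucc) U

variable [T2Space M] (c : BrokenOrbit φ h x)

/-- A broken orbit that avoids the fixed points not on `c` has its fixed points among those of `c`,
in the same order. -/
theorem exists_refine {c c' : BrokenOrbit φ h x}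
    (hc : Disjoint c'.carrier ({p | ∀ t, φ t p = p} \ range c.pt)) :
    ∃ g : Fin (c'.len + 1) → Fin (c.len + 1), StrictMono g ∧ g 0 = 0 ∧
      ∀ l, c'.pt l = c.pt (g l) := by
  have hex : ∀ l, ∃ i, c'.pt l = c.pt i := fun l => by
    by_contra! hcon
    exact Set.disjoint_left.1 hc (c'.pt_mem_carrier l) ⟨c'.fixed l, by
      rintro ⟨i, hi⟩; exact hcon i hi.symm⟩
  choose g hg using hex
  refine ⟨g, fun l l' hl => ?_, c.pt_injective ?_, hg⟩
  · have := c'.strictMono hl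
    rw [Function.comp_apply, Function.comp_apply, hg, hg] at this
    exact c.strictMono.lt_iff_lt.1 this
  · rw [← hg, c.pt_zero, c'.pt_zero]

theorem isOpen_compl_fixed_diff (hfin : {p | ∀ t, φ t p = p}.Finite) :
    IsOpen ({p | ∀ t, φ t p = p} \ range c.pt)ᶜ :=
  (hfin.subset sdiff_subset).isClosed.isOpen_compl

/-- The fixed points on a broken orbit are its points `pt i`; the end point is no exception, since a
fixed end point is the limit of its own trajectory. -/
theorem carrier_inter_fixed (c : BrokenOrbit φ h x) :
    c.carrier ∩ {p | ∀ t, φ t p = p} = range c.pt := by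
  ext p
  constructor
  · rintro ⟨(hp | hp) | ⟨t, -, ht⟩, hfix⟩
    · exact hp
    · obtain ⟨i, hi⟩ := mem_iUnion.1 hp
      exact absurd hfix (c.not_fixed_of_mem hi)
    · have h1 : Tendsto (fun t => φ t p) atBot (𝓝 (c.pt (Fin.last _))) :=
        c.tendsto_atBot_of_mem ⟨t, ht⟩
      refine ⟨_, tendsto_nhds_unique h1 ?_⟩
      simp only [show ∀ t, φ t p = p from hfix, tendsto_const_nhds]
  · rintro ⟨i, rfl⟩
    exact ⟨c.pt_mem_carrier i, c.fixed i⟩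

theorem carrier_subset_compl : c.carrier ⊆ ({p | ∀ t, φ t p = p} \ range c.pt)ᶜ :=
  fun _ hp hp' => hp'.2 (c.carrier_inter_fixed ▸ ⟨hp, hp'.1⟩)

/-- Broken orbits near `c` come close to each point of `c`. -/
theorem exists_nhd_inter (hfin : {p | ∀ t, φ t p = p}.Finite) {W : Set M} (hW : IsOpen W)
    (hc : (c.carrier ∩ W).Nonempty) :
    ∃ V O : Set M, IsOpen V ∧ IsOpen O ∧ c.carrier ⊆ V ∧ c.endpt ∈ O ∧
      ∀ c' : BrokenOrbit φ h x, c'.carrier ⊆ V → c'.endpt ∈ O → (c'.carrier ∩ W).Nonempty := by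
  -- It suffices to treat points on the trajectories: each fixed point but the first is the limit of
  -- one, and the last trajectory is controlled by the end point.
  have hpiece : ∀ (i : Fin c.len), ∀ p ∈ c.piece i.castSucc, p ∈ W →
      ∃ V O : Set M, IsOpen V ∧ IsOpen O ∧ c.carrier ⊆ V ∧ c.endpt ∈ O ∧
        ∀ c' : BrokenOrbit φ h x, c'.carrier ⊆ V → c'.endpt ∈ O →
          (c'.carrier ∩ W).Nonempty := by
    intro i p hp hpW
    obtain ⟨V, O, hV, hO, hcV, hcO, hVO⟩ := c.exists_nhd_meets hp (hW.mem_nhds hpW) hfin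
    refine ⟨V ∩ ({p | ∀ t, φ t p = p} \ range c.pt)ᶜ, O, hV.inter (c.isOpen_compl_fixed_diff hfin),
      hO, subset_inter hcV c.carrier_subset_compl, hcO, fun c' hc' hm' => ?_⟩
    obtain ⟨g, hg, hg0, hgp⟩ := exists_refine (c := c) (c' := c')
      (Set.disjoint_left.2 fun z hz => (hc' hz).2)
    obtain ⟨b, hb1, hb2, -⟩ := exists_block_map hg hg0
    obtain ⟨z, ⟨-, hz⟩, hzW⟩ := hVO c' (fun z hz => (hc' hz).1) hm' (b i.castSucc)
      ⟨_, hb1 _, hgp _⟩ fun l' hl' => ⟨_, hb2 _ l' hl', hgp _⟩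
    exact ⟨z, hz, hzW⟩
  obtain ⟨p, (⟨i, rfl⟩ | hp) | ⟨t, ht, rfl⟩, hpW⟩ := hc
  · induction i using Fin.cases with
    | zero =>
      refine ⟨univ, univ, isOpen_univ, isOpen_univ, subset_univ _, mem_univ _, fun c' _ _ => ?_⟩
      exact ⟨c.pt 0, (c.pt_zero.trans c'.pt_zero.symm) ▸ c'.pt_mem_carrier 0, hpW⟩
    | succ i =>
      obtain ⟨t, ht⟩ := ((c.tendsto_atTop i).eventually (hW.mem_nhds hpW)).exists
      exact hpiece i _ ⟨t, rfl⟩ ht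
  · obtain ⟨i, hi⟩ := mem_iUnion.1 hp
    exact hpiece i p hi hpW
  · refine ⟨univ, (fun q => φ t q) ⁻¹' W, isOpen_univ,
      hW.preimage (φ.continuous continuous_const continuous_id), subset_univ _, hpW,
      fun c' _ hm' => ⟨φ t c'.endpt, Or.inr ⟨t, ht, rfl⟩, hm'⟩⟩

/-- A slice to `c` is a slice to all broken orbits near `c`. -/
theorem exists_nhd_hasSlice (hfin : {p | ∀ t, φ t p = p}.Finite) {D : Set M → Prop}
    (hD : IsDiscFamily φ D) {r : ℕ} {U : Fin r → Set M} (hU : c.HasSlice D U) :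
    ∃ V O : Set M, IsOpen V ∧ IsOpen O ∧ c.carrier ⊆ V ∧ c.endpt ∈ O ∧
      ∀ c' : BrokenOrbit φ h x, c'.carrier ⊆ V → c'.endpt ∈ O → c'.HasSlice D U := by
  obtain ⟨hUD, hUdisj, a, ha, haR, hastep⟩ := hU
  have hW : ∀ i, {q | ∀ j, a j = i → ∃ t, φ t q ∈ U j} ∈ 𝓝 (c.rep i) := by
    intro i
    have : ∀ j, ∀ᶠ q in 𝓝 (c.rep i), a j = i → ∃ t, φ t q ∈ U j := by
      intro j
      by_cases hj : a j = i
      · obtain ⟨p, hpU, hp⟩ := ha j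
        rw [hj] at hp
        obtain ⟨t, rfl⟩ := hp
        exact (hD.eventually_meets _ (hUD j) _ _ hpU).mono fun _ hq _ => hq
      · exact Eventually.of_forall fun _ hj' => absurd hj' hj
    exact eventually_all.2 this
  have hmeet := fun i : Fin c.len =>
    c.exists_nhd_meets (c.rep_mem_piece i.castSucc) (hW i.castSucc) hfin
  choose V O hV hO hcV hcO hVO using hmeet
  refine ⟨({p | ∀ t, φ t p = p} \ range c.pt)ᶜ ∩ ⋂ i, V i,
    interior {q | ∀ j, a j = Fin.last _ → ∃ t, φ t q ∈ U j} ∩ ⋂ i, O i,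
    (c.isOpen_compl_fixed_diff hfin).inter (isOpen_iInter_of_finite hV),
    isOpen_interior.inter (isOpen_iInter_of_finite hO),
    subset_inter c.carrier_subset_compl (subset_iInter hcV),
    ⟨mem_interior_iff_mem_nhds.2 (hW _), mem_iInter.2 hcO⟩, fun c' hc' hm' => ?_⟩
  obtain ⟨g, hg, hg0, hgp⟩ := exists_refine (c := c) (c' := c')
    (Set.disjoint_left.2 fun z hz => (hc' hz).1)
  obtain ⟨b, hb1, hb2, hb3, hb4, hb5⟩ := exists_block_map hg hg0
  -- A disc that meets the `i`-th trajectory of `c` meets the trajectory of `c'` that joins the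
  -- fixed points around it, and this trajectory has number `b i`.
  refine ⟨hUD, hUdisj, b ∘ a, fun j => ?_, ?_, fun j j' hj => ?_⟩
  · have hz : ∃ z ∈ c'.piece (b (a j)), ∀ k, a k = a j → ∃ t, φ t z ∈ U k := by
      generalize a j = i
      induction i using Fin.lastCases with
      | last =>
        rw [hb3]
        exact ⟨_, c'.rep_mem_piece _, interior_subset hm'.1⟩
      | cast i =>
        obtain ⟨z, ⟨hz, -⟩, hzW⟩ := hVO i c' (fun z hz => mem_iInter.1 (hc' hz).2 i)
          (mem_iInter.1 hm'.2 i) (b i.castSucc)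
          ⟨_, hb1 _, hgp _⟩ fun l' hl' => ⟨_, hb2 _ l' hl', hgp _⟩
        exact ⟨z, hz, hzW⟩
    obtain ⟨z, hz, hzU⟩ := hz
    obtain ⟨t, ht⟩ := hzU j rfl
    refine ⟨_, ht, ?_⟩
    simp only [Function.comp_apply]
    rw [c'.piece_eq_of_mem hz]
    exact ⟨t, rfl⟩
  · rintro _ ⟨l, rfl⟩
    obtain ⟨i, hi⟩ := hb4 l
    obtain ⟨j, hj⟩ := haR _ ⟨i, rfl⟩
    exact ⟨j, by rw [Function.comp_apply, hj, hi]⟩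
  · simp only [Function.comp_apply]
    rcases hastep j j' hj with h1 | h1
    · exact Or.inl (by rw [h1])
    · exact hb5 _ _ h1

/-- Each broken orbit has a slice, one small disc for each trajectory but the last. -/
theorem exists_hasSlice {D : Set M → Prop} (hD : IsDiscFamily φ D) :
    ∃ (r : ℕ) (U : Fin r → Set M), c.HasSlice D U := by
  have hinj : Function.Injective fun i : Fin c.len => c.rep i.castSucc := fun i j hij =>
    Fin.castSucc_injective _ (c.eq_of_mem_piece (c.rep_mem_piece _) (by
      simp only at hij
      rw [hij]; exact c.rep_mem_piece _))
  obtain ⟨W, hW, hWd⟩ := (finite_range fun i : Fin c.len => c.rep i.castSucc).t2_separation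
  have hex : ∀ i : Fin c.len, ∃ U ⊆ W (c.rep i.castSucc), c.rep i.castSucc ∈ U ∧ D U := fun i =>
    hD.exists_disc _ (c.not_fixed_of_mem (c.rep_mem_piece _)) _
      ((hW _).2.mem_nhds (hW _).1)
  choose U hUW hpU hUD using hex
  refine ⟨c.len, U, hUD, fun i j hij => ?_, Fin.castSucc, fun j => ⟨_, hpU j, c.rep_mem_piece _⟩,
    ?_, fun j j' hj => Or.inr (by simpa using hj)⟩
  · exact (hWd (mem_range_self i) (mem_range_self j) (hinj.ne hij)).mono (hUW i) (hUW j)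
  · rintro _ ⟨i, rfl⟩
    exact ⟨i, rfl⟩

/-- The set of points of a broken orbit determines its fixed points and its trajectories between
them; only the choice of the points `rep i` is lost. -/
theorem eq_of_carrier_eq {c c' : BrokenOrbit φ h x} (hcc : c.carrier = c'.carrier) :
    ∃ hl : c.len = c'.len, (∀ i, c.pt i = c'.pt (Fin.cast (by rw [hl]) i)) ∧
      ∀ i : Fin c.len, c.piece i.castSucc = c'.piece (Fin.cast hl i).castSucc := by
  have hr : range c.pt = range c'.pt := by
    rw [← carrier_inter_fixed, ← carrier_inter_fixed, hcc]
  have hl : c.len = c'.len := by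
    have h1 := Set.ncard_range_of_injective c.pt_injective
    have h2 := Set.ncard_range_of_injective c'.pt_injective
    rw [hr, h2] at h1
    simpa using h1.symm
  have hpt : ∀ i, c.pt i = c'.pt (Fin.cast (by rw [hl]) i) :=
    eq_of_range_eq hl c.strictMono c'.strictMono hr
  refine ⟨hl, hpt, fun i => ?_⟩
  have hmem : c.rep i.castSucc ∈ c'.carrier :=
    hcc ▸ c.piece_subset_carrier i (c.rep_mem_piece _)
  rcases c'.carrier_subset_piece hmem with ⟨j, hj⟩ | hm
  · exact absurd (hj ▸ c'.fixed j) (c.not_fixed_of_mem (c.rep_mem_piece _))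
  · obtain ⟨j, hj⟩ := mem_iUnion.1 hm
    have h1 := tendsto_nhds_unique (c.tendsto_atBot _) (c'.tendsto_atBot_of_mem hj)
    rw [hpt] at h1
    have h2 := c'.pt_injective h1
    have h3 : j = (Fin.cast hl i).castSucc := h2.symm
    rw [← h3, c'.piece_eq_of_mem hj]
    rfl

end BrokenOrbit
end Slices

/-! ### The slice topology and compact subsets -/

section SliceTopology

open TopologicalSpace

variable {M : Type*} [TopologicalSpace M] [T2Space M] {φ : Flow ℝ M} {h : M → ℤ} {x : M}
  {S : Type*}

/-- The topology generated by the sets of elements that lie in `V`, have `U` as a slice, and have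
their end point in `O`, on a type of broken orbits. -/
@[reducible]
def sliceTopology (D : Set M → Prop) (f : S → BrokenOrbit φ h x) : TopologicalSpace S :=
  generateFrom {A | ∃ (c : S) (V O : Set M) (r : ℕ) (U : Fin r → Set M),
    IsOpen V ∧ (f c).carrier ⊆ V ∧ IsOpen O ∧ (f c).endpt ∈ O ∧ (f c).HasSlice D U ∧
      A = {d | (f d).carrier ⊆ V ∧ (f d).HasSlice D U ∧ (f d).endpt ∈ O}}

/-- The points of a broken orbit as a compact set, together with its end point. -/
def toCompacts (c : BrokenOrbit φ h x) : NonemptyCompacts M × M :=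
  (⟨⟨c.carrier, c.isCompact_carrier⟩, ⟨_, c.endpt_mem_carrier⟩⟩, c.endpt)

theorem mem_nhds_sliceTopology {D : Set M → Prop} (hD : IsDiscFamily φ D)
    (f : S → BrokenOrbit φ h x) {V O : Set M} (hV : IsOpen V) (hO : IsOpen O) (c : S)
    (hcV : (f c).carrier ⊆ V) (hcO : (f c).endpt ∈ O) :
    {d | (f d).carrier ⊆ V ∧ (f d).endpt ∈ O} ∈ @nhds S (sliceTopology D f) c := by
  let _ := sliceTopology D f
  obtain ⟨r, U, hU⟩ := (f c).exists_hasSlice hD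
  have hopen : IsOpen {d | (f d).carrier ⊆ V ∧ (f d).HasSlice D U ∧ (f d).endpt ∈ O} :=
    isOpen_generateFrom_of_mem ⟨c, V, O, r, U, hV, hcV, hO, hcO, hU, rfl⟩
  exact mem_of_superset (hopen.mem_nhds ⟨hcV, hU, hcO⟩) fun d hd => ⟨hd.1, hd.2.2⟩

theorem continuous_nonemptyCompacts [TopologicalSpace S] {g : S → NonemptyCompacts M}
    (h1 : ∀ V, IsOpen V → IsOpen {s | (g s : Set M) ⊆ V})
    (h2 : ∀ V, IsOpen V → IsOpen {s | ((g s : Set M) ∩ V).Nonempty}) : Continuous g := by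
  refine continuous_induced_rng.2 (continuous_generateFrom_iff.2 ?_)
  rintro _ (⟨V, hV, rfl⟩ | ⟨V, hV, rfl⟩)
  · exact h1 V hV
  · exact h2 V hV

/-- The slice topology is the one induced by the Vietoris topology: slices give no condition that
does not follow from the position of the points and of the end point. -/
theorem isInducing_toCompacts {D : Set M → Prop} (hD : IsDiscFamily φ D)
    (hfin : {p | ∀ t, φ t p = p}.Finite) (f : S → BrokenOrbit φ h x) :
    @IsInducing _ _ (sliceTopology D f) _ fun c => toCompacts (f c) := by
  let _ := sliceTopology D f
  have hmem := fun {V O : Set M} => mem_nhds_sliceTopology hD f (V := V) (O := O)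
  refine ⟨le_antisymm ?_ ?_⟩
  · rw [← continuous_iff_le_induced]
    refine Continuous.prodMk ?_ ?_
    · refine continuous_nonemptyCompacts (fun V hV => ?_) fun W hW => ?_
      · refine isOpen_iff_mem_nhds.2 fun c hc => ?_
        exact mem_of_superset (hmem hV isOpen_univ c hc (mem_univ _)) fun d hd => hd.1
      · refine isOpen_iff_mem_nhds.2 fun c hc => ?_
        obtain ⟨V, O, hV, hO, hcV, hcO, h'⟩ := (f c).exists_nhd_inter hfin hW hc
        exact mem_of_superset (hmem hV hO c hcV hcO) fun d hd => h' _ hd.1 hd.2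
    · refine continuous_def.2 fun O hO => isOpen_iff_mem_nhds.2 fun c hc => ?_
      exact mem_of_superset (hmem isOpen_univ hO c (subset_univ _) hc) fun d hd => hd.2
  · refine le_generateFrom ?_
    rintro _ ⟨c₀, V, O, r, U, hV, hc₀V, hO, hc₀O, hU, rfl⟩
    -- The sets that generate the slice topology are open: a slice remains one nearby.
    rw [@isOpen_iff_mem_nhds _ (induced _ _)]
    rintro c ⟨hcV, hcU, hcO⟩
    obtain ⟨V', O', hV', hO', hcV', hcO', h'⟩ := (f c).exists_nhd_hasSlice hfin hD hcU
    rw [nhds_induced, mem_comap]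
    refine ⟨{K : NonemptyCompacts M | (K : Set M) ⊆ V ∩ V'} ×ˢ (O ∩ O'), ?_, ?_⟩
    · refine IsOpen.mem_nhds ?_ ⟨subset_inter hcV hcV', hcO, hcO'⟩
      exact (NonemptyCompacts.isOpen_subsets_of_isOpen (hV.inter hV')).prod (hO.inter hO')
    · rintro d ⟨hd1, hd2⟩
      exact ⟨fun p hp => (hd1 hp).1, h' _ (fun p hp => (hd1 hp).2) hd2.2, hd2.1⟩

theorem isEmbedding_toCompacts [t : TopologicalSpace S] {D : Set M → Prop}
    (hD : IsDiscFamily φ D) (hfin : {p | ∀ t, φ t p = p}.Finite) {f : S → BrokenOrbit φ h x}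
    (ht : t = sliceTopology D f)
    (hinj : ∀ c d, (f c).carrier = (f d).carrier → (f c).endpt = (f d).endpt → c = d) :
    IsEmbedding fun c => toCompacts (f c) := by
  have hind := isInducing_toCompacts hD hfin f
  rw [← ht] at hind
  refine ⟨hind, fun c d hcd => hinj c d ?_ (congrArg Prod.snd hcd)⟩
  exact congrArg (fun K : NonemptyCompacts M × M => (K.1 : Set M)) hcd

end SliceTopology

/-! ### Levels of a Lyapunov function on a broken orbit -/

section Lyapunov

variable {M : Type*} [TopologicalSpace M] [T2Space M] {φ : Flow ℝ M} {h : M → ℤ} {x : M}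
  {F : M → ℝ}

namespace BrokenOrbit

theorem lt_of_tendsto_atBot (hFc : Continuous F)
    (hF : ∀ q, (¬ ∀ t, φ t q = q) → StrictMono fun t => F (φ t q)) {q a : M}
    (hq : ¬ ∀ t, φ t q = q) (ha : Tendsto (fun t => φ t q) atBot (𝓝 a)) : F a < F q := by
  have h1 : F a ≤ F (φ (-1) q) :=
    (hF q hq).monotone.le_of_tendsto ((hFc.tendsto a).comp ha) (-1)
  have h2 := hF q hq (show (-1 : ℝ) < 0 by norm_num)
  simp only [φ.map_zero_apply] at h2
  exact h1.trans_lt h2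

theorem lt_of_tendsto_atTop (hFc : Continuous F)
    (hF : ∀ q, (¬ ∀ t, φ t q = q) → StrictMono fun t => F (φ t q)) {q b : M}
    (hq : ¬ ∀ t, φ t q = q) (hb : Tendsto (fun t => φ t q) atTop (𝓝 b)) : F q < F b := by
  have h1 : F (φ 1 q) ≤ F b :=
    (hF q hq).monotone.ge_of_tendsto ((hFc.tendsto b).comp hb) 1
  have h2 := hF q hq (show (0 : ℝ) < 1 by norm_num)
  simp only [φ.map_zero_apply] at h2
  exact h2.trans_le h1

variable (c : BrokenOrbit φ h x)

theorem not_fixed_or_eq {i : Fin (c.len + 1)} {p : M} (hp : p ∈ c.piece i) :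
    p = c.pt i ∨ ¬ ∀ t, φ t p = p := by
  by_cases hfix : ∀ t, φ t p = p
  · refine Or.inl (tendsto_nhds_unique ?_ (c.tendsto_atBot_of_mem hp))
    simp only [hfix, tendsto_const_nhds]
  · exact Or.inr hfix

/-- The union of the whole trajectories of a broken orbit, with the last one not cut off. -/
def extended : Set M := range c.pt ∪ ⋃ i, c.piece i

theorem map_mem_extended {p : M} (hp : p ∈ c.extended) (t : ℝ) : φ t p ∈ c.extended := by
  rcases hp with ⟨i, rfl⟩ | hp
  · rw [c.fixed]; exact Or.inl ⟨i, rfl⟩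
  · obtain ⟨i, hi⟩ := mem_iUnion.1 hp
    refine Or.inr (mem_iUnion.2 ⟨i, ?_⟩)
    rw [c.piece_eq_of_mem hi]
    exact ⟨t, rfl⟩

theorem map_pt_strictMono (hFc : Continuous F)
    (hF : ∀ q, (¬ ∀ t, φ t q = q) → StrictMono fun t => F (φ t q)) : StrictMono (F ∘ c.pt) :=
  Fin.strictMono_iff_lt_succ.2 fun i =>
    have hi := c.not_fixed_of_mem (c.rep_mem_piece i.castSucc)
    (lt_of_tendsto_atBot hFc hF hi (c.tendsto_atBot _)).trans
      (lt_of_tendsto_atTop hFc hF hi (c.tendsto_atTop _))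

/-- A point of a broken orbit lies at a fixed point or on the following trajectory, below the level
of the next fixed point. -/
theorem exists_level (hFc : Continuous F)
    (hF : ∀ q, (¬ ∀ t, φ t q = q) → StrictMono fun t => F (φ t q)) {p : M}
    (hp : p ∈ c.extended) : ∃ i, (p = c.pt i ∨ p ∈ c.piece i ∧ F (c.pt i) < F p) ∧
      ∀ j, i < j → F p < F (c.pt j) := by
  have hmono := c.map_pt_strictMono hFc hF
  by_cases hpt : p ∈ range c.pt
  · obtain ⟨i, rfl⟩ := hpt
    exact ⟨i, Or.inl rfl, fun j hj => hmono hj⟩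
  · obtain ⟨i, hi⟩ := mem_iUnion.1 (hp.resolve_left hpt)
    have hnf := (c.not_fixed_or_eq hi).resolve_left fun he => hpt ⟨i, he.symm⟩
    refine ⟨i, Or.inr ⟨hi, lt_of_tendsto_atBot hFc hF hnf (c.tendsto_atBot_of_mem hi)⟩,
      fun j hj => ?_⟩
    induction i using Fin.lastCases with
    | last => exact absurd hj (Fin.le_last j).not_gt
    | cast i =>
      refine (lt_of_tendsto_atTop hFc hF hnf (c.tendsto_atTop_of_mem hi)).trans_le ?_
      exact hmono.monotone (Fin.castSucc_lt_iff_succ_le.1 hj)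

/-- A Lyapunov function is injective on a broken orbit. -/
theorem injOn_extended (hFc : Continuous F)
    (hF : ∀ q, (¬ ∀ t, φ t q = q) → StrictMono fun t => F (φ t q)) : InjOn F c.extended := by
  intro p hp q hq hpq
  obtain ⟨i, hi, hi'⟩ := c.exists_level hFc hF hp
  obtain ⟨j, hj, hj'⟩ := c.exists_level hFc hF hq
  have hle : ∀ {i : Fin (c.len + 1)} {p : M}, (p = c.pt i ∨ p ∈ c.piece i ∧ F (c.pt i) < F p) →
      F (c.pt i) ≤ F p := by
    rintro i p (rfl | hp)
    · exact le_rfl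
    · exact hp.2.le
  have hij : i = j := by
    rcases lt_trichotomy i j with h1 | h1 | h1
    · exact absurd ((hi' j h1).trans_le (hle hj)) (by rw [hpq]; exact lt_irrefl _)
    · exact h1
    · exact absurd ((hj' i h1).trans_le (hle hi)) (by rw [hpq]; exact lt_irrefl _)
  subst hij
  rcases hi with rfl | ⟨hi, hil⟩
  · rcases hj with rfl | ⟨hj, hjl⟩
    · rfl
    · exact absurd hpq hjl.ne
  · rcases hj with rfl | ⟨hj, hjl⟩
    · exact absurd hpq hil.ne'
    · have hnf := (c.not_fixed_or_eq hi).resolve_left fun he => hil.ne (by rw [he])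
      rw [c.piece_eq_of_mem hi] at hj
      obtain ⟨t, rfl⟩ := hj
      have h0 : F (φ 0 p) = F (φ t p) := by rw [φ.map_zero_apply]; exact hpq
      have : (0 : ℝ) = t := (hF p hnf).injective h0
      simp only [← this, φ.map_zero_apply]

theorem carrier_subset_extended : c.carrier ⊆ c.extended := c.carrier_subset_piece

/-- The end point cuts off the last trajectory at its level. -/
theorem mem_carrier_of_le
    (hF : ∀ q, (¬ ∀ t, φ t q = q) → StrictMono fun t => F (φ t q)) {p : M}
    (hp : p ∈ c.extended) (hle : F p ≤ F c.endpt) : p ∈ c.carrier := by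
  rcases hp with ⟨i, rfl⟩ | hp
  · exact c.pt_mem_carrier i
  · obtain ⟨i, hi⟩ := mem_iUnion.1 hp
    induction i using Fin.lastCases with
    | cast i => exact c.piece_subset_carrier i hi
    | last =>
      rcases c.not_fixed_or_eq (c.rep_mem_piece (Fin.last _)) with he | hnf
      · obtain ⟨t, rfl⟩ := hi
        simp only [he, c.fixed]
        exact c.pt_mem_carrier _
      · obtain ⟨t, rfl⟩ := hi
        refine Or.inr ⟨t, mem_Iic.2 ?_, rfl⟩
        by_contra! ht
        have := hF _ hnf ht
        simp only [φ.map_zero_apply] at this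
        exact absurd hle this.not_ge

theorem le_of_mem_carrier (hFc : Continuous F)
    (hF : ∀ q, (¬ ∀ t, φ t q = q) → StrictMono fun t => F (φ t q)) {p : M}
    (hp : p ∈ c.carrier) : F x ≤ F p ∧ F p ≤ F c.endpt := by
  have hmono := c.map_pt_strictMono hFc hF
  constructor
  · obtain ⟨i, hi, -⟩ := c.exists_level hFc hF (c.carrier_subset_extended hp)
    have h0 : F x ≤ F (c.pt i) := by
      have := hmono.monotone (Fin.zero_le i)
      rwa [Function.comp_apply, c.pt_zero] at this
    rcases hi with rfl | hi
    · exact h0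
    · exact h0.trans hi.2.le
  · have hlast : F (c.pt (Fin.last _)) ≤ F c.endpt := by
      rcases c.not_fixed_or_eq (c.rep_mem_piece (Fin.last _)) with he | hnf
      · exact (congrArg F he).symm.le
      · exact (lt_of_tendsto_atBot hFc hF hnf (c.tendsto_atBot _)).le
    rcases hp with (⟨i, rfl⟩ | hp) | ⟨t, ht, rfl⟩
    · exact (hmono.monotone (Fin.le_last i)).trans hlast
    · obtain ⟨i, hi⟩ := mem_iUnion.1 hp
      refine le_trans ?_ ((hmono.monotone (Fin.le_last i.succ)).trans hlast)
      exact (lt_of_tendsto_atTop hFc hF (c.not_fixed_of_mem hi) (c.tendsto_atTop_of_mem hi)).le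
    · rcases c.not_fixed_or_eq (c.rep_mem_piece (Fin.last _)) with he | hnf
      · simp only [endpt, he, c.fixed, le_refl]
      · have := (hF _ hnf).monotone (mem_Iic.1 ht)
        simp only [φ.map_zero_apply] at this
        exact this

theorem isPreconnected_carrier : IsPreconnected c.carrier := by
  set s : ℕ → Set M := fun k => if hk : k < c.len then c.arc ⟨k, hk⟩ else c.lastArc with hs
  have h1 : c.carrier = ⋃ k, s k := by
    rw [carrier_eq]
    ext p
    constructor
    · rintro (hp | hp)
      · obtain ⟨i, hi⟩ := mem_iUnion.1 hp
        exact mem_iUnion.2 ⟨i, by simpa [hs] using hi⟩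
      · exact mem_iUnion.2 ⟨c.len, by simpa [hs] using hp⟩
    · intro hp
      obtain ⟨k, hk⟩ := mem_iUnion.1 hp
      by_cases hkl : k < c.len
      · exact Or.inl (mem_iUnion.2 ⟨⟨k, hkl⟩, by simpa [hs, hkl] using hk⟩)
      · exact Or.inr (by simpa [hs, hkl] using hk)
  rw [h1]
  -- Consecutive arcs have a fixed point in common. The chain is indexed by all natural numbers,
  -- with the last arc repeated.
  refine IsPreconnected.iUnion_of_chain (fun k => ?_) fun k => ?_
  · by_cases hkl : k < c.len
    · simpa [hs, hkl] using c.isPreconnected_arc _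
    · simpa [hs, hkl] using c.isPreconnected_lastArc
  · by_cases hkl : k < c.len
    · refine ⟨c.pt (Fin.succ ⟨k, hkl⟩), ?_, ?_⟩
      · simp only [hs, hkl, dif_pos]
        exact c.mem_arc_iff.2 (Or.inr (Or.inl rfl))
      · by_cases hkl' : k + 1 < c.len
        · simp only [hs, Nat.succ_eq_succ, Nat.succ_eq_add_one, hkl', dif_pos]
          exact c.mem_arc_iff.2 (Or.inl rfl)
        · simp only [hs, Nat.succ_eq_succ, Nat.succ_eq_add_one, hkl', dif_neg, not_false_iff]
          have : Fin.succ ⟨k, hkl⟩ = Fin.last c.len := Fin.ext (by simp; omega)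
          rw [this]
          exact mem_insert _ _
    · refine ⟨c.pt (Fin.last _), ?_, ?_⟩
      · simp only [hs, hkl, dif_neg, not_false_iff]
        exact mem_insert _ _
      · have hkl' : ¬ k + 1 < c.len := by omega
        simp only [hs, Nat.succ_eq_succ, Nat.succ_eq_add_one, hkl', dif_neg, not_false_iff]
        exact mem_insert _ _

/-- The part of a broken orbit between two levels of a Lyapunov function is connected. -/
theorem isPreconnected_carrier_inter (hFc : Continuous F)
    (hF : ∀ q, (¬ ∀ t, φ t q = q) → StrictMono fun t => F (φ t q)) {p q : M}
    (hp : p ∈ c.carrier) (hq : q ∈ c.carrier) :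
    IsPreconnected (c.carrier ∩ F ⁻¹' (uIcc (F p) (F q))) := by
  have : CompactSpace c.carrier := isCompact_iff_compactSpace.1 c.isCompact_carrier
  set F' : c.carrier → ℝ := fun z => F z with hF'
  have hF'c : Continuous F' := hFc.comp continuous_subtype_val
  -- A Lyapunov function is a homeomorphism of the broken orbit onto an interval.
  have hinj : Function.Injective F' := fun z w hzw =>
    Subtype.ext (c.injOn_extended hFc hF (c.carrier_subset_extended z.2)
      (c.carrier_subset_extended w.2) hzw)
  have hrange : OrdConnected (range F') := by
    have : range F' = F '' c.carrier := by
      rw [hF', ← Function.comp_def, range_comp, Subtype.range_coe]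
    rw [this]
    exact (c.isPreconnected_carrier.image F hFc.continuousOn).ordConnected
  have h1 := (isPreconnected_uIcc (a := F p) (b := F q)).preimage_of_isClosedMap hinj
    hF'c.isClosedMap (hrange.uIcc_subset ⟨⟨p, hp⟩, rfl⟩ ⟨⟨q, hq⟩, rfl⟩)
  have h2 := h1.image Subtype.val continuous_subtype_val.continuousOn
  have h3 : Subtype.val '' (F' ⁻¹' uIcc (F p) (F q)) = c.carrier ∩ F ⁻¹' (uIcc (F p) (F q)) := by
    ext z
    constructor
    · rintro ⟨w, hw, rfl⟩; exact ⟨w.2, hw⟩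
    · rintro ⟨hz, hz'⟩; exact ⟨⟨z, hz⟩, hz', rfl⟩
  rwa [h3] at h2

end BrokenOrbit
end Lyapunov

/-! ### Limits of broken orbits -/

section Limits

open TopologicalSpace

variable {M : Type*} [TopologicalSpace M] [T2Space M] {φ : Flow ℝ M} {h : M → ℤ} {x : M}
  {F : M → ℝ} {ι : Type*}

/-- Each point of a limit of compact sets is the limit of points of these sets: take nearest points.
-/
theorem exists_selection [MetrizableSpace M] {l : Filter ι} {C : ι → NonemptyCompacts M}
    {K : NonemptyCompacts M} (hC : Tendsto C l (𝓝 K)) {p : M} (hp : p ∈ K) :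
    ∃ s : ι → M, (∀ ν, s ν ∈ C ν) ∧ Tendsto s l (𝓝 p) := by
  let _ := metrizableSpaceMetric M
  have hex : ∀ ν, ∃ s ∈ C ν, ∀ z ∈ C ν, dist s p ≤ dist z p := fun ν => by
    obtain ⟨s, hs, hmin⟩ := (C ν).isCompact.exists_isMinOn (C ν).nonempty
      (f := fun z => dist z p) (by fun_prop)
    exact ⟨s, hs, fun z hz => hmin hz⟩
  choose s hs hmin using hex
  refine ⟨s, hs, Metric.tendsto_nhds.2 fun ε hε => ?_⟩
  have h1 := hC.eventually ((NonemptyCompacts.isOpen_inter_nonempty_of_isOpen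
    (Metric.isOpen_ball (x := p) (ε := ε))).mem_nhds ⟨p, hp, Metric.mem_ball_self hε⟩)
  filter_upwards [h1] with ν hν
  obtain ⟨z, hz, hzp⟩ := hν
  exact (hmin ν z hz).trans_lt hzp

theorem mem_of_tendsto_nonemptyCompacts {l : Filter ι} [NeBot l] {C : ι → NonemptyCompacts M}
    {K : NonemptyCompacts M} (hC : Tendsto C l (𝓝 K)) {s : ι → M} (hs : ∀ᶠ ν in l, s ν ∈ C ν)
    {p : M} (hp : Tendsto s l (𝓝 p)) : p ∈ K := by
  by_contra hpK
  obtain ⟨V, W, hV, hW, hKV, hpW, hVW⟩ := SeparatedNhds.of_isCompact_isCompact K.isCompact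
    (isCompact_singleton (x := p)) (Set.disjoint_singleton_right.2 hpK)
  have h1 := hC.eventually ((NonemptyCompacts.isOpen_subsets_of_isOpen hV).mem_nhds hKV)
  have h2 := hp.eventually (hW.mem_nhds (hpW rfl))
  obtain ⟨ν, h1, h2, h3⟩ := (h1.and (h2.and hs)).exists
  exact Set.disjoint_left.1 hVW (h1 h3) h2

theorem exists_ultrafilter_limit [CompactSpace M] (𝒰 : Ultrafilter ι) (s : ι → M) :
    ∃ p, Tendsto s 𝒰 (𝓝 p) := by
  obtain ⟨p, -, hp⟩ := isCompact_univ.ultrafilter_le_nhds (𝒰.map s) (by simp)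
  exact ⟨p, hp⟩

variable {𝒰 : Ultrafilter ι} {c : ι → BrokenOrbit φ h x} {K : NonemptyCompacts M} {m : M}

theorem le_of_mem_limit [MetrizableSpace M] (hFc : Continuous F)
    (hF : ∀ q, (¬ ∀ t, φ t q = q) → StrictMono fun t => F (φ t q))
    (hK : Tendsto (fun ν => (toCompacts (c ν)).1) 𝒰 (𝓝 K))
    (hm : Tendsto (fun ν => (c ν).endpt) 𝒰 (𝓝 m)) {p : M} (hp : p ∈ K) :
    F x ≤ F p ∧ F p ≤ F m := by
  obtain ⟨s, hs, hsp⟩ := exists_selection hK hp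
  have h1 := fun ν => (c ν).le_of_mem_carrier hFc hF (hs ν)
  exact ⟨ge_of_tendsto' ((hFc.tendsto p).comp hsp) fun ν => (h1 ν).1,
    le_of_tendsto_of_tendsto' ((hFc.tendsto p).comp hsp) ((hFc.tendsto m).comp hm)
      fun ν => (h1 ν).2⟩

/-- A limit of broken orbits is invariant under the flow up to the level of its end point. Times at
which this level is attained are obtained from earlier times by continuity. -/
theorem map_mem_limit [MetrizableSpace M] (hFc : Continuous F)
    (hF : ∀ q, (¬ ∀ t, φ t q = q) → StrictMono fun t => F (φ t q))
    (hK : Tendsto (fun ν => (toCompacts (c ν)).1) 𝒰 (𝓝 K))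
    (hm : Tendsto (fun ν => (c ν).endpt) 𝒰 (𝓝 m)) {p : M} (hp : p ∈ K) {t : ℝ}
    (ht : t ≤ 0 ∨ F (φ t p) ≤ F m) : φ t p ∈ K := by
  by_cases hfix : ∀ t, φ t p = p
  · rwa [hfix]
  have hlt : ∀ t, F (φ t p) < F m → φ t p ∈ K := by
    intro t ht
    obtain ⟨s, hs, hsp⟩ := exists_selection hK hp
    have h1 : Tendsto (fun ν => φ t (s ν)) 𝒰 (𝓝 (φ t p)) :=
      ((φ.continuous continuous_const continuous_id).tendsto p).comp hsp
    refine mem_of_tendsto_nonemptyCompacts hK ?_ h1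
    filter_upwards [((hFc.tendsto _).comp h1).eventually_lt ((hFc.tendsto _).comp hm) ht]
      with ν hν
    exact (c ν).mem_carrier_of_le hF
      ((c ν).map_mem_extended ((c ν).carrier_subset_extended (hs ν)) t) (le_of_lt hν)
  have hle : F (φ t p) ≤ F m := by
    refine ht.elim (fun ht => ?_) id
    have h1 := (hF p hfix).monotone ht
    simp only [φ.map_zero_apply] at h1
    exact h1.trans (le_of_mem_limit hFc hF hK hm hp).2
  have hcl : IsClosed {t | φ t p ∈ K} :=
    K.isCompact.isClosed.preimage (IsFlowOf.continuous_time φ p)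
  have hsub : Iio t ⊆ {t | φ t p ∈ K} := fun r hr => hlt r ((hF p hfix hr).trans_le hle)
  exact hcl.closure_subset_iff.2 hsub (by rw [closure_Iio]; exact mem_Iic.2 le_rfl)

/-- On a limit of broken orbits, a point that is not fixed is determined by the value of a Lyapunov
function: nearby broken orbits contain a segment of trajectory through the point. -/
theorem eq_of_mem_limit_of_not_fixed [MetrizableSpace M] (hFc : Continuous F)
    (hF : ∀ q, (¬ ∀ t, φ t q = q) → StrictMono fun t => F (φ t q))
    (hK : Tendsto (fun ν => (toCompacts (c ν)).1) 𝒰 (𝓝 K)) {p q : M} (hp : p ∈ K) (hq : q ∈ K)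
    (hfix : ¬ ∀ t, φ t p = p) (hpq : F p = F q) : p = q := by
  obtain ⟨s, hs, hsp⟩ := exists_selection hK hp
  obtain ⟨s', hs', hsq⟩ := exists_selection hK hq
  have hlim : ∀ t, Tendsto (fun ν => F (φ t (s ν))) 𝒰 (𝓝 (F (φ t p))) := fun t =>
    ((hFc.comp (φ.continuous continuous_const continuous_id)).tendsto p).comp hsp
  have hlim' : Tendsto (fun ν => F (s' ν)) 𝒰 (𝓝 (F q)) := (hFc.tendsto q).comp hsq
  have h1 : F (φ (-1) p) < F q := by
    have := hF p hfix (show (-1 : ℝ) < 0 by norm_num)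
    simpa only [φ.map_zero_apply, hpq] using this
  have h2 : F q < F (φ 1 p) := by
    have := hF p hfix (show (0 : ℝ) < 1 by norm_num)
    simpa only [φ.map_zero_apply, hpq] using this
  -- Near the limit, the point `s' ν` is reached from `s ν` by the flow in time at most `1`.
  have hex : ∀ ν, ∃ t ∈ Icc (-1 : ℝ) 1, F (φ (-1) (s ν)) < F (s' ν) → F (s' ν) < F (φ 1 (s ν)) →
      φ t (s ν) = s' ν := by
    intro ν
    by_cases h3 : F (φ (-1) (s ν)) < F (s' ν) ∧ F (s' ν) < F (φ 1 (s ν))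
    · obtain ⟨t, ht, hte⟩ := intermediate_value_Icc (show (-1 : ℝ) ≤ 1 by norm_num)
        (hFc.comp (IsFlowOf.continuous_time φ (s ν))).continuousOn ⟨h3.1.le, h3.2.le⟩
      refine ⟨t, ht, fun _ _ => (c ν).injOn_extended hFc hF ?_ ?_ hte⟩
      · exact (c ν).map_mem_extended ((c ν).carrier_subset_extended (hs ν)) t
      · exact (c ν).carrier_subset_extended (hs' ν)
    · exact ⟨0, by norm_num, fun h4 h5 => absurd ⟨h4, h5⟩ h3⟩
  choose t ht hts using hex
  obtain ⟨t₀, -, ht₀⟩ := (isCompact_Icc (a := (-1 : ℝ)) (b := 1)).ultrafilter_le_nhds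
    (𝒰.map t) (le_principal_iff.2 (Ultrafilter.mem_map.2 (univ_mem' ht)))
  have h3 : Tendsto (fun ν => φ (t ν) (s ν)) 𝒰 (𝓝 (φ t₀ p)) :=
    ((φ.continuous continuous_fst continuous_snd).tendsto (t₀, p)).comp
      (Tendsto.prodMk_nhds (show Tendsto t 𝒰 (𝓝 t₀) from ht₀) hsp)
  have h4 : Tendsto (fun ν => φ (t ν) (s ν)) 𝒰 (𝓝 q) := by
    refine hsq.congr' ?_
    filter_upwards [(hlim (-1)).eventually_lt hlim' h1, hlim'.eventually_lt (hlim 1) h2]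
      with ν h5 h6
    exact (hts ν h5 h6).symm
  have h5 : q = φ t₀ p := tendsto_nhds_unique h4 h3
  have h6 : F (φ 0 p) = F (φ t₀ p) := by rw [φ.map_zero_apply, hpq, h5]
  have h7 : (0 : ℝ) = t₀ := (hF p hfix).injective h6
  rw [h5, ← h7, φ.map_zero_apply]

/-- A Lyapunov function is injective on a limit of broken orbits: between two fixed points on the
same level, connected segments of the broken orbits would have to cross a hypersurface that
separates one of them from all other fixed points, and in the limit there would be a point on this
level that is not fixed. -/
theorem injOn_limit [CompactSpace M] [MetrizableSpace M]
    (hfin : {p | ∀ t, φ t p = p}.Finite) (hFc : Continuous F)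
    (hF : ∀ q, (¬ ∀ t, φ t q = q) → StrictMono fun t => F (φ t q))
    (hK : Tendsto (fun ν => (toCompacts (c ν)).1) 𝒰 (𝓝 K)) : InjOn F (K : Set M) := by
  intro p hp q hq hpq
  by_contra hne
  have hfix : ∀ t, φ t p = p := by
    by_contra hfix
    exact hne (eq_of_mem_limit_of_not_fixed hFc hF hK hp hq hfix hpq)
  -- The set `W` is a neighbourhood of `p` without `q`, on whose frontier there are no fixed points.
  set T := insert q {p | ∀ t, φ t p = p} \ {p} with hT
  have hTc : IsClosed T := ((hfin.insert q).subset sdiff_subset).isClosed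
  obtain ⟨C, hC, hCc, hCT⟩ := exists_mem_nhds_isClosed_subset
    (hTc.isOpen_compl.mem_nhds (fun hpT => hpT.2 rfl : p ∉ T))
  set W := interior C with hW
  have hWC : closure W ⊆ C := closure_minimal interior_subset hCc
  have hpW : p ∈ W := mem_interior_iff_mem_nhds.2 hC
  have hqW : q ∉ closure W := fun hqW => hCT (hWC hqW) ⟨mem_insert _ _, fun h => hne h.symm⟩
  obtain ⟨s, hs, hsp⟩ := exists_selection hK hp
  obtain ⟨s', hs', hsq⟩ := exists_selection hK hq
  have hex : ∀ ν, ∃ z, s ν ∈ W → s' ν ∉ closure W →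
      z ∈ (c ν).carrier ∧ F z ∈ uIcc (F (s ν)) (F (s' ν)) ∧ z ∈ frontier W := by
    intro ν
    by_cases h1 : s ν ∈ W ∧ s' ν ∉ closure W
    · by_contra! hcon
      obtain ⟨z, -, hzW, hzW'⟩ := (c ν).isPreconnected_carrier_inter hFc hF (hs ν) (hs' ν) W
        (closure W)ᶜ isOpen_interior isClosed_closure.isOpen_compl (fun z hz => by
          by_contra hz'
          rw [mem_union, not_or, mem_compl_iff, not_not] at hz'
          refine (hcon z).2.2 hz.1 hz.2 ?_
          rw [isOpen_interior.frontier_eq]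
          exact ⟨hz'.2, hz'.1⟩)
        ⟨s ν, ⟨hs ν, left_mem_uIcc⟩, h1.1⟩ ⟨s' ν, ⟨hs' ν, right_mem_uIcc⟩, h1.2⟩
      exact hzW' (subset_closure hzW)
    · exact ⟨p, fun h2 h3 => absurd ⟨h2, h3⟩ h1⟩
  choose z hz using hex
  have hev : ∀ᶠ ν in (𝒰 : Filter ι),
      z ν ∈ (c ν).carrier ∧ F (z ν) ∈ uIcc (F (s ν)) (F (s' ν)) ∧ z ν ∈ frontier W := by
    filter_upwards [hsp.eventually (isOpen_interior.mem_nhds hpW),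
      hsq.eventually (isClosed_closure.isOpen_compl.mem_nhds hqW)] with ν h1 h2
    exact hz ν h1 h2
  -- The limit of these points of the frontier is on the level of `p` and `q`.
  obtain ⟨z₀, hz₀⟩ := exists_ultrafilter_limit 𝒰 z
  have hz₀K : z₀ ∈ K := mem_of_tendsto_nonemptyCompacts hK (hev.mono fun ν h => h.1) hz₀
  have hz₀W : z₀ ∈ frontier W :=
    isClosed_frontier.mem_of_tendsto hz₀ (hev.mono fun ν h => h.2.2)
  have hz₀F : F z₀ = F p := by
    have h1 : Tendsto (fun ν => F (s ν)) 𝒰 (𝓝 (F p)) := (hFc.tendsto p).comp hsp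
    have h2 : Tendsto (fun ν => F (s' ν)) 𝒰 (𝓝 (F p)) := hpq ▸ (hFc.tendsto q).comp hsq
    have h3 := h1.min h2
    have h4 := h1.max h2
    rw [min_self] at h3
    rw [max_self] at h4
    exact tendsto_nhds_unique ((hFc.tendsto z₀).comp hz₀)
      (tendsto_of_tendsto_of_tendsto_of_le_of_le' h3 h4 (hev.mono fun ν h => h.2.1.1)
        (hev.mono fun ν h => h.2.1.2))
  have hz₀p : z₀ ≠ p := fun h => by
    rw [h, isOpen_interior.frontier_eq] at hz₀W
    exact hz₀W.2 hpW
  have hz₀fix : ¬ ∀ t, φ t z₀ = z₀ := fun hfix' =>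
    hCT (hWC (frontier_subset_closure hz₀W)) ⟨mem_insert_of_mem _ hfix', hz₀p⟩
  exact hz₀p (eq_of_mem_limit_of_not_fixed hFc hF hK hz₀K hp hz₀fix hz₀F)

/-- The values of the function on a limit of broken orbits fill the interval between the values at
`x` and at the end point. -/
theorem exists_mem_limit [CompactSpace M] [MetrizableSpace M] (hFc : Continuous F)
    (hK : Tendsto (fun ν => (toCompacts (c ν)).1) 𝒰 (𝓝 K))
    (hm : Tendsto (fun ν => (c ν).endpt) 𝒰 (𝓝 m)) (hx : x ∈ K) (hmK : m ∈ K) {v : ℝ}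
    (hv : v ∈ Icc (F x) (F m)) : ∃ p ∈ K, F p = v := by
  rcases hv.1.eq_or_lt with rfl | hxv
  · exact ⟨x, hx, rfl⟩
  rcases hv.2.eq_or_lt with rfl | hvm
  · exact ⟨m, hmK, rfl⟩
  have hex : ∀ ν, ∃ z, v < F (c ν).endpt → z ∈ (c ν).carrier ∧ F z = v := by
    intro ν
    by_cases h1 : v < F (c ν).endpt
    · have hxc : x ∈ (c ν).carrier := by
        have := (c ν).pt_mem_carrier 0
        rwa [(c ν).pt_zero] at this
      obtain ⟨z, hz, hzv⟩ := (c ν).isPreconnected_carrier.intermediate_value hxc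
        (c ν).endpt_mem_carrier hFc.continuousOn ⟨hxv.le, h1.le⟩
      exact ⟨z, fun _ => ⟨hz, hzv⟩⟩
    · exact ⟨x, fun h2 => absurd h2 h1⟩
  choose z hz using hex
  have hev : ∀ᶠ ν in (𝒰 : Filter ι), z ν ∈ (c ν).carrier ∧ F (z ν) = v := by
    filter_upwards [((hFc.tendsto m).comp hm).eventually (lt_mem_nhds hvm)] with ν h1
    exact hz ν h1
  obtain ⟨z₀, hz₀⟩ := exists_ultrafilter_limit 𝒰 z
  refine ⟨z₀, mem_of_tendsto_nonemptyCompacts hK (hev.mono fun ν h => h.1) hz₀, ?_⟩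
  exact tendsto_nhds_unique ((hFc.tendsto z₀).comp hz₀)
    (tendsto_const_nhds.congr' (hev.mono fun ν h => h.2.symm))

theorem exists_enumeration {C : Set M} (hC : C.Finite) (hne : C.Nonempty) (hF : InjOn F C) :
    ∃ (N : ℕ) (pt : Fin (N + 1) → M), StrictMono (F ∘ pt) ∧ range pt = C := by
  classical
  set A := hC.toFinset.image F with hA
  have hAne : A.Nonempty := by simpa [hA] using hne
  obtain ⟨N, hN⟩ : ∃ N, A.card = N + 1 := ⟨A.card - 1, by have := hAne.card_pos; omega⟩
  have hex : ∀ i, ∃ p ∈ C, F p = A.orderEmbOfFin hN i := fun i => by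
    have := A.orderEmbOfFin_mem hN i
    obtain ⟨p, hp, hpe⟩ := Finset.mem_image.1 this
    exact ⟨p, hC.mem_toFinset.1 hp, hpe⟩
  choose pt hpt hFpt using hex
  refine ⟨N, pt, fun i j hij => ?_, Subset.antisymm ?_ fun p hp => ?_⟩
  · rw [Function.comp_apply, Function.comp_apply, hFpt, hFpt]
    exact (A.orderEmbOfFin hN).strictMono hij
  · rintro _ ⟨i, rfl⟩; exact hpt i
  · have : F p ∈ range (A.orderEmbOfFin hN) := by
      rw [Finset.range_orderEmbOfFin]
      simpa [hA] using ⟨p, hp, rfl⟩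
    obtain ⟨i, hi⟩ := this
    exact ⟨i, hF (hpt i) hp (by rw [hFpt, hi])⟩

/-- A trajectory in a compact set on which the Lyapunov function is injective converges. -/
theorem exists_tendsto_of_injOn {K : Set M} (hKc : IsCompact K) (hFc : Continuous F)
    (hinj : InjOn F K) {l : Filter ℝ} [NeBot l] (hl : ∀ s, Tendsto (fun t => s + t) l l) {q : M}
    (hq : ∀ᶠ t in l, φ t q ∈ K) {L : ℝ} (hL : Tendsto (fun t => F (φ t q)) l (𝓝 L)) :
    ∃ z ∈ K, (∀ t, φ t z = z) ∧ Tendsto (fun t => φ t q) l (𝓝 z) := by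
  have hFL : ∀ z, MapClusterPt z l (fun t => φ t q) → F z = L := fun z hz =>
    eq_of_nhds_neBot (ClusterPt.mono (hz.continuousAt_comp hFc.continuousAt) hL)
  obtain ⟨z, hz, hzc⟩ := hKc.exists_mapClusterPt_of_frequently hq.frequently
  have hlim : Tendsto (fun t => φ t q) l (𝓝 z) :=
    hKc.tendsto_nhds_of_unique_mapClusterPt hq fun y hy hyc =>
      hinj hy hz ((hFL y hyc).trans (hFL z hzc).symm)
  refine ⟨z, hz, fun s => ?_, hlim⟩
  refine tendsto_nhds_unique (((φ.continuous continuous_const continuous_id).tendsto z).comp hlim)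
    ((hlim.comp (hl s)).congr fun t => ?_)
  exact φ.map_add s t q

end Limits

/-! ### Compactness -/

section Compactness

open TopologicalSpace

variable {M : Type*} [TopologicalSpace M] [T2Space M] [CompactSpace M] [MetrizableSpace M]
  {φ : Flow ℝ M} {h : M → ℤ} {x : M} {F : M → ℝ} {ι : Type*} {𝒰 : Ultrafilter ι}
  {c : ι → BrokenOrbit φ h x} {K : NonemptyCompacts M} {m : M}

/-- A compact set that is invariant under the flow up to the level of `m`, and on which a Lyapunov
function is injective with all values between those at `x` and at `m`, is a broken orbit. -/
theorem exists_brokenOrbit (hfin : {p | ∀ t, φ t p = p}.Finite) (hFc : Continuous F)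
    (hF : ∀ q, (¬ ∀ t, φ t q = q) → StrictMono fun t => F (φ t q))
    (hh : ∀ u a b, (¬ ∀ t, φ t u = u) → Tendsto (fun t => φ t u) atBot (𝓝 a) →
      Tendsto (fun t => φ t u) atTop (𝓝 b) → h a < h b) {K : Set M} (hK : IsCompact K)
    (hxfix : ∀ t, φ t x = x) (hx : x ∈ K) (hm : m ∈ K)
    (hle : ∀ p ∈ K, F x ≤ F p ∧ F p ≤ F m)
    (hinv : ∀ p ∈ K, ∀ t, t ≤ 0 ∨ F (φ t p) ≤ F m → φ t p ∈ K) (hinj : InjOn F K)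
    (hsurj : ∀ v ∈ Icc (F x) (F m), ∃ p ∈ K, F p = v) :
    ∃ c : BrokenOrbit φ h x, c.carrier = K ∧ c.endpt = m := by
  set C := K ∩ {p | ∀ t, φ t p = p} with hC
  obtain ⟨N, pt, hmono, hrange⟩ := exists_enumeration (F := F) (hfin.subset inter_subset_right :
    C.Finite) ⟨x, hx, hxfix⟩ (hinj.mono inter_subset_left)
  have hptC : ∀ i, pt i ∈ C := fun i => hrange ▸ mem_range_self i
  have hpt0 : pt 0 = x := by
    obtain ⟨i, hi⟩ : x ∈ range pt := hrange ▸ ⟨hx, hxfix⟩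
    have h1 := hmono.monotone (Fin.zero_le i)
    simp only [Function.comp_apply, hi] at h1
    exact hinj (hptC 0).1 hx (le_antisymm h1 (hle _ (hptC 0).1).1)
  -- A point that is not fixed is not on the level of a fixed point.
  have hlevel : ∀ p ∈ K, (¬ ∀ t, φ t p = p) → ∀ i, F p ≠ F (pt i) := fun p hp hpf i he =>
    hpf (hinj hp (hptC i).1 he ▸ (hptC i).2)
  have hfix' : ∀ {p : M} {t : ℝ}, (¬ ∀ t, φ t p = p) → ¬ ∀ r, φ r (φ t p) = φ t p := by
    intro p t hp hfix
    refine hp fun r => ?_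
    have h1 : φ (-t) (φ t p) = p := by rw [← φ.map_add, neg_add_cancel, φ.map_zero_apply]
    rw [hfix] at h1
    have h2 := hfix r
    rwa [h1] at h2
  have hbd : ∀ q, BddAbove (range fun t => F (φ t q)) ∧ BddBelow (range fun t => F (φ t q)) :=
    fun q => ⟨(isCompact_range hFc).bddAbove.mono (by rintro _ ⟨t, rfl⟩; exact ⟨_, rfl⟩),
      (isCompact_range hFc).bddBelow.mono (by rintro _ ⟨t, rfl⟩; exact ⟨_, rfl⟩)⟩
  -- A trajectory in `K` cannot cross the level of a fixed point in `K`, hence comes from the fixed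
  -- point just below it.
  have hbot : ∀ p ∈ K, (¬ ∀ t, φ t p = p) → ∀ i, F (pt i) < F p → (∀ j, i < j → F p < F (pt j)) →
      Tendsto (fun t => φ t p) atBot (𝓝 (pt i)) := by
    intro p hp hpf i hip hpj
    obtain ⟨z, hz, hzf, hzt⟩ := exists_tendsto_of_injOn hK hFc hinj (l := atBot)
      (fun s => tendsto_atBot_add_const_left _ s tendsto_id)
      ((eventually_le_atBot 0).mono fun t ht => hinv p hp t (Or.inl ht))
      (tendsto_atBot_ciInf (hF p hpf).monotone (hbd p).2)
    obtain ⟨j, rfl⟩ : z ∈ range pt := hrange ▸ ⟨hz, hzf⟩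
    have h1 := BrokenOrbit.lt_of_tendsto_atBot hFc hF hpf hzt
    rcases lt_trichotomy j i with hji | rfl | hij
    · exfalso
      have h2 : F (pt j) < F (pt i) := hmono hji
      obtain ⟨T, hT, hT0⟩ := ((((hFc.tendsto _).comp hzt).eventually (gt_mem_nhds h2)).and
        (eventually_le_atBot 0)).exists
      obtain ⟨t, ht, hte⟩ := intermediate_value_Icc hT0
        (hFc.comp (IsFlowOf.continuous_time φ p)).continuousOn
        (show F (pt i) ∈ Icc (F (φ T p)) (F (φ 0 p)) from
          ⟨le_of_lt hT, by rw [φ.map_zero_apply]; exact hip.le⟩)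
      exact hlevel _ (hinv p hp t (Or.inl ht.2)) (hfix' hpf) i hte
    · exact hzt
    · exact absurd h1 (hpj j hij).not_gt
  -- The point of `K` at the middle level between consecutive fixed points lies on a trajectory from
  -- one to the other.
  have hrep : ∀ i : Fin N, ∃ p ∈ K, (∀ t, φ t p ∈ K) ∧ (¬ ∀ t, φ t p = p) ∧
      Tendsto (fun t => φ t p) atBot (𝓝 (pt i.castSucc)) ∧
      Tendsto (fun t => φ t p) atTop (𝓝 (pt i.succ)) := by
    intro i
    have hlt : F (pt i.castSucc) < F (pt i.succ) := hmono Fin.castSucc_lt_succ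
    have h1 := hle _ (hptC i.castSucc).1
    have h2 := hle _ (hptC i.succ).1
    obtain ⟨p, hp, hpv⟩ := hsurj ((F (pt i.castSucc) + F (pt i.succ)) / 2)
      ⟨by linarith, by linarith⟩
    have hp1 : F (pt i.castSucc) < F p := by linarith
    have hp2 : F p < F (pt i.succ) := by linarith
    have hpf : ¬ ∀ t, φ t p = p := by
      intro hpf
      obtain ⟨j, rfl⟩ : p ∈ range pt := hrange ▸ ⟨hp, hpf⟩
      have h3 := hmono.lt_iff_lt.1 hp1
      have h4 := hmono.lt_iff_lt.1 hp2
      exact absurd h4 (Fin.castSucc_lt_iff_succ_le.1 h3).not_gt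
    have hlt' : ∀ t, F (φ t p) < F (pt i.succ) := by
      intro t
      by_contra! ht
      have ht0 : 0 ≤ t := by
        by_contra! ht0
        have h3 := hF p hpf ht0
        simp only [φ.map_zero_apply] at h3
        linarith
      obtain ⟨r, hr, hre⟩ := intermediate_value_Icc ht0
        (hFc.comp (IsFlowOf.continuous_time φ p)).continuousOn
        (show F (pt i.succ) ∈ Icc (F (φ 0 p)) (F (φ t p)) from
          ⟨by rw [φ.map_zero_apply]; exact hp2.le, ht⟩)
      exact hlevel _ (hinv p hp r (Or.inr (hre.le.trans h2.2))) (hfix' hpf) i.succ hre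
    have hpK : ∀ t, φ t p ∈ K := fun t => hinv p hp t (Or.inr ((hlt' t).le.trans h2.2))
    refine ⟨p, hp, hpK, hpf, hbot p hp hpf _ hp1 fun j hj =>
      hp2.trans_le (hmono.monotone (Fin.castSucc_lt_iff_succ_le.1 hj)), ?_⟩
    obtain ⟨z, hz, hzf, hzt⟩ := exists_tendsto_of_injOn hK hFc hinj (l := atTop)
      (fun s => tendsto_atTop_add_const_left _ s tendsto_id) (Eventually.of_forall hpK)
      (tendsto_atTop_ciSup (hF p hpf).monotone (hbd p).1)
    obtain ⟨j, rfl⟩ : z ∈ range pt := hrange ▸ ⟨hz, hzf⟩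
    have h3 := BrokenOrbit.lt_of_tendsto_atTop hFc hF hpf hzt
    have h4 : F (pt j) ≤ F (pt i.succ) :=
      le_of_tendsto' ((hFc.tendsto _).comp hzt) fun t => (hlt' t).le
    have h5 : i.castSucc < j := hmono.lt_iff_lt.1 (hp1.trans h3)
    have h6 : j ≤ i.succ := hmono.le_iff_le.1 h4
    rwa [le_antisymm h6 (Fin.castSucc_lt_iff_succ_le.1 h5)] at hzt
  choose rep hrepK hrepK' hrepf hrepb hrept using hrep
  have hmbot : Tendsto (fun t => φ t m) atBot (𝓝 (pt (Fin.last N))) := by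
    by_cases hmf : ∀ t, φ t m = m
    · obtain ⟨j, hj⟩ : m ∈ range pt := hrange ▸ ⟨hm, hmf⟩
      have h1 : F (pt (Fin.last N)) ≤ F (pt j) := hj ▸ (hle _ (hptC _).1).2
      have h2 : j = Fin.last N := le_antisymm (Fin.le_last _) (hmono.le_iff_le.1 h1)
      simp only [hmf, ← h2, hj, tendsto_const_nhds]
    · exact hbot m hm hmf _ ((hle _ (hptC _).1).2.lt_of_ne (hlevel m hm hmf _).symm)
        fun j hj => absurd hj (Fin.le_last j).not_gt
  let b : BrokenOrbit φ h x :=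
    { len := N
      pt := pt
      rep := Fin.snoc (α := fun _ => M) rep m
      fixed := fun i => (hptC i).2
      pt_zero := hpt0
      strictMono := Fin.strictMono_iff_lt_succ.2 fun i => hh (rep i) _ _ (hrepf i) (hrepb i)
        (hrept i)
      tendsto_atBot := fun i => by
        induction i using Fin.lastCases with
        | last => rw [Fin.snoc_last]; exact hmbot
        | cast i => rw [Fin.snoc_castSucc]; exact hrepb i
      tendsto_atTop := fun i => by rw [Fin.snoc_castSucc]; exact hrept i }
  have hbe : b.endpt = m := Fin.snoc_last (α := fun _ => M) m rep
  have hsub : b.carrier ⊆ K := by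
    rintro p ((⟨i, rfl⟩ | hp) | ⟨t, ht, rfl⟩)
    · exact (hptC i).1
    · obtain ⟨i, t, rfl⟩ := mem_iUnion.1 hp
      have he : b.rep i.castSucc = rep i := Fin.snoc_castSucc (α := fun _ => M) m rep i
      simp only [he]
      exact hrepK' i t
    · simp only [hbe]
      exact hinv m hm t (Or.inl ht)
  refine ⟨b, Subset.antisymm hsub fun p hp => ?_, hbe⟩
  have hxb : x ∈ b.carrier := hpt0 ▸ b.pt_mem_carrier 0
  -- The broken orbit attains all levels of `K`, on which the function is injective.
  obtain ⟨z, hz, hzp⟩ := b.isPreconnected_carrier.intermediate_value hxb b.endpt_mem_carrier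
    hFc.continuousOn (show F p ∈ Icc (F x) (F b.endpt) from hbe ▸ hle p hp)
  rwa [← hinj (hsub hz) hp hzp]

/-- With a Lyapunov function, limits of broken orbits are broken orbits. -/
theorem exists_eq_limit (hfin : {p | ∀ t, φ t p = p}.Finite) (hFc : Continuous F)
    (hF : ∀ q, (¬ ∀ t, φ t q = q) → StrictMono fun t => F (φ t q))
    (hh : ∀ u a b, (¬ ∀ t, φ t u = u) → Tendsto (fun t => φ t u) atBot (𝓝 a) →
      Tendsto (fun t => φ t u) atTop (𝓝 b) → h a < h b) (hxfix : ∀ t, φ t x = x)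
    (hlim : Tendsto (fun ν => toCompacts (c ν)) 𝒰 (𝓝 (K, m))) :
    ∃ b : BrokenOrbit φ h x, b.carrier = K ∧ b.endpt = m := by
  have hK : Tendsto (fun ν => (toCompacts (c ν)).1) 𝒰 (𝓝 K) :=
    (continuous_fst.tendsto _).comp hlim
  have hm : Tendsto (fun ν => (c ν).endpt) 𝒰 (𝓝 m) := (continuous_snd.tendsto _).comp hlim
  have hxK : x ∈ K := mem_of_tendsto_nonemptyCompacts hK (s := fun _ => x)
    (Eventually.of_forall fun ν => by
      have := (c ν).pt_mem_carrier 0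
      rwa [(c ν).pt_zero] at this) tendsto_const_nhds
  have hmK : m ∈ K := mem_of_tendsto_nonemptyCompacts hK
    (Eventually.of_forall fun ν => (c ν).endpt_mem_carrier) hm
  exact exists_brokenOrbit hfin hFc hF hh K.isCompact hxfix hxK hmK
    (fun p hp => le_of_mem_limit hFc hF hK hm hp)
    (fun p hp t ht => map_mem_limit hFc hF hK hm hp ht) (injOn_limit hfin hFc hF hK)
    fun v hv => exists_mem_limit hFc hK hm hxK hmK hv

/-- With a Lyapunov function, a space of broken orbits that has the topology induced from compact
sets and contains each broken orbit, up to the choice of points on its trajectories, is compact. -/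
theorem compactSpace_of_isInducing {S : Type*} [TopologicalSpace S] {f : S → BrokenOrbit φ h x}
    (hf : IsInducing fun s => toCompacts (f s))
    (hsurj : ∀ b : BrokenOrbit φ h x, ∃ s, (f s).carrier = b.carrier ∧ (f s).endpt = b.endpt)
    (hfin : {p | ∀ t, φ t p = p}.Finite) (hFc : Continuous F)
    (hF : ∀ q, (¬ ∀ t, φ t q = q) → StrictMono fun t => F (φ t q))
    (hh : ∀ u a b, (¬ ∀ t, φ t u = u) → Tendsto (fun t => φ t u) atBot (𝓝 a) →
      Tendsto (fun t => φ t u) atTop (𝓝 b) → h a < h b) (hxfix : ∀ t, φ t x = x) :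
    CompactSpace S := by
  refine ⟨isCompact_iff_ultrafilter_le_nhds.2 fun 𝒰 _ => ?_⟩
  obtain ⟨⟨K, m⟩, hKm⟩ := exists_ultrafilter_limit 𝒰 fun s => toCompacts (f s)
  obtain ⟨b, hbK, hbm⟩ := exists_eq_limit hfin hFc hF hh hxfix hKm
  obtain ⟨s, hsK, hsm⟩ := hsurj b
  have he : toCompacts (f s) = (K, m) :=
    Prod.ext (NonemptyCompacts.ext (hsK.trans hbK)) (hsm.trans hbm)
  refine ⟨s, mem_univ s, ?_⟩
  have h1 : Tendsto (fun s : S => s) 𝒰 (𝓝 s) := hf.tendsto_nhds_iff.2 (by rw [he]; exact hKm)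
  exact h1

end Compactness

/-! ### The completed unstable set -/

section CompletedSpaces

variable {n : ℕ} {M : Type*} [TopologicalSpace M] [ChartedSpace (EuclideanSpace ℝ (Fin n)) M]
  {X : (m : M) → TangentSpace (𝓡 n) m} {φ : Flow ℝ M} {x y : M}

theorem IsFlowOf.orbitOn_eq (hφ : IsFlowOf φ X) (m : M) (S : Set ℝ) :
    orbitOn X m S = (fun t => φ t m) '' S := by
  ext p
  constructor
  · rintro ⟨γ, hγ, rfl, t, ht, rfl⟩
    exact ⟨t, ht, (hφ.unique γ hγ t).symm⟩
  · rintro ⟨t, ht, rfl⟩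
    exact ⟨fun t => φ t m, hφ.integral m, φ.map_zero_apply m, t, ht, rfl⟩

theorem IsFlowOf.mem_limitSet_iff (hφ : IsFlowOf φ X) {l : Filter ℝ} {m : M} :
    m ∈ limitSet X l x ↔ Tendsto (fun t => φ t m) l (𝓝 x) := by
  constructor
  · rintro ⟨γ, hγ, rfl, h⟩
    exact h.congr fun t => hφ.unique γ hγ t
  · intro h
    exact ⟨fun t => φ t m, hφ.integral m, φ.map_zero_apply m, h⟩

namespace Instanton

/-- A point on an instanton. -/
def point (γ : Instanton X x y) : M := (Quotient.out γ).toFun 0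

theorem image_eq_range (hφ : IsFlowOf φ X) (γ : Instanton X x y) :
    γ.image = range fun t => φ t γ.point := by
  have h1 : γ.image = range (Quotient.out γ).toFun := by
    conv_lhs => rw [← Quotient.out_eq γ]
    rfl
  rw [h1]
  exact congrArg range (funext fun t => hφ.unique _ (Quotient.out γ).integral t)

theorem tendsto_atBot_point (hφ : IsFlowOf φ X) (γ : Instanton X x y) :
    Tendsto (fun t => φ t γ.point) atBot (𝓝 x) :=
  (Quotient.out γ).tendsto_atBot.congr fun t => hφ.unique _ (Quotient.out γ).integral t

theorem tendsto_atTop_point (hφ : IsFlowOf φ X) (γ : Instanton X x y) :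
    Tendsto (fun t => φ t γ.point) atTop (𝓝 y) :=
  (Quotient.out γ).tendsto_atTop.congr fun t => hφ.unique _ (Quotient.out γ).integral t

theorem image_injective (hφ : IsFlowOf φ X) :
    Function.Injective (image : Instanton X x y → Set M) := by
  intro γ δ
  induction γ using Quotient.inductionOn with | _ γ => ?_
  induction δ using Quotient.inductionOn with | _ δ => ?_
  intro h
  have h' : range γ.toFun = range δ.toFun := h
  obtain ⟨a, ha⟩ : δ.toFun 0 ∈ range γ.toFun := h' ▸ mem_range_self 0
  refine Quotient.sound ⟨a, fun t => ?_⟩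
  rw [hφ.unique _ δ.integral, ← ha, hφ.unique _ γ.integral a, ← φ.map_add,
    ← hφ.unique _ γ.integral]

/-- The instanton through a point with the right limits. -/
def ofPoint (hφ : IsFlowOf φ X) (p : M) (hx : Tendsto (fun t => φ t p) atBot (𝓝 x))
    (hy : Tendsto (fun t => φ t p) atTop (𝓝 y)) : Instanton X x y :=
  Quotient.mk _ ⟨fun t => φ t p, hφ.integral p, hx, hy⟩

end Instanton

theorem BrokenInstanton.eq_of_pieces_eq (hφ : IsFlowOf φ X) {c d : BrokenInstanton X x y}
    (hl : c.len = d.len) (hpt : ∀ i, c.pt i = d.pt (Fin.cast (by rw [hl]) i))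
    (hp : ∀ i, c.pieces i = d.pieces (Fin.cast hl i)) : c = d := by
  obtain ⟨len, pt, _, _, _, inst⟩ := c
  obtain ⟨len', pt', _, _, _, inst'⟩ := d
  simp only at hl
  subst hl
  have hpt' : pt = pt' := funext hpt
  subst hpt'
  have hinst : inst = inst' := funext fun i => Instanton.image_injective hφ (hp i)
  subst hinst
  rfl

variable [IsManifold (𝓡 n) 1 M]

theorem BrokenInstanton.Descending.strictMono {c : BrokenInstanton X x y} (hc : c.Descending) :
    StrictMono ((fun p => -(index X p : ℤ)) ∘ c.pt) :=
  Fin.strictMono_iff_lt_succ.2 fun i => by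
    have := hc i
    simp only [Function.comp_apply]
    omega

variable [IsManifold (𝓡 n) ∞ M]

/-- An element of the completed unstable set as a broken orbit. -/
def UnstableHat.toBrokenOrbit (hφ : IsFlowOf φ X) (c : UnstableHat X x) :
    BrokenOrbit φ (fun p => -(index X p : ℤ)) x where
  len := c.chain.len
  pt := c.chain.pt
  rep := Fin.snoc (α := fun _ => M) (fun i => (c.chain.inst i).point) c.endpt
  fixed i t := hφ.apply_rest (c.chain.rest i) t
  pt_zero := c.chain.pt_zero
  strictMono := c.desc.strictMono
  tendsto_atBot i := by
    induction i using Fin.lastCases with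
    | last =>
      rw [Fin.snoc_last, c.chain.pt_last]
      exact hφ.mem_limitSet_iff.1 c.mem
    | cast i =>
      rw [Fin.snoc_castSucc]
      exact (c.chain.inst i).tendsto_atBot_point hφ
  tendsto_atTop i := by
    rw [Fin.snoc_castSucc]
    exact (c.chain.inst i).tendsto_atTop_point hφ

namespace UnstableHat

theorem endpt_toBrokenOrbit (hφ : IsFlowOf φ X) (c : UnstableHat X x) :
    (c.toBrokenOrbit hφ).endpt = c.endpt :=
  Fin.snoc_last (n := c.chain.len) (α := fun _ => M) c.endpt fun i => (c.chain.inst i).point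

theorem piece_toBrokenOrbit (hφ : IsFlowOf φ X) (c : UnstableHat X x) :
    (c.toBrokenOrbit hφ).piece =
      Fin.snoc (α := fun _ => Set M) c.chain.pieces (orbitOn X c.endpt univ) := by
  funext i
  induction i using Fin.lastCases with
  | last =>
    refine Eq.trans ?_ (Fin.snoc_last (n := c.chain.len) (α := fun _ => Set M)
      (orbitOn X c.endpt univ) c.chain.pieces).symm
    rw [hφ.orbitOn_eq, image_univ]
    exact congrArg (fun p => range fun t => φ t p) (c.endpt_toBrokenOrbit hφ)
  | cast i =>
    have h1 : (c.toBrokenOrbit hφ).rep i.castSucc = (c.chain.inst i).point :=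
      Fin.snoc_castSucc (n := c.chain.len) (α := fun _ => M) c.endpt
        (fun i => (c.chain.inst i).point) i
    rw [BrokenOrbit.piece, h1, ← Instanton.image_eq_range hφ]
    exact (Fin.snoc_castSucc (n := c.chain.len) (α := fun _ => Set M)
      (orbitOn X c.endpt univ) c.chain.pieces i).symm

theorem carrier_toBrokenOrbit (hφ : IsFlowOf φ X) (c : UnstableHat X x) :
    (c.toBrokenOrbit hφ).carrier = c.carrier := by
  have h1 : ∀ i : Fin c.chain.len, (c.toBrokenOrbit hφ).piece i.castSucc = c.chain.pieces i :=
    fun i => by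
      rw [piece_toBrokenOrbit]
      exact Fin.snoc_castSucc (n := c.chain.len) (α := fun _ => Set M)
        (orbitOn X c.endpt univ) c.chain.pieces i
  have h2 : (⋃ i : Fin (c.toBrokenOrbit hφ).len, (c.toBrokenOrbit hφ).piece i.castSucc) =
      ⋃ i, c.chain.pieces i := iUnion_congr h1
  rw [BrokenOrbit.carrier, h2, endpt_toBrokenOrbit, carrier, BrokenInstanton.carrier,
    hφ.orbitOn_eq]
  rfl

theorem hasSlice_toBrokenOrbit (hφ : IsFlowOf φ X) (c : UnstableHat X x) {r : ℕ}
    {U : Fin r → Set M} :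
    (c.toBrokenOrbit hφ).HasSlice (IsTransversalDisc X) U ↔ c.HasSlice U := by
  rw [BrokenOrbit.HasSlice, piece_toBrokenOrbit]
  rfl

/-- The transversal slice topology of the completed unstable set is the one of broken orbits. -/
theorem topology_eq (hφ : IsFlowOf φ X) :
    (inferInstance : TopologicalSpace (UnstableHat X x)) =
      sliceTopology (IsTransversalDisc X) (toBrokenOrbit hφ) := by
  simp only [sliceTopology, carrier_toBrokenOrbit, hasSlice_toBrokenOrbit, endpt_toBrokenOrbit]
  rfl

theorem eq_of_carrier_eq [T2Space M] (hφ : IsFlowOf φ X) {c d : UnstableHat X x}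
    (h : c.carrier = d.carrier) (he : c.endpt = d.endpt) : c = d := by
  rw [← carrier_toBrokenOrbit hφ, ← carrier_toBrokenOrbit hφ] at h
  obtain ⟨hl, hpt, hp⟩ := BrokenOrbit.eq_of_carrier_eq h
  simp only [piece_toBrokenOrbit] at hp
  obtain ⟨b, c, hc, m, hm⟩ := c
  obtain ⟨b', d, hd, m', hm'⟩ := d
  have hl' : c.len = d.len := hl
  have hb : b = b' := by
    rw [← c.pt_last, ← d.pt_last]
    refine (hpt (Fin.last _)).trans ?_
    exact congrArg d.pt (Fin.ext hl')
  subst hb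
  simp only at he
  subst he
  have hcd : c = d := BrokenInstanton.eq_of_pieces_eq hφ hl' hpt fun i => by
    refine (Fin.snoc_castSucc (n := c.len) (α := fun _ => Set M) (orbitOn X m univ)
      c.pieces i).symm.trans ((hp i).trans ?_)
    exact Fin.snoc_castSucc (n := d.len) (α := fun _ => Set M) (orbitOn X m univ) d.pieces
      (Fin.cast hl' i)
  subst hcd
  rfl

/-- Each broken orbit comes from an element of the completed unstable set. -/
theorem exists_toBrokenOrbit_eq (hφ : IsFlowOf φ X)
    (b : BrokenOrbit φ (fun p => -(index X p : ℤ)) x) :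
    ∃ c : UnstableHat X x, (c.toBrokenOrbit hφ).carrier = b.carrier ∧
      (c.toBrokenOrbit hφ).endpt = b.endpt := by
  refine ⟨⟨b.pt (Fin.last _), ⟨b.len, b.pt, fun i => hφ.rest_iff.2 (b.fixed i), b.pt_zero, rfl,
    fun i => Instanton.ofPoint hφ (b.rep i.castSucc) (b.tendsto_atBot _) (b.tendsto_atTop i)⟩,
    fun i => ?_, b.endpt, hφ.mem_limitSet_iff.2 (b.tendsto_atBot _)⟩, ?_, ?_⟩
  · have := b.strictMono (Fin.castSucc_lt_succ (i := i))
    simp only [Function.comp_apply] at this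
    show index X (b.pt i.succ) < index X (b.pt i.castSucc)
    omega
  · rw [carrier_toBrokenOrbit, carrier, hφ.orbitOn_eq]
    rfl
  · rw [endpt_toBrokenOrbit]

end UnstableHat
end CompletedSpaces

/-! ### The completed stable set -/

section StableSpaces

/-- Reversal of time reverses the order of the trajectories and of the discs of a slice. -/
theorem IsSliceOf.comp_rev {M : Type*} {D : Set M → Prop} {p r : ℕ} {P : Fin p → Set M}
    {R : Set (Fin p)} {U : Fin r → Set M} (h : IsSliceOf D P R U) :
    IsSliceOf D (P ∘ Fin.rev) (Fin.rev ⁻¹' R) (U ∘ Fin.rev) := by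
  obtain ⟨h1, h2, a, ha, haR, hs⟩ := h
  refine ⟨fun j => h1 _, fun j j' hj => h2 fun h => hj (Fin.rev_injective h),
    fun j => (a j.rev).rev, fun j => ?_, fun i hi => ?_, fun j j' hj => ?_⟩
  · simpa using ha j.rev
  · obtain ⟨j, hj⟩ := haR _ hi
    exact ⟨j.rev, by simp only [Fin.rev_rev, hj]⟩
  · have hj' : (j.rev : ℕ) = j'.rev + 1 := by
      rw [Fin.val_rev, Fin.val_rev]
      omega
    rcases hs _ _ hj' with h | h
    · exact Or.inl (congrArg Fin.rev h.symm)
    · right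
      simp only [Fin.val_rev] at *
      omega

theorem isSliceOf_comp_rev_iff {M : Type*} {D : Set M → Prop} {p r : ℕ} {P : Fin p → Set M}
    {R : Set (Fin p)} {U : Fin r → Set M} :
    IsSliceOf D (P ∘ Fin.rev) (Fin.rev ⁻¹' R) (U ∘ Fin.rev) ↔ IsSliceOf D P R U := by
  refine ⟨fun h => ?_, IsSliceOf.comp_rev⟩
  have h' := h.comp_rev
  simp only [Function.comp_assoc, ← preimage_comp, Fin.rev_involutive.comp_self] at h'
  exact h'

variable {n : ℕ} {M : Type*} [TopologicalSpace M] [ChartedSpace (EuclideanSpace ℝ (Fin n)) M]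
  {X : (m : M) → TangentSpace (𝓡 n) m} {φ : Flow ℝ M} {x y : M}

theorem reverse_orbit (φ : Flow ℝ M) (p : M) :
    (fun t => φ.reverse t p) = (fun t => φ t p) ∘ Neg.neg := rfl

theorem range_reverse (φ : Flow ℝ M) (p : M) :
    (range fun t => φ.reverse t p) = range fun t => φ t p := by
  rw [reverse_orbit, neg_surjective.range_comp]

theorem image_reverse (φ : Flow ℝ M) (p : M) :
    (fun t => φ.reverse t p) '' Iic 0 = (fun t => φ t p) '' Ici 0 := by
  rw [reverse_orbit, image_comp, image_neg_Iic, neg_zero]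

variable [IsManifold (𝓡 n) 1 M] [IsManifold (𝓡 n) ∞ M]

/-- An element of the completed stable set, read backwards, as a broken orbit of the reversed
flow. -/
def StableHat.toBrokenOrbit (hφ : IsFlowOf φ X) (c : StableHat X x) :
    BrokenOrbit φ.reverse (fun p => (index X p : ℤ)) x where
  len := c.chain.len
  pt i := c.chain.pt i.rev
  rep := Fin.snoc (α := fun _ => M) (fun i => (c.chain.inst i.rev).point) c.endpt
  fixed i t := hφ.apply_rest (c.chain.rest i.rev) (-t)
  pt_zero := by rw [Fin.rev_zero, c.chain.pt_last]
  strictMono := Fin.strictMono_iff_lt_succ.2 fun i => by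
    have := c.desc i.rev
    simp only [Function.comp_apply]
    rw [Fin.rev_castSucc, Fin.rev_succ]
    omega
  tendsto_atBot i := by
    rw [reverse_orbit]
    induction i using Fin.lastCases with
    | last =>
      rw [Fin.snoc_last, Fin.rev_last, c.chain.pt_zero]
      exact (hφ.mem_limitSet_iff.1 c.mem).comp tendsto_neg_atBot_atTop
    | cast i =>
      rw [Fin.snoc_castSucc, Fin.rev_castSucc]
      exact ((c.chain.inst i.rev).tendsto_atTop_point hφ).comp tendsto_neg_atBot_atTop
  tendsto_atTop i := by
    rw [reverse_orbit, Fin.snoc_castSucc, Fin.rev_succ]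
    exact ((c.chain.inst i.rev).tendsto_atBot_point hφ).comp tendsto_neg_atTop_atBot

namespace StableHat

theorem endpt_toBrokenOrbit (hφ : IsFlowOf φ X) (c : StableHat X x) :
    (c.toBrokenOrbit hφ).endpt = c.endpt :=
  Fin.snoc_last (n := c.chain.len) (α := fun _ => M) c.endpt
    fun i => (c.chain.inst i.rev).point

theorem piece_toBrokenOrbit_castSucc (hφ : IsFlowOf φ X) (c : StableHat X x)
    (i : Fin c.chain.len) :
    (c.toBrokenOrbit hφ).piece i.castSucc = c.chain.pieces i.rev := by
  have h1 : (c.toBrokenOrbit hφ).rep i.castSucc = (c.chain.inst i.rev).point :=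
    Fin.snoc_castSucc (n := c.chain.len) (α := fun _ => M) c.endpt
      (fun i => (c.chain.inst i.rev).point) i
  refine (congrArg (fun p => range fun t => φ.reverse t p) h1).trans ?_
  rw [range_reverse, ← Instanton.image_eq_range hφ]
  rfl

theorem piece_toBrokenOrbit (hφ : IsFlowOf φ X) (c : StableHat X x) :
    (c.toBrokenOrbit hφ).piece =
      Fin.cons (α := fun _ => Set M) (orbitOn X c.endpt univ) c.chain.pieces ∘ Fin.rev := by
  funext i
  induction i using Fin.lastCases with
  | last =>
    refine Eq.trans ?_ (congrArg (Fin.cons (n := c.chain.len) (α := fun _ => Set M)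
      (orbitOn X c.endpt univ) c.chain.pieces) (Fin.rev_last c.chain.len)).symm
    rw [Fin.cons_zero, hφ.orbitOn_eq, image_univ, ← range_reverse]
    exact congrArg (fun p => range fun t => φ.reverse t p) (c.endpt_toBrokenOrbit hφ)
  | cast i =>
    refine Eq.trans ?_ (congrArg (Fin.cons (n := c.chain.len) (α := fun _ => Set M)
      (orbitOn X c.endpt univ) c.chain.pieces) (Fin.rev_castSucc i)).symm
    exact piece_toBrokenOrbit_castSucc hφ c i

theorem carrier_toBrokenOrbit (hφ : IsFlowOf φ X) (c : StableHat X x) :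
    (c.toBrokenOrbit hφ).carrier = c.carrier := by
  have h2 : (⋃ i : Fin (c.toBrokenOrbit hφ).len, (c.toBrokenOrbit hφ).piece i.castSucc) =
      ⋃ i, c.chain.pieces i := by
    rw [← Fin.rev_surjective.iUnion_comp c.chain.pieces]
    exact iUnion_congr (piece_toBrokenOrbit_castSucc hφ c)
  have h3 : range (c.toBrokenOrbit hφ).pt = range c.chain.pt :=
    Fin.rev_surjective.range_comp c.chain.pt
  rw [BrokenOrbit.carrier, h2, h3, endpt_toBrokenOrbit, carrier, BrokenInstanton.carrier,
    hφ.orbitOn_eq, image_reverse, union_comm]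

theorem hasSlice_toBrokenOrbit (hφ : IsFlowOf φ X) (c : StableHat X x) {r : ℕ}
    {U : Fin r → Set M} :
    (c.toBrokenOrbit hφ).HasSlice (IsTransversalDisc X) (U ∘ Fin.rev) ↔ c.HasSlice U := by
  have hR : (range Fin.castSucc : Set (Fin (c.chain.len + 1))) = Fin.rev ⁻¹' range Fin.succ := by
    ext i
    constructor
    · rintro ⟨j, rfl⟩
      exact ⟨j.rev, (Fin.rev_castSucc j).symm⟩
    · rintro ⟨j, hj⟩
      exact ⟨j.rev, by rw [← Fin.rev_succ, hj, Fin.rev_rev]⟩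
  rw [BrokenOrbit.HasSlice, piece_toBrokenOrbit]
  refine Iff.trans ?_ isSliceOf_comp_rev_iff
  rw [← hR]
  rfl

/-- The transversal slice topology of the completed stable set is the one of broken orbits of the
reversed flow, up to the order of the discs. -/
theorem topology_eq (hφ : IsFlowOf φ X) :
    (inferInstance : TopologicalSpace (StableHat X x)) =
      sliceTopology (IsTransversalDisc X) (toBrokenOrbit hφ) := by
  have hU : ∀ {r : ℕ} (U : Fin r → Set M), (U ∘ Fin.rev) ∘ Fin.rev = U := fun U => by
    rw [Function.comp_assoc, Fin.rev_involutive.comp_self, Function.comp_id]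
  refine congrArg TopologicalSpace.generateFrom (Set.ext fun A => ⟨?_, ?_⟩)
  · rintro ⟨c, V, O, r, U, h⟩
    refine ⟨c, V, O, r, U ∘ Fin.rev, ?_⟩
    simpa only [carrier_toBrokenOrbit, hasSlice_toBrokenOrbit, endpt_toBrokenOrbit] using h
  · rintro ⟨c, V, O, r, U, h⟩
    refine ⟨c, V, O, r, U ∘ Fin.rev, ?_⟩
    simpa only [← hasSlice_toBrokenOrbit hφ, hU, carrier_toBrokenOrbit, endpt_toBrokenOrbit] using h

theorem eq_of_carrier_eq [T2Space M] (hφ : IsFlowOf φ X) {c d : StableHat X x}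
    (h : c.carrier = d.carrier) (he : c.endpt = d.endpt) : c = d := by
  rw [← carrier_toBrokenOrbit hφ, ← carrier_toBrokenOrbit hφ] at h
  obtain ⟨hl, hpt, hp⟩ := BrokenOrbit.eq_of_carrier_eq h
  have hl' : c.chain.len = d.chain.len := hl
  have hpt' : ∀ i, c.chain.pt i = d.chain.pt (Fin.cast (by rw [hl']) i) := fun i => by
    have h1 : c.chain.pt i.rev.rev = d.chain.pt (Fin.cast (by rw [hl']) i.rev).rev := hpt i.rev
    rw [Fin.rev_rev] at h1
    refine h1.trans (congrArg d.chain.pt (Fin.ext ?_))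
    simp only [Fin.val_rev, Fin.val_cast]
    omega
  have hp' : ∀ i, c.chain.pieces i = d.chain.pieces (Fin.cast hl' i) := fun i => by
    have h1 := (piece_toBrokenOrbit_castSucc hφ c i.rev).symm.trans
      ((hp i.rev).trans (piece_toBrokenOrbit_castSucc hφ d (Fin.cast hl' i.rev)))
    rw [Fin.rev_rev] at h1
    refine h1.trans (congrArg d.chain.pieces (Fin.ext ?_))
    simp only [Fin.val_rev, Fin.val_cast]
    omega
  clear h hl hpt hp
  obtain ⟨b, m, hm, c, hc⟩ := c
  obtain ⟨b', m', hm', d, hd⟩ := d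
  have hb : b = b' := by
    rw [← c.pt_zero, ← d.pt_zero]
    exact (hpt' 0).trans (congrArg d.pt (Fin.ext rfl))
  subst hb
  simp only at he
  subst he
  obtain rfl : c = d := BrokenInstanton.eq_of_pieces_eq hφ hl' hpt' hp'
  rfl

/-- Each broken orbit of the reversed flow comes from an element of the completed stable set. -/
theorem exists_toBrokenOrbit_eq (hφ : IsFlowOf φ X)
    (b : BrokenOrbit φ.reverse (fun p => (index X p : ℤ)) x) :
    ∃ c : StableHat X x, (c.toBrokenOrbit hφ).carrier = b.carrier ∧
      (c.toBrokenOrbit hφ).endpt = b.endpt := by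
  have hbot : ∀ i, Tendsto (fun t => φ t (b.rep i)) atTop (𝓝 (b.pt i)) := fun i => by
    refine ((b.tendsto_atBot i).comp tendsto_neg_atTop_atBot).congr fun t => ?_
    exact congrArg (fun s => φ s (b.rep i)) (neg_neg t)
  have htop : ∀ i : Fin b.len, Tendsto (fun t => φ t (b.rep i.castSucc)) atBot
      (𝓝 (b.pt i.succ)) := fun i => by
    refine ((b.tendsto_atTop i).comp tendsto_neg_atBot_atTop).congr fun t => ?_
    exact congrArg (fun s => φ s (b.rep i.castSucc)) (neg_neg t)
  let c : StableHat X x := ⟨b.pt (Fin.last _), b.endpt, hφ.mem_limitSet_iff.2 (hbot _),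
    ⟨b.len, fun i => b.pt i.rev,
      fun i => hφ.rest_iff.2 fun t => by simpa using b.fixed i.rev (-t),
      by rw [Fin.rev_zero], by rw [Fin.rev_last, b.pt_zero],
      fun i => Instanton.ofPoint hφ (b.rep i.rev.castSucc)
        (by rw [Fin.rev_castSucc]; exact htop i.rev)
        (by rw [Fin.rev_succ]; exact hbot _)⟩,
    fun i => by
      have := b.strictMono (Fin.castSucc_lt_succ (i := i.rev))
      simp only [Function.comp_apply] at this
      show index X (b.pt i.succ.rev) < index X (b.pt i.castSucc.rev)
      rw [Fin.rev_castSucc, Fin.rev_succ]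
      omega⟩
  refine ⟨c, ?_, endpt_toBrokenOrbit hφ c⟩
  have h1 : range c.chain.pt = range b.pt := Fin.rev_surjective.range_comp b.pt
  have h2 : (⋃ i, c.chain.pieces i) = ⋃ i : Fin b.len, b.piece i.castSucc := by
    rw [← Fin.rev_surjective.iUnion_comp fun i : Fin b.len => b.piece i.castSucc]
    exact iUnion_congr fun i => (range_reverse φ (b.rep i.rev.castSucc)).symm
  rw [carrier_toBrokenOrbit, carrier, hφ.orbitOn_eq, BrokenInstanton.carrier, h1, h2, union_comm,
    BrokenOrbit.carrier, image_reverse]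

end StableHat
end StableSpaces

/-! ### The completed spaces -/

section Flows

variable {M : Type*} [TopologicalSpace M] {φ : Flow ℝ M}

theorem forall_reverse_iff {p : M} : (∀ t, φ.reverse t p = p) ↔ ∀ t, φ t p = p :=
  (neg_surjective (G := ℝ)).forall (p := fun t => φ t p = p) |>.symm

theorem IsDiscFamily.reverse {D : Set M → Prop} (hD : IsDiscFamily φ D) :
    IsDiscFamily φ.reverse D where
  not_fixed U hU p hp h := hD.not_fixed U hU p hp (forall_reverse_iff.1 h)
  eventually_meets U hU p τ hp := (hD.eventually_meets U hU p (-τ) hp).mono fun _ hq =>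
    neg_surjective.exists.1 hq
  exists_disc p hp := hD.exists_disc p fun h => hp (forall_reverse_iff.2 h)

/-- The limits of trajectories are fixed points. -/
theorem fixed_of_tendsto [T2Space M] {l : Filter ℝ} [NeBot l]
    (hl : ∀ s, Tendsto (fun t => t + s) l l) {u a : M}
    (ha : Tendsto (fun t => φ t u) l (𝓝 a)) (s : ℝ) : φ s a = a := by
  have h1 : Tendsto (fun t => φ s (φ t u)) l (𝓝 (φ s a)) :=
    ((φ.continuous continuous_const continuous_id).tendsto a).comp ha
  refine tendsto_nhds_unique (h1.congr fun t => ?_) (BrokenOrbit.tendsto_orbit hl ha s)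
  rw [← φ.map_add, ← φ.map_add, add_comm]

end Flows

section VectorFields

variable {n : ℕ} {M : Type*} [TopologicalSpace M] [ChartedSpace (EuclideanSpace ℝ (Fin n)) M]
  [IsManifold (𝓡 n) ∞ M] {X : (m : M) → TangentSpace (𝓡 n) m} {φ : Flow ℝ M}

theorem isDiscFamily_isTransversalDisc (hφ : IsFlowOf φ X)
    (hX : ContMDiff (𝓡 n) (𝓡 n).tangent ∞ (fun m => (⟨m, X m⟩ : TangentBundle (𝓡 n) M))) :
    IsDiscFamily φ (IsTransversalDisc X) where
  not_fixed _ hU _ hp h := hU.ne_zero hp (hφ.rest_iff.2 h)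
  eventually_meets _ hU _ _ hp := hU.eventually_meets hφ hp
  exists_disc _ hp _ hW := exists_isTransversalDisc hX (fun h => hp (hφ.rest_iff.1 h)) hW

theorem IsFlowOf.finite_fixed [IsManifold (𝓡 n) 1 M] [T2Space M] [CompactSpace M]
    (hφ : IsFlowOf φ X)
    (hX : ContMDiff (𝓡 n) (𝓡 n).tangent ∞ (fun m => (⟨m, X m⟩ : TangentBundle (𝓡 n) M)))
    (hP1 : AllHyperbolic X) : {p : M | ∀ t, φ t p = p}.Finite := by
  simpa only [hφ.rest_iff] using finite_rest hφ hX hP1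

theorem IsFlowOf.index_lt_of_tendsto [IsManifold (𝓡 n) 1 M] [T2Space M] [CompactSpace M]
    (hφ : IsFlowOf φ X)
    (hX : ContMDiff (𝓡 n) (𝓡 n).tangent ∞ (fun m => (⟨m, X m⟩ : TangentBundle (𝓡 n) M)))
    (hP1 : AllHyperbolic X) (hP2 : AllTransversal X) {u a b : M} (hu : ¬ ∀ t, φ t u = u)
    (ha : Tendsto (fun t => φ t u) atBot (𝓝 a)) (hb : Tendsto (fun t => φ t u) atTop (𝓝 b)) :
    index X b < index X a :=
  index_lt hφ hX hP1 hP2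
    (hφ.rest_iff.2 (fixed_of_tendsto (fun s => tendsto_atBot_add_const_right _ s tendsto_id) ha))
    (hφ.rest_iff.2 (fixed_of_tendsto (fun s => tendsto_atTop_add_const_right _ s tendsto_id) hb))
    ha hb fun h => hu (hφ.rest_iff.1 h)

theorem IsLyapunov.strictAnti {f : M → ℝ} (hf : IsLyapunov X f) (hφ : IsFlowOf φ X) {q : M}
    (hq : ¬ ∀ t, φ t q = q) : StrictAnti fun t => f (φ t q) := by
  have hd : ∀ t, HasDerivAt (fun t => f (φ t q))
      (show ℝ from mfderiv (𝓡 n) 𝓘(ℝ, ℝ) f (φ t q) (X (φ t q))) t := fun t => by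
    have h1 := ((hf.1.mdifferentiableAt (by simp)).hasMFDerivAt).comp t (hφ.integral q t)
    have h2 : HasFDerivAt (fun t => f (φ t q))
        ((show EuclideanSpace ℝ (Fin n) →L[ℝ] ℝ from mfderiv (𝓡 n) 𝓘(ℝ, ℝ) f (φ t q)).comp
          ((1 : ℝ →L[ℝ] ℝ).smulRight (show EuclideanSpace ℝ (Fin n) from X (φ t q)))) t :=
      hasMFDerivAt_iff_hasFDerivAt.1 h1
    refine h2.hasDerivAt.congr_deriv ?_
    rw [ContinuousLinearMap.comp_apply, ContinuousLinearMap.smulRight_apply, one_apply_eq_self,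
      one_smul]
    rfl
  refine strictAnti_of_deriv_neg fun t => ?_
  rw [(hd t).deriv]
  refine hf.2 _ fun h => hq (hφ.rest_iff.1 ?_)
  have h0 := hφ.rest_iff.1 h (-t)
  rw [← φ.map_add, neg_add_cancel, φ.map_zero_apply] at h0
  rw [h0]
  exact h

end VectorFields

/-- If the discs avoid `Q`, then an additional last trajectory `Q` that may, but need not be met
does not change the slices. -/
theorem isSliceOf_snoc_iff {M : Type*} {D : Set M → Prop} {p r : ℕ} {P : Fin p → Set M}
    {Q : Set M} {U : Fin r → Set M} (hQ : ∀ U, D U → Disjoint U Q) :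
    IsSliceOf D (Fin.snoc (α := fun _ => Set M) P Q) (range Fin.castSucc) U ↔
      IsSliceOf D P univ U := by
  constructor
  · rintro ⟨h1, h2, a, ha, haR, hs⟩
    have hex : ∀ j, ∃ i : Fin p, a j = i.castSucc := fun j => by
      have h3 := ha j
      generalize a j = i at h3
      induction i using Fin.lastCases with
      | last =>
        rw [Fin.snoc_last] at h3
        exact absurd (hQ _ (h1 j)) (not_disjoint_iff_nonempty_inter.2 h3)
      | cast i => exact ⟨i, rfl⟩
    choose b hb using hex
    refine ⟨h1, h2, b, fun j => ?_, fun i _ => ?_, fun j j' hj => ?_⟩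
    · have h3 := ha j
      rwa [hb, Fin.snoc_castSucc] at h3
    · obtain ⟨j, hj⟩ := haR _ ⟨i, rfl⟩
      exact ⟨j, Fin.castSucc_injective _ ((hb j).symm.trans hj)⟩
    · have h3 := hs j j' hj
      rw [hb, hb] at h3
      exact h3.imp (fun h => Fin.castSucc_injective _ h) id
  · rintro ⟨h1, h2, a, ha, haR, hs⟩
    refine ⟨h1, h2, fun j => (a j).castSucc, fun j => ?_, ?_, fun j j' hj => ?_⟩
    · rw [Fin.snoc_castSucc]
      exact ha j
    · rintro _ ⟨i, rfl⟩
      obtain ⟨j, rfl⟩ := haR i trivial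
      exact ⟨j, rfl⟩
    · exact (hs j j' hj).imp (congrArg _) id

section Spaces

open TopologicalSpace

theorem metrizableSpace_of_chartedSpace (n : ℕ) (M : Type*) [TopologicalSpace M]
    [ChartedSpace (EuclideanSpace ℝ (Fin n)) M] [T2Space M] [CompactSpace M] :
    MetrizableSpace M := by
  have : SecondCountableTopology M :=
    ChartedSpace.secondCountable_of_sigmaCompact (EuclideanSpace ℝ (Fin n)) M
  exact metrizableSpace_of_t3_secondCountable M

variable {n : ℕ} {M : Type*} [TopologicalSpace M] [ChartedSpace (EuclideanSpace ℝ (Fin n)) M]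
  [IsManifold (𝓡 n) ∞ M] [IsManifold (𝓡 n) 1 M] [T2Space M] [CompactSpace M]
  {X : (m : M) → TangentSpace (𝓡 n) m} {φ : Flow ℝ M} {x y z : M}

theorem t2Space_and_paracompactSpace (S : Type*) [TopologicalSpace S] [MetrizableSpace S] :
    T2Space S ∧ ParacompactSpace S := by
  let _ := metrizableSpaceMetric S
  exact ⟨inferInstance, inferInstance⟩

namespace UnstableHat

theorem isEmbedding (hφ : IsFlowOf φ X)
    (hX : ContMDiff (𝓡 n) (𝓡 n).tangent ∞ (fun m => (⟨m, X m⟩ : TangentBundle (𝓡 n) M)))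
    (hP1 : AllHyperbolic X) :
    IsEmbedding fun c : UnstableHat X x => toCompacts (c.toBrokenOrbit hφ) := by
  refine isEmbedding_toCompacts (isDiscFamily_isTransversalDisc hφ hX)
    (hφ.finite_fixed hX hP1) (topology_eq hφ) fun c d hc he => ?_
  rw [carrier_toBrokenOrbit, carrier_toBrokenOrbit] at hc
  rw [endpt_toBrokenOrbit, endpt_toBrokenOrbit] at he
  exact eq_of_carrier_eq hφ hc he

theorem continuous_endpt
    (hX : ContMDiff (𝓡 n) (𝓡 n).tangent ∞ (fun m => (⟨m, X m⟩ : TangentBundle (𝓡 n) M)))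
    (hP1 : AllHyperbolic X) : Continuous (endpt : UnstableHat X x → M) := by
  obtain ⟨φ, hφ⟩ := exists_isFlowOf hX
  exact (continuous_snd.comp (isEmbedding hφ hX hP1).continuous).congr fun c =>
    endpt_toBrokenOrbit hφ c

theorem metrizableSpace
    (hX : ContMDiff (𝓡 n) (𝓡 n).tangent ∞ (fun m => (⟨m, X m⟩ : TangentBundle (𝓡 n) M)))
    (hP1 : AllHyperbolic X) : MetrizableSpace (UnstableHat X x) := by
  obtain ⟨φ, hφ⟩ := exists_isFlowOf hX
  have := metrizableSpace_of_chartedSpace n M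
  let _ := metrizableSpaceMetric M
  exact (isEmbedding hφ hX hP1).metrizableSpace

theorem compactSpace
    (hX : ContMDiff (𝓡 n) (𝓡 n).tangent ∞ (fun m => (⟨m, X m⟩ : TangentBundle (𝓡 n) M)))
    (hP1 : AllHyperbolic X) (hP2 : AllTransversal X) {f : M → ℝ} (hf : IsLyapunov X f)
    (hx : X x = 0) : CompactSpace (UnstableHat X x) := by
  obtain ⟨φ, hφ⟩ := exists_isFlowOf hX
  have := metrizableSpace_of_chartedSpace n M
  refine compactSpace_of_isInducing (F := fun p => -f p) (isEmbedding hφ hX hP1).isInducing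
    (exists_toBrokenOrbit_eq hφ) (hφ.finite_fixed hX hP1) hf.1.continuous.neg
    (fun q hq => (hf.strictAnti hφ hq).neg) (fun u a b hu ha hb => ?_) (hφ.rest_iff.1 hx)
  have := hφ.index_lt_of_tendsto hX hP1 hP2 hu ha hb
  omega

end UnstableHat

namespace StableHat

theorem isEmbedding (hφ : IsFlowOf φ X)
    (hX : ContMDiff (𝓡 n) (𝓡 n).tangent ∞ (fun m => (⟨m, X m⟩ : TangentBundle (𝓡 n) M)))
    (hP1 : AllHyperbolic X) :
    IsEmbedding fun c : StableHat X x => toCompacts (c.toBrokenOrbit hφ) := by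
  refine isEmbedding_toCompacts (isDiscFamily_isTransversalDisc hφ hX).reverse
    (by simpa only [forall_reverse_iff] using hφ.finite_fixed hX hP1) (topology_eq hφ)
    fun c d hc he => ?_
  rw [carrier_toBrokenOrbit, carrier_toBrokenOrbit] at hc
  rw [endpt_toBrokenOrbit, endpt_toBrokenOrbit] at he
  exact eq_of_carrier_eq hφ hc he

theorem continuous_endpt
    (hX : ContMDiff (𝓡 n) (𝓡 n).tangent ∞ (fun m => (⟨m, X m⟩ : TangentBundle (𝓡 n) M)))
    (hP1 : AllHyperbolic X) : Continuous (endpt : StableHat X x → M) := by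
  obtain ⟨φ, hφ⟩ := exists_isFlowOf hX
  exact (continuous_snd.comp (isEmbedding hφ hX hP1).continuous).congr fun c =>
    endpt_toBrokenOrbit hφ c

theorem metrizableSpace
    (hX : ContMDiff (𝓡 n) (𝓡 n).tangent ∞ (fun m => (⟨m, X m⟩ : TangentBundle (𝓡 n) M)))
    (hP1 : AllHyperbolic X) : MetrizableSpace (StableHat X x) := by
  obtain ⟨φ, hφ⟩ := exists_isFlowOf hX
  have := metrizableSpace_of_chartedSpace n M
  let _ := metrizableSpaceMetric M
  exact (isEmbedding hφ hX hP1).metrizableSpace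

theorem compactSpace
    (hX : ContMDiff (𝓡 n) (𝓡 n).tangent ∞ (fun m => (⟨m, X m⟩ : TangentBundle (𝓡 n) M)))
    (hP1 : AllHyperbolic X) (hP2 : AllTransversal X) {f : M → ℝ} (hf : IsLyapunov X f)
    (hx : X x = 0) : CompactSpace (StableHat X x) := by
  obtain ⟨φ, hφ⟩ := exists_isFlowOf hX
  have := metrizableSpace_of_chartedSpace n M
  refine compactSpace_of_isInducing (F := f) (isEmbedding hφ hX hP1).isInducing
    (exists_toBrokenOrbit_eq hφ)
    (by simpa only [forall_reverse_iff] using hφ.finite_fixed hX hP1) hf.1.continuous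
    (fun q hq s t hst => ?_) (fun u a b hu ha hb => ?_) (forall_reverse_iff.2 (hφ.rest_iff.1 hx))
  · exact hf.strictAnti hφ (fun h => hq (forall_reverse_iff.2 h)) (neg_lt_neg hst)
  · refine Int.ofNat_lt.2 (hφ.index_lt_of_tendsto hX hP1 hP2 (u := u)
      (fun h => hu (forall_reverse_iff.2 h)) ?_ ?_)
    · exact (hb.comp tendsto_neg_atBot_atTop).congr fun t => congrArg (fun s => φ s u) (neg_neg t)
    · exact (ha.comp tendsto_neg_atTop_atBot).congr fun t => congrArg (fun s => φ s u) (neg_neg t)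

end StableHat

namespace THat

/-- The index decreases along a broken instanton between different rest points. For at least two
pieces this is part of the definition; for a single piece it follows from transversality. -/
theorem descending (hφ : IsFlowOf φ X)
    (hX : ContMDiff (𝓡 n) (𝓡 n).tangent ∞ (fun m => (⟨m, X m⟩ : TangentBundle (𝓡 n) M)))
    (hP1 : AllHyperbolic X) (hP2 : AllTransversal X) (hxy : x ≠ y) (c : THat X x y) :
    c.1.Descending := by
  by_cases hlen : 2 ≤ c.1.len
  · exact c.2.2 hlen
  intro i
  have h0 : i.castSucc = 0 := Fin.ext (by simp; omega)
  have h1 : i.succ = Fin.last _ := Fin.ext (by simp; omega)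
  have ha := (c.1.inst i).tendsto_atBot_point hφ
  have hb := (c.1.inst i).tendsto_atTop_point hφ
  refine hφ.index_lt_of_tendsto hX hP1 hP2 (fun h => hxy ?_) ha hb
  simp only [h] at ha hb
  have h2 : c.1.pt i.castSucc = c.1.pt i.succ :=
    (tendsto_nhds_unique ha tendsto_const_nhds).trans
      (tendsto_nhds_unique hb tendsto_const_nhds).symm
  rwa [h0, h1, c.1.pt_zero, c.1.pt_last] at h2

/-- The index decreases along a nonconstant trajectory, so a broken instanton from `x` to itself is
the constant one. -/
theorem subsingleton_self
    (hX : ContMDiff (𝓡 n) (𝓡 n).tangent ∞ (fun m => (⟨m, X m⟩ : TangentBundle (𝓡 n) M)))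
    (hP1 : AllHyperbolic X) (hP2 : AllTransversal X) : Subsingleton (THat X x x) := by
  obtain ⟨φ, hφ⟩ := exists_isFlowOf hX
  have hlen : ∀ c : THat X x x, c.1.len = 1 := fun c => by
    by_contra hne
    have hpos := c.2.1
    have h1 := (c.2.2 (by omega)).strictMono
      (show (0 : Fin (c.1.len + 1)) < Fin.last _ from Fin.lt_def.2 (by simp; omega))
    simp only [Function.comp_apply, c.1.pt_zero, c.1.pt_last, lt_irrefl] at h1
  have hpt : ∀ (c : THat X x x) i, c.1.pt i = x := fun c i => by
    have hl := hlen c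
    induction i using Fin.lastCases with
    | last => exact c.1.pt_last
    | cast i => rw [show i.castSucc = 0 from Fin.ext (by simp; omega), c.1.pt_zero]
  have hpiece : ∀ (c : THat X x x) i, c.1.pieces i = {x} := fun c i => by
    have ha := (c.1.inst i).tendsto_atBot_point hφ
    have hb := (c.1.inst i).tendsto_atTop_point hφ
    have hfix : ∀ t, φ t (c.1.inst i).point = (c.1.inst i).point := by
      by_contra h
      have h1 := hφ.index_lt_of_tendsto hX hP1 hP2 h ha hb
      rw [hpt, hpt] at h1
      exact lt_irrefl _ h1
    simp only [hfix] at ha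
    have h2 : x = (c.1.inst i).point :=
      (hpt c _).symm.trans (tendsto_nhds_unique ha tendsto_const_nhds)
    rw [BrokenInstanton.pieces, Instanton.image_eq_range hφ,
      show (fun t => φ t (c.1.inst i).point) = fun _ => x from
        funext fun t => (hfix t).trans h2.symm, range_const]
  refine ⟨fun c d => Subtype.ext (BrokenInstanton.eq_of_pieces_eq hφ ((hlen c).trans (hlen d).symm)
    (fun i => ?_) fun i => ?_)⟩
  · rw [hpt, hpt]
  · rw [hpiece, hpiece]

/-- A broken instanton from `x` to `y` as the element of the completed unstable set whose end point
is the rest point `y`. -/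
def toUnstableHat (hφ : IsFlowOf φ X) (hy : X y = 0) (hdesc : ∀ c : THat X x y, c.1.Descending)
    (c : THat X x y) : UnstableHat X x :=
  ⟨y, c.1, hdesc c, y, hφ.mem_limitSet_iff.2 (by
    simp only [hφ.apply_rest hy]
    exact tendsto_const_nhds)⟩

theorem orbitOn_rest (hφ : IsFlowOf φ X) (hy : X y = 0) {S : Set ℝ} (hS : S.Nonempty) :
    orbitOn X y S = {y} := by
  rw [hφ.orbitOn_eq]
  simp only [hφ.apply_rest hy, hS.image_const]

/-- The slice topology on `THat X x y` is induced from the completed unstable set: discs do not meet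
the constant trajectory at the rest point `y`. -/
theorem isInducing_toUnstableHat (hφ : IsFlowOf φ X) (hy : X y = 0)
    (hdesc : ∀ c : THat X x y, c.1.Descending) : IsInducing (toUnstableHat hφ hy hdesc) := by
  have hcar : ∀ c, (toUnstableHat hφ hy hdesc c).carrier = c.1.carrier := fun c => by
    have hyc : y ∈ c.1.carrier := Or.inl ⟨Fin.last _, c.1.pt_last⟩
    rw [UnstableHat.carrier, toUnstableHat, orbitOn_rest hφ hy nonempty_Iic]
    exact union_eq_self_of_subset_right (singleton_subset_iff.2 hyc)
  have hslice : ∀ (c : THat X x y) {r : ℕ} (U : Fin r → Set M),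
      (toUnstableHat hφ hy hdesc c).HasSlice U ↔ c.HasSlice U := fun c r U => by
    refine isSliceOf_snoc_iff (D := IsTransversalDisc X) (P := c.1.pieces) fun U hU => ?_
    rw [toUnstableHat, orbitOn_rest hφ hy univ_nonempty, disjoint_singleton_right]
    exact fun hyU => hU.ne_zero hyU hy
  refine ⟨le_antisymm (continuous_iff_le_induced.1 (continuous_generateFrom_iff.2 ?_))
    (le_generateFrom ?_)⟩
  · rintro _ ⟨c, V, O, r, U, hV, -, hO, -, -, rfl⟩
    rcases eq_empty_or_nonempty (toUnstableHat hφ hy hdesc ⁻¹'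
      {d | d.carrier ⊆ V ∧ d.HasSlice U ∧ d.endpt ∈ O}) with hne | ⟨d, hd, hdU, hyO⟩
    · rw [hne]
      exact isOpen_empty
    · refine isOpen_generateFrom_of_mem ⟨d, V, r, U, hV, (hcar d).symm.trans_subset hd,
        (hslice d U).1 hdU, Set.ext fun e => ?_⟩
      change _ ∧ _ ∧ _ ↔ _ ∧ _
      rw [hcar, hslice]
      exact and_congr_right fun _ => and_iff_left hyO
  · rintro _ ⟨c, V, r, U, hV, hc, hU, rfl⟩
    refine isOpen_induced_iff.2 ⟨_, isOpen_generateFrom_of_mem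
      ⟨toUnstableHat hφ hy hdesc c, V, univ, r, U, hV, (hcar c).trans_subset hc, isOpen_univ,
        mem_univ _, (hslice c U).2 hU, rfl⟩, ?_⟩
    refine Set.ext fun d => ?_
    change _ ∧ _ ∧ _ ↔ _ ∧ _
    rw [hcar, hslice]
    exact and_congr_right fun _ => and_iff_left trivial

theorem isClosedEmbedding_toUnstableHat (hφ : IsFlowOf φ X)
    (hX : ContMDiff (𝓡 n) (𝓡 n).tangent ∞ (fun m => (⟨m, X m⟩ : TangentBundle (𝓡 n) M)))
    (hP1 : AllHyperbolic X) (hxy : x ≠ y) (hy : X y = 0)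
    (hdesc : ∀ c : THat X x y, c.1.Descending) :
    IsClosedEmbedding (toUnstableHat hφ hy hdesc) := by
  refine ⟨⟨isInducing_toUnstableHat hφ hy hdesc, fun c d hcd => ?_⟩, ?_⟩
  · exact Subtype.ext (eq_of_heq (UnstableHat.mk.inj hcd).2.1)
  -- The image is the set where the end point is `y`: a rest point lies in its own unstable set
  -- only.
  · have hr : range (toUnstableHat hφ hy hdesc) = {u | u.endpt = y} := by
      ext u
      constructor
      · rintro ⟨c, rfl⟩
        rfl
      · obtain ⟨b, c, hc, m, hm⟩ := u
        rintro (rfl : m = y)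
        have hb : b = m := by
          have h1 := hφ.mem_limitSet_iff.1 hm
          simp only [hφ.apply_rest hy] at h1
          exact tendsto_nhds_unique h1 tendsto_const_nhds
        subst hb
        have hlen : 1 ≤ c.len := by
          by_contra h
          refine hxy (c.pt_zero.symm.trans (Eq.trans ?_ c.pt_last))
          exact congrArg c.pt (Fin.ext (by simp; omega))
        exact ⟨⟨c, hlen, fun _ => hc⟩, rfl⟩
    rw [hr]
    exact isClosed_eq (UnstableHat.continuous_endpt hX hP1) continuous_const

theorem t2Space_and_paracompactSpace
    (hX : ContMDiff (𝓡 n) (𝓡 n).tangent ∞ (fun m => (⟨m, X m⟩ : TangentBundle (𝓡 n) M)))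
    (hP1 : AllHyperbolic X) (hP2 : AllTransversal X) (hy : X y = 0) :
    T2Space (THat X x y) ∧ ParacompactSpace (THat X x y) := by
  by_cases hxy : x = y
  · subst hxy
    have := subsingleton_self (x := x) hX hP1 hP2
    exact ⟨⟨fun c d hcd => absurd (Subsingleton.elim c d) hcd⟩, inferInstance⟩
  · obtain ⟨φ, hφ⟩ := exists_isFlowOf hX
    have := UnstableHat.metrizableSpace (x := x) hX hP1
    have := (isClosedEmbedding_toUnstableHat hφ hX hP1 hxy hy
      (descending hφ hX hP1 hP2 hxy)).isEmbedding.metrizableSpace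
    exact BrokenFlow.t2Space_and_paracompactSpace _

theorem compactSpace
    (hX : ContMDiff (𝓡 n) (𝓡 n).tangent ∞ (fun m => (⟨m, X m⟩ : TangentBundle (𝓡 n) M)))
    (hP1 : AllHyperbolic X) (hP2 : AllTransversal X) {f : M → ℝ} (hf : IsLyapunov X f)
    (hx : X x = 0) (hy : X y = 0) : CompactSpace (THat X x y) := by
  by_cases hxy : x = y
  · subst hxy
    have := subsingleton_self (x := x) hX hP1 hP2
    infer_instance
  · obtain ⟨φ, hφ⟩ := exists_isFlowOf hX
    have := UnstableHat.compactSpace hX hP1 hP2 hf hx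
    exact (isClosedEmbedding_toUnstableHat hφ hX hP1 hxy hy
      (descending hφ hX hP1 hP2 hxy)).compactSpace

end THat

namespace MHat

/-- `MHat X x z` is the closed subspace of the product where the end points agree. -/
theorem isClosedEmbedding_toProd
    (hX : ContMDiff (𝓡 n) (𝓡 n).tangent ∞ (fun m => (⟨m, X m⟩ : TangentBundle (𝓡 n) M)))
    (hP1 : AllHyperbolic X) : IsClosedEmbedding (toProd : MHat X x z → _) := by
  refine ⟨⟨⟨rfl⟩, ?_⟩, ?_⟩
  · rintro ⟨⟩ ⟨⟩ h
    simp only [toProd, Prod.mk.injEq, UnstableHat.mk.injEq, StableHat.mk.injEq] at h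
    obtain ⟨⟨rfl, h1, rfl⟩, rfl, -, h2⟩ := h
    cases h1
    cases h2
    rfl
  · have hr : range (toProd : MHat X x z → _) = {p | p.1.endpt = p.2.endpt} := by
      ext ⟨u, v⟩
      constructor
      · rintro ⟨c, hc⟩
        rw [← hc]
        rfl
      · obtain ⟨b, c, hc, m, hm⟩ := u
        obtain ⟨b', m', hm', c', hc'⟩ := v
        rintro (rfl : m = m')
        exact ⟨⟨b, b', c, hc, m, ⟨hm, hm'⟩, c', hc'⟩, rfl⟩
    rw [hr]
    exact isClosed_eq ((UnstableHat.continuous_endpt hX hP1).comp continuous_fst)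
      ((StableHat.continuous_endpt hX hP1).comp continuous_snd)

theorem t2Space_and_paracompactSpace
    (hX : ContMDiff (𝓡 n) (𝓡 n).tangent ∞ (fun m => (⟨m, X m⟩ : TangentBundle (𝓡 n) M)))
    (hP1 : AllHyperbolic X) : T2Space (MHat X x z) ∧ ParacompactSpace (MHat X x z) := by
  have := UnstableHat.metrizableSpace (x := x) hX hP1
  have := StableHat.metrizableSpace (x := z) hX hP1
  have := (isClosedEmbedding_toProd (x := x) (z := z) hX hP1).isEmbedding.metrizableSpace
  exact BrokenFlow.t2Space_and_paracompactSpace _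

theorem continuous_toManifold
    (hX : ContMDiff (𝓡 n) (𝓡 n).tangent ∞ (fun m => (⟨m, X m⟩ : TangentBundle (𝓡 n) M)))
    (hP1 : AllHyperbolic X) : Continuous (toManifold : MHat X x z → M) :=
  ((UnstableHat.continuous_endpt hX hP1).comp continuous_fst).comp
    (isClosedEmbedding_toProd hX hP1).continuous

theorem compactSpace
    (hX : ContMDiff (𝓡 n) (𝓡 n).tangent ∞ (fun m => (⟨m, X m⟩ : TangentBundle (𝓡 n) M)))
    (hP1 : AllHyperbolic X) (hP2 : AllTransversal X) {f : M → ℝ} (hf : IsLyapunov X f)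
    (hx : X x = 0) (hz : X z = 0) : CompactSpace (MHat X x z) := by
  have := UnstableHat.compactSpace hX hP1 hP2 hf hx
  have := StableHat.compactSpace hX hP1 hP2 hf hz
  exact (isClosedEmbedding_toProd hX hP1).compactSpace

end MHat
end Spaces

end BrokenFlow

end


open BrokenFlow in
theorem theorem1p3 {n : ℕ} {M : Type*} [TopologicalSpace M]
    [ChartedSpace (EuclideanSpace ℝ (Fin n)) M] [IsManifold (𝓡 n) ∞ M]
    [T2Space M] [CompactSpace M] (X : (m : M) → TangentSpace (𝓡 n) m)
    (hX : ContMDiff (𝓡 n) (𝓡 n).tangent ∞ (fun m => (⟨m, X m⟩ : TangentBundle (𝓡 n) M)))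
    (hP1 : BrokenFlow.AllHyperbolic X) (hP2 : BrokenFlow.AllTransversal X) :
    ((∀ x : M, X x = 0 →
        (T2Space (BrokenFlow.UnstableHat X x) ∧ ParacompactSpace (BrokenFlow.UnstableHat X x)) ∧
        (T2Space (BrokenFlow.StableHat X x) ∧ ParacompactSpace (BrokenFlow.StableHat X x)) ∧
        Continuous (BrokenFlow.UnstableHat.toManifold : BrokenFlow.UnstableHat X x → M)) ∧
      (∀ x y : M, X x = 0 → X y = 0 →
        T2Space (BrokenFlow.THat X x y) ∧ ParacompactSpace (BrokenFlow.THat X x y)) ∧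
      (∀ x z : M, X x = 0 → X z = 0 →
        (T2Space (BrokenFlow.MHat X x z) ∧ ParacompactSpace (BrokenFlow.MHat X x z)) ∧
        Continuous (BrokenFlow.MHat.toManifold : BrokenFlow.MHat X x z → M))) ∧
    ((∃ f : M → ℝ, BrokenFlow.IsLyapunov X f) →
      (∀ x : M, X x = 0 →
        CompactSpace (BrokenFlow.UnstableHat X x) ∧ CompactSpace (BrokenFlow.StableHat X x)) ∧
      (∀ x y : M, X x = 0 → X y = 0 → CompactSpace (BrokenFlow.THat X x y)) ∧
      (∀ x z : M, X x = 0 → X z = 0 → CompactSpace (BrokenFlow.MHat X x z))) := by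
  refine ⟨⟨fun x _ => ⟨?_, ?_, UnstableHat.continuous_endpt hX hP1⟩, fun x y _ hy =>
    THat.t2Space_and_paracompactSpace hX hP1 hP2 hy, fun x z _ _ =>
    ⟨MHat.t2Space_and_paracompactSpace hX hP1, MHat.continuous_toManifold hX hP1⟩⟩, ?_⟩
  · have := UnstableHat.metrizableSpace (x := x) hX hP1
    exact t2Space_and_paracompactSpace _
  · have := StableHat.metrizableSpace (x := x) hX hP1
    exact t2Space_and_paracompactSpace _
  · rintro ⟨f, hf⟩
    exact ⟨fun x hx => ⟨UnstableHat.compactSpace hX hP1 hP2 hf hx,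
        StableHat.compactSpace hX hP1 hP2 hf hx⟩,
      fun x y hx hy => THat.compactSpace hX hP1 hP2 hf hx hy,
      fun x z hx hz => MHat.compactSpace hX hP1 hP2 hf hx hz⟩
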